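/- **Model.** Let $K,d\ge 1$. In round $k\in[K]$ an arbitrary (possibly random, history-dependent) arm set $\mathcal D_k\subseteq\mathbb R^d$ is revealed, the learner plays $a_k\in\mathcal D_k$ and receives $r_k=\langle\theta_k,a_k\rangle+\epsilon_k$, where $\theta_1,\dots,\theta_K$ are unknown vectors fixed in advance. For constants $A,B,R\ge 0$ assume $\|\theta_k\|_2\le B$, and $\|a\|_2\le A$, $\langle a,\theta_k\rangle\in[-1,1]$ for all $a\in\mathcal D_k$; almost surely $|\epsilon_k|\le R$, $\mathbb E[\epsilon_k\mid a_{1:k},\epsilon_{1:k-1}]=0$, $\mathbb E[\epsilon_k^2\mid a_{1:k},\epsilon_{1:k-1}]=\sigma_k^2$; $\sum_{k=1}^{K-1}\|\theta_{k+1}-\theta_k\|_2\le B_K$ and $\sum_{k=1}^K\sigma_k^2\le V_K$ almost surely. The variances $\sigma_k^2$ are not revealed. The dynamic regret is $\mathrm{Regret}(K)=\sum_{k=1}^K\big(\sup_{a\in\mathcal D_k}\langle a,\theta_k\rangle-\langle a_k,\theta_k\rangle\big)$. For a positive semidefinite matrix $M$ write $\|x\|_M=\sqrt{x^\top Mx}$.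 **Algorithm (Restarted SAVE$^+$ with parameters $\alpha>0$, $w\in\mathbb N_{\ge1}$, $R$, $B$, $\delta$).** Let $L=\lceil\log_2(1/\alpha)\rceil$ (read as $0$ if $\alpha\ge1$). At round $1$, and again at the beginning of every round $k$ divisible by $w$, set $\hat\Sigma_{k,\ell}=2^{-2\ell}I$, $\hat b_{k,\ell}=0$, $\hat\Psi_{k,\ell}=\emptyset$ for all layers $\ell$. In round $k$, with $\hat\theta_{k,\ell}=\hat\Sigma_{k,\ell}^{-1}\hat b_{k,\ell}$, play $$a_k\in\arg\max_{a\in\mathcal D_k}\ \min_{\ell\in[L]}\ \langle a,\hat\theta_{k,\ell}\rangle+\hat\beta_{k,\ell}\|a\|_{\hat\Sigma_{k,\ell}^{-1}}$$ (ties broken arbitrarily; any arm may be played if $L=0$). Let $\ell_k$ be the least $\ell\in[L]$ with $\|a_k\|_{\hat\Sigma_{k,\ell}^{-1}}\ge2^{-\ell}$, and $\ell_k=L+1$ if there is none. Add $k$ to $\hat\Psi_{\ell_k}$. If $\ell_k\le L$, put $w_k=2^{-\ell_k}/\|a_k\|_{\hat\Sigma_{k,\ell_k}^{-1}}$, add $w_k^2a_ka_k^\top$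 to $\hat\Sigma_{\ell_k}$ and $w_k^2r_ka_k$ to $\hat b_{\ell_k}$. All other quantities are unchanged. For all $k$ and $\ell\in[L]$ the confidence radius is $$\hat\beta_{k,\ell}=16\cdot2^{-\ell}\sqrt{8\widehat{\mathrm{Var}}_{k,\ell}+6R^2\log\tfrac{4(w+1)^2L}{\delta}+2^{-2\ell+4}}\sqrt{\log\tfrac{4w^2L}{\delta}}+6\cdot2^{-\ell}R\log\tfrac{4w^2L}{\delta}+2^{-\ell}B,$$ where $\widehat{\mathrm{Var}}_{k,\ell}=\sum_{i\in\hat\Psi_{k,\ell}}w_i^2(r_i-\langle\hat\theta_{k,\ell},a_i\rangle)^2$ if $2^\ell\ge64\sqrt{\log(4(w+1)^2L/\delta)}$, and $\widehat{\mathrm{Var}}_{k,\ell}=R^2|\hat\Psi_{k,\ell}|$ otherwise. **Claim.** For all constants $A,B,R\ge0$ and $c_0,c_1>0$ there are $C>0$ and $p\in\mathbb N$, depending only on these, such that the following holds for all $d,K\ge1$, all $B_K,V_K\in[c_0,c_1K]$, all $\delta\in(0,1)$ and every model as above. Choose $$w=\begin{cases}\big\lceil d^{1/3}(K/B_K)^{1/3}\big\rceil,&K^2\ge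 V_K^3d/B_K,\\[2pt]\big\lceil d^{2/5}(KV_K)^{1/5}/B_K^{2/5}\big\rceil,&\text{otherwise,}\end{cases}\qquad \alpha=\frac{d^{1/6}\sqrt w\,B_K^{1/3}}{K^{1/3}+(V_KKw)^{1/6}}.$$ Then with probability at least $1-3\delta$ the regret of Restarted SAVE$^+$ satisfies $$\mathrm{Regret}(K)\le C\,\big(1+\log(K/\delta)\big)^p\,\Big(d^{4/5}V_K^{2/5}B_K^{1/5}K^{2/5}+d^{2/3}B_K^{1/3}K^{2/3}\Big),$$ that is, $\mathrm{Regret}(K)=\tilde O\big(d^{4/5}V_K^{2/5}B_K^{1/5}K^{2/5}+d^{2/3}B_K^{1/3}K^{2/3}\big)$. -/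

import Mathlib

open MeasureTheory ProbabilityTheory
open scoped Matrix

noncomputable section

namespace RestartedSAVE

/-- The weighted Euclidean norm `‖x‖_M = √(xᵀ M x)`. -/
def matNorm {d : ℕ} (M : Matrix (Fin d) (Fin d) ℝ) (x : EuclideanSpace ℝ (Fin d)) : ℝ :=
  Real.sqrt (x.ofLp ⬝ᵥ (M *ᵥ x.ofLp))

/-! ### The algorithm -/

/-- What the learner stores, for every layer `ℓ`: the covariance matrix, the vector `b`, and the
set `Ψ` of rounds (since the last restart) that were assigned to this layer. Moreover `weight t`
is the regression weight of a round `t` that was assigned to one of the layers `1, …, L`. -/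
structure State (d : ℕ) where
  cov : ℕ → Matrix (Fin d) (Fin d) ℝ
  vec : ℕ → (Fin d → ℝ)
  rounds : ℕ → Finset ℕ
  weight : ℕ → ℝ

/-- The state after a (re)start: `Σ_ℓ = 2^{-2ℓ} I`, `b_ℓ = 0`, `Ψ_ℓ = ∅`. -/
def State.init (d : ℕ) : State d where
  cov ℓ := (2 : ℝ) ^ (-2 * (ℓ : ℤ)) • (1 : Matrix (Fin d) (Fin d) ℝ)
  vec _ := 0
  rounds _ := ∅
  weight _ := 0

/-- The estimate `θ̂_ℓ = Σ_ℓ⁻¹ b_ℓ`. -/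
def State.theta {d : ℕ} (s : State d) (ℓ : ℕ) : EuclideanSpace ℝ (Fin d) :=
  WithLp.toLp 2 ((s.cov ℓ)⁻¹ *ᵥ s.vec ℓ)

/-- The layer of an arm `x`: the least `ℓ ∈ {1, …, L}` with `‖x‖_{Σ_ℓ⁻¹} ≥ 2^{-ℓ}`, and `L + 1`
if there is none. -/
def State.layer {d : ℕ} (s : State d) (L : ℕ) (x : EuclideanSpace ℝ (Fin d)) : ℕ :=
  let S := (Finset.Icc 1 L).filter
    (fun ℓ : ℕ => (2 : ℝ) ^ (-(ℓ : ℤ)) ≤ matNorm (s.cov ℓ)⁻¹ x)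
  if h : S.Nonempty then S.min' h else L + 1

/-- The update at the end of round `k`, in which arm `x` was played and reward `y` was received. -/
def State.update {d : ℕ} (s : State d) (L k : ℕ) (x : EuclideanSpace ℝ (Fin d)) (y : ℝ) :
    State d :=
  let j := s.layer L x
  let wt : ℝ := (2 : ℝ) ^ (-(j : ℤ)) / matNorm (s.cov j)⁻¹ x
  { cov := fun ℓ =>
      if ℓ = j ∧ j ≤ L then s.cov ℓ + wt ^ 2 • Matrix.vecMulVec x.ofLp x.ofLp else s.cov ℓ
    vec := fun ℓ => if ℓ = j ∧ j ≤ L then s.vec ℓ + (wt ^ 2 * y) • x.ofLp else s.vec ℓ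
    rounds := fun ℓ => if ℓ = j then insert k (s.rounds ℓ) else s.rounds ℓ
    weight := fun t => if t = k ∧ j ≤ L then wt else s.weight t }

/-- The state at the beginning of round `k ≥ 1` (after the restart, if there is one), when the
arms `a 1, …, a (k-1)` were played and the rewards `r 1, …, r (k-1)` were received. The learner
starts at round `1` and restarts at every round divisible by `w`. -/
def state {d : ℕ} (w L : ℕ) (a : ℕ → EuclideanSpace ℝ (Fin d)) (r : ℕ → ℝ) : ℕ → State d
  | 0 => State.init d
  | k + 1 =>
    if k = 0 ∨ (k + 1) % w = 0 then State.init d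
    else (state w L a r k).update L k (a k) (r k)

/-- The variance estimate of layer `ℓ` at the beginning of round `k`. -/
def varHat {d : ℕ} (R δ : ℝ) (w L : ℕ) (a : ℕ → EuclideanSpace ℝ (Fin d)) (r : ℕ → ℝ)
    (k ℓ : ℕ) : ℝ :=
  let s := state w L a r k
  if 64 * Real.sqrt (Real.log (4 * ((w : ℝ) + 1) ^ 2 * L / δ)) ≤ (2 : ℝ) ^ ℓ then
    ∑ i ∈ s.rounds ℓ, s.weight i ^ 2 * (r i - inner ℝ (s.theta ℓ) (a i)) ^ 2
  else R ^ 2 * ((s.rounds ℓ).card : ℝ)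

/-- The confidence radius of layer `ℓ` at round `k`. Here `B` bounds the norms of the feature
vectors. -/
def betaHat {d : ℕ} (R B δ : ℝ) (w L : ℕ) (a : ℕ → EuclideanSpace ℝ (Fin d)) (r : ℕ → ℝ)
    (k ℓ : ℕ) : ℝ :=
  16 * (2 : ℝ) ^ (-(ℓ : ℤ)) *
      Real.sqrt (8 * varHat R δ w L a r k ℓ
        + 6 * R ^ 2 * Real.log (4 * ((w : ℝ) + 1) ^ 2 * L / δ) + (2 : ℝ) ^ (-2 * (ℓ : ℤ) + 4)) *
      Real.sqrt (Real.log (4 * (w : ℝ) ^ 2 * L / δ))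
    + 6 * (2 : ℝ) ^ (-(ℓ : ℤ)) * R * Real.log (4 * (w : ℝ) ^ 2 * L / δ)
    + (2 : ℝ) ^ (-(ℓ : ℤ)) * B

/-- The index of an arm `x` at round `k`: the minimum over the layers `ℓ ∈ {1, …, L}` of the upper
confidence bounds `⟨x, θ̂_{k,ℓ}⟩ + β̂_{k,ℓ} ‖x‖_{Σ_{k,ℓ}⁻¹}`. For `L = 0` the index is the
constant `0`, so that every arm is allowed. -/
def index {d : ℕ} (R B δ : ℝ) (w L : ℕ) (a : ℕ → EuclideanSpace ℝ (Fin d)) (r : ℕ → ℝ)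
    (k : ℕ) (x : EuclideanSpace ℝ (Fin d)) : ℝ :=
  ⨅ ℓ : Set.Icc 1 L,
    (inner ℝ x ((state w L a r k).theta ℓ)
      + betaHat R B δ w L a r k ℓ * matNorm ((state w L a r k).cov ℓ)⁻¹ x)

/-- The number of layers, `L = ⌈log₂ (1/α)⌉` (and `0` if `α ≥ 1`). -/
def numLayers (α : ℝ) : ℕ := ⌈Real.logb 2 (1 / α)⌉₊

/-- `a` is a sequence of arms that Restarted SAVE⁺ with parameters `α`, `w`, norm bound `B`, noise
bound `R` and confidence parameter `δ` may play in rounds `1, …, K`, when `D k` is the arm set and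
`r k` the reward of round `k`; ties are broken arbitrarily. -/
def IsPlay {d : ℕ} (R B δ α : ℝ) (w K : ℕ) (D : ℕ → Set (EuclideanSpace ℝ (Fin d)))
    (a : ℕ → EuclideanSpace ℝ (Fin d)) (r : ℕ → ℝ) : Prop :=
  ∀ k ∈ Finset.Icc 1 K, a k ∈ D k ∧
    ∀ x ∈ D k, index R B δ w (numLayers α) a r k x ≤ index R B δ w (numLayers α) a r k (a k)

/-! ### The environment -/

/-- The σ-algebra generated by the arms `a 1, …, a k` and the noises `ε 1, …, ε (k-1)`. -/
@[reducible] def history {Ω : Type*} {d : ℕ} (a : ℕ → Ω → EuclideanSpace ℝ (Fin d)) (ε : ℕ → Ω → ℝ) (k : ℕ) :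
    MeasurableSpace Ω :=
  (⨆ t ∈ Finset.Icc 1 k, MeasurableSpace.comap (a t) inferInstance) ⊔
    (⨆ t ∈ Finset.Icc 1 (k - 1), MeasurableSpace.comap (ε t) inferInstance)

/-- The reward `r_k = ⟨θ_k, a_k⟩ + ε_k`. -/
def reward {Ω : Type*} {d : ℕ} (θ : ℕ → EuclideanSpace ℝ (Fin d))
    (a : ℕ → Ω → EuclideanSpace ℝ (Fin d)) (ε : ℕ → Ω → ℝ) (ω : Ω) (k : ℕ) : ℝ :=
  inner ℝ (θ k) (a k ω) + ε k ω

/-- The non-stationary heteroscedastic linear bandit over the rounds `1, …, K`. The feature vectors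
`θ k` are fixed in advance, the arm sets `D k` are arbitrary (possibly random and depending on the
past), `a k` is the arm played and `ε k` the noise. The variance `σ k ^ 2` may be random, since the
noise may depend on the arm. -/
structure IsEnvironment {Ω : Type*} [MeasurableSpace Ω] (μ : Measure Ω) {d : ℕ} (K : ℕ)
    (A R B BK VK : ℝ) (θ : ℕ → EuclideanSpace ℝ (Fin d))
    (D : ℕ → Ω → Set (EuclideanSpace ℝ (Fin d))) (a : ℕ → Ω → EuclideanSpace ℝ (Fin d))
    (ε σ : ℕ → Ω → ℝ) : Prop where
  measurable_arm : ∀ k ∈ Finset.Icc 1 K, Measurable (a k)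
  measurable_noise : ∀ k ∈ Finset.Icc 1 K, Measurable (ε k)
  norm_theta_le : ∀ k ∈ Finset.Icc 1 K, ‖θ k‖ ≤ B
  norm_arm_le : ∀ k ∈ Finset.Icc 1 K, ∀ ω, ∀ x ∈ D k ω, ‖x‖ ≤ A
  mean_mem : ∀ k ∈ Finset.Icc 1 K, ∀ ω, ∀ x ∈ D k ω, inner ℝ x (θ k) ∈ Set.Icc (-1 : ℝ) 1
  noise_le : ∀ k ∈ Finset.Icc 1 K, ∀ᵐ ω ∂μ, |ε k ω| ≤ R
  noise_mean : ∀ k ∈ Finset.Icc 1 K, μ[ε k | history a ε k] =ᵐ[μ] 0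
  noise_variance : ∀ k ∈ Finset.Icc 1 K,
    μ[fun ω => ε k ω ^ 2 | history a ε k] =ᵐ[μ] fun ω => σ k ω ^ 2
  variation_le : ∑ k ∈ Finset.Icc 1 (K - 1), ‖θ (k + 1) - θ k‖ ≤ BK
  variance_le : ∀ᵐ ω ∂μ, ∑ k ∈ Finset.Icc 1 K, σ k ω ^ 2 ≤ VK

/-- The dynamic regret. The supremum is the mean reward of the best arm of round `k`. -/
def regret {Ω : Type*} {d : ℕ} (K : ℕ) (θ : ℕ → EuclideanSpace ℝ (Fin d))
    (D : ℕ → Ω → Set (EuclideanSpace ℝ (Fin d))) (a : ℕ → Ω → EuclideanSpace ℝ (Fin d))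
    (ω : Ω) : ℝ :=
  ∑ k ∈ Finset.Icc 1 K,
    (sSup ((fun x => inner ℝ x (θ k)) '' D k ω) - inner ℝ (a k ω) (θ k))

/-! ### The choice of parameters -/

/-- The restart window size, rounded up to an integer. -/
def window (d K : ℕ) (BK VK : ℝ) : ℕ :=
  if VK ^ 3 * d / BK ≤ (K : ℝ) ^ 2 then
    ⌈(d : ℝ) ^ (1 / 3 : ℝ) * (K / BK) ^ (1 / 3 : ℝ)⌉₊
  else
    ⌈(d : ℝ) ^ (2 / 5 : ℝ) * (K * VK) ^ (1 / 5 : ℝ) / BK ^ (2 / 5 : ℝ)⌉₊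

/-- The parameter `α`, for the window size `w`. -/
def alpha (d K : ℕ) (BK VK : ℝ) (w : ℕ) : ℝ :=
  (d : ℝ) ^ (1 / 6 : ℝ) * Real.sqrt w * BK ^ (1 / 3 : ℝ) /
    ((K : ℝ) ^ (1 / 3 : ℝ) + (VK * K * w) ^ (1 / 6 : ℝ))

/-- The rate `d^{4/5} V_K^{2/5} B_K^{1/5} K^{2/5} + d^{2/3} B_K^{1/3} K^{2/3}`. -/
def rate (d K : ℕ) (BK VK : ℝ) : ℝ :=
  (d : ℝ) ^ (4 / 5 : ℝ) * VK ^ (2 / 5 : ℝ) * BK ^ (1 / 5 : ℝ) * (K : ℝ) ^ (2 / 5 : ℝ)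
    + (d : ℝ) ^ (2 / 3 : ℝ) * BK ^ (1 / 3 : ℝ) * (K : ℝ) ^ (2 / 3 : ℝ)

end RestartedSAVE

end

/-! Optimism bounds the regret round by round. If the played arm has layer `ℓ + 1`, its width in
layer `ℓ` is below `2^{-ℓ}`, so the round costs about `2^{-ℓ} β̂_ℓ` plus a drift term. Unless `2^ℓ`
is small compared with the square root of a logarithm, `β̂_ℓ` is of order `2^{-ℓ} √Q` up to
logarithms and drift, where `Q` is the sum of the squared noises in the window; hence the round
costs about `4^{-ℓ} √Q` (`inner_le_of_typical`). The weights give every update of layer `ℓ` the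
squared inverse Gram norm `4^{-ℓ}` exactly, so by the elliptical potential a window contains at most
about `d 4^ℓ` of them (`card_layer_le`), and each layer contributes `d √Q`. Layer `L + 1`
contributes at most `w 4^{-L} √Q ≤ w α² √Q`, and `w α²` is of order `d`. Cauchy–Schwarz over the
windows yields `d √(K V_K / w)`; the small layers cost about `d` rounds per window, that is `d K /
w`.

Changes of `θ` inside a window shift the estimates by at most `√w A Δ` in the norm of the covariance
matrix, `Δ` being the variation within the window. The index is a minimum over all layers, and a
width can be as large as `2^L A`, so the total drift is of order `2^L √w · w B_K`, which is of order
`w² B_K` because `2^L` is at most of order `√w`. The chosen `w` and `α` bring all these terms to the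
order of the rate (`goodParameters`, `sum_terms_le`).

The confidence bound is a self-normalized inequality in terms of the realized squared noises instead
of the unknown variances. It rests on the supermartingale `exp (∑ (X_i - X_i²))`, a truncation that
makes the increments bounded, and a union over a grid of values of the squared noise
(`selfNorm_le_of_exponent_le`, `measure_exponent_le`). On high layers the residuals used by the
algorithm can replace the noises, since the estimation error enters with the small factor `4^{-ℓ}
log` and is absorbed (`errNorm_le_betaHat`, `betaHat_le_of_high`).

The logarithms in `β̂` contain `w` but not `K`, so a union bound over all rounds is out of reach.
Instead each round fails with probability at most `δ / w`, and by Markov's inequality more than `K /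
w` rounds fail with probability at most `δ`; such rounds cost at most `2` each, which the rate
absorbs. A second `δ` pays for bounding the squared noises by `2 V_K + R² log (1/δ)`.

When the parameters are degenerate (`w > K`, `α ≥ 1`, too few layers, or `B` too large compared with
`R log w`), the number of rounds is itself at most of the order of the rate times logarithms, and
the bound `2 K` on the regret suffices (`parameters_of_not_trivial`). -/

noncomputable section

namespace RestartedSAVE

/-! ### Regularized Gram matrices -/

section LinearAlgebra

variable {d : ℕ}

/-- The regularized Gram matrix `c I + ∑_{s ≤ i < t} x_i x_iᵀ`. -/
def gram (c : ℝ) (x : ℕ → Fin d → ℝ) (s t : ℕ) : Matrix (Fin d) (Fin d) ℝ :=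
  c • (1 : Matrix (Fin d) (Fin d) ℝ) + ∑ i ∈ Finset.Ico s t, Matrix.vecMulVec (x i) (x i)

theorem dotProduct_mulVec_comm_of_isHermitian {M : Matrix (Fin d) (Fin d) ℝ} (hM : M.IsHermitian)
    (x y : Fin d → ℝ) : x ⬝ᵥ (M *ᵥ y) = y ⬝ᵥ (M *ᵥ x) := by
  have h : Mᵀ = M := by simpa [Matrix.IsHermitian, Matrix.conjTranspose_eq_transpose_of_trivial] using hM
  rw [Matrix.dotProduct_mulVec, ← Matrix.mulVec_transpose, h, dotProduct_comm]

theorem PosSemidef.dotProduct_mulVec_self_nonneg {M : Matrix (Fin d) (Fin d) ℝ}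
    (hM : M.PosSemidef) (x : Fin d → ℝ) : 0 ≤ x ⬝ᵥ (M *ᵥ x) := by
  simpa using hM.dotProduct_mulVec_nonneg x

/-- The Cauchy–Schwarz inequality for the bilinear form of a positive semidefinite matrix. -/
theorem PosSemidef.dotProduct_mulVec_sq_le {M : Matrix (Fin d) (Fin d) ℝ} (hM : M.PosSemidef)
    (x y : Fin d → ℝ) : (x ⬝ᵥ (M *ᵥ y)) ^ 2 ≤ (x ⬝ᵥ (M *ᵥ x)) * (y ⬝ᵥ (M *ᵥ y)) := by
  have key : ∀ t : ℝ, 0 ≤ (y ⬝ᵥ (M *ᵥ y)) * (t * t) + (2 * (x ⬝ᵥ (M *ᵥ y))) * t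
      + x ⬝ᵥ (M *ᵥ x) := by
    intro t
    have h := PosSemidef.dotProduct_mulVec_self_nonneg hM (x + t • y)
    have hc := dotProduct_mulVec_comm_of_isHermitian hM.1 y x
    simp only [Matrix.mulVec_add, Matrix.mulVec_smul, dotProduct_add, add_dotProduct,
      smul_dotProduct, dotProduct_smul, smul_eq_mul] at h
    rw [hc] at h
    linarith
  have := discrim_le_zero key
  rw [discrim] at this
  nlinarith

theorem abs_dotProduct_mulVec_le {M : Matrix (Fin d) (Fin d) ℝ} (hM : M.PosSemidef)
    (x y : Fin d → ℝ) :
    |x ⬝ᵥ (M *ᵥ y)| ≤ √(x ⬝ᵥ (M *ᵥ x)) * √(y ⬝ᵥ (M *ᵥ y)) := by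
  rw [← Real.sqrt_mul (PosSemidef.dotProduct_mulVec_self_nonneg hM x)]
  exact Real.abs_le_sqrt (PosSemidef.dotProduct_mulVec_sq_le hM x y)

variable {c : ℝ} (x : ℕ → Fin d → ℝ) (s t : ℕ)

theorem dotProduct_vecMulVec_self (v : Fin d → ℝ) (y z : Fin d → ℝ) :
    y ⬝ᵥ (Matrix.vecMulVec v v *ᵥ z) = (v ⬝ᵥ y) * (v ⬝ᵥ z) := by
  rw [Matrix.vecMulVec_mulVec, dotProduct_comm v y]
  simp [dotProduct_smul, mul_comm]

theorem dotProduct_gram_mulVec (y z : Fin d → ℝ) :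
    y ⬝ᵥ (gram c x s t *ᵥ z)
      = c * (y ⬝ᵥ z) + ∑ i ∈ Finset.Ico s t, (x i ⬝ᵥ y) * (x i ⬝ᵥ z) := by
  rw [gram, Matrix.add_mulVec, Matrix.smul_mulVec, Matrix.one_mulVec, dotProduct_add,
    dotProduct_smul, smul_eq_mul, Matrix.sum_mulVec, dotProduct_sum]
  simp_rw [dotProduct_vecMulVec_self]

theorem posDef_gram (hc : 0 < c) : (gram c x s t).PosDef := by
  unfold gram
  refine Matrix.PosDef.add_posSemidef (Matrix.PosDef.one.smul hc) ?_
  refine Matrix.posSemidef_sum _ fun i _ => ?_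
  simpa using Matrix.posSemidef_vecMulVec_self_star (x i)

theorem posSemidef_gram_inv (hc : 0 < c) : ((gram c x s t)⁻¹).PosSemidef :=
  (posDef_gram x s t hc).inv.posSemidef

theorem gram_mulVec_inv_mulVec (hc : 0 < c) (v : Fin d → ℝ) :
    gram c x s t *ᵥ ((gram c x s t)⁻¹ *ᵥ v) = v := by
  rw [Matrix.mulVec_mulVec, Matrix.mul_nonsing_inv _
    ((Matrix.isUnit_iff_isUnit_det _).1 (posDef_gram x s t hc).isUnit), Matrix.one_mulVec]

theorem gram_inv_mulVec_eq (hc : 0 < c) {v y : Fin d → ℝ} (h : gram c x s t *ᵥ y = v) :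
    (gram c x s t)⁻¹ *ᵥ v = y := by
  rw [← h, Matrix.mulVec_mulVec, Matrix.nonsing_inv_mul _
    ((Matrix.isUnit_iff_isUnit_det _).1 (posDef_gram x s t hc).isUnit), Matrix.one_mulVec]

theorem gram_succ {t : ℕ} (hst : s ≤ t) :
    gram c x s (t + 1) = gram c x s t + Matrix.vecMulVec (x t) (x t) := by
  rw [gram, Finset.sum_Ico_succ_top hst, gram, add_assoc]

/-- `‖v‖²` in the inverse Gram norm, expressed through `y = G⁻¹ v`. -/
theorem dotProduct_gram_inv_self (hc : 0 < c) (v : Fin d → ℝ) :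
    v ⬝ᵥ ((gram c x s t)⁻¹ *ᵥ v)
      = c * (((gram c x s t)⁻¹ *ᵥ v) ⬝ᵥ ((gram c x s t)⁻¹ *ᵥ v))
        + ∑ i ∈ Finset.Ico s t, (x i ⬝ᵥ ((gram c x s t)⁻¹ *ᵥ v)) ^ 2 := by
  have h := dotProduct_gram_mulVec (c := c) x s t ((gram c x s t)⁻¹ *ᵥ v) ((gram c x s t)⁻¹ *ᵥ v)
  rw [gram_mulVec_inv_mulVec x s t hc, dotProduct_comm] at h
  rw [h]
  simp_rw [sq]

theorem dotProduct_self_nonneg' (v : Fin d → ℝ) : 0 ≤ v ⬝ᵥ v := by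
  simpa using dotProduct_star_self_nonneg v

/-- Drop the regularization term from the quadratic form. Applied to the error vector, this bounds
the in-sample prediction error by the estimation error. -/
theorem sum_sq_dotProduct_gram_inv_le (hc : 0 < c) (v : Fin d → ℝ) :
    ∑ i ∈ Finset.Ico s t, (x i ⬝ᵥ ((gram c x s t)⁻¹ *ᵥ v)) ^ 2
      ≤ v ⬝ᵥ ((gram c x s t)⁻¹ *ᵥ v) := by
  rw [dotProduct_gram_inv_self x s t hc v]
  nlinarith [dotProduct_self_nonneg' ((gram c x s t)⁻¹ *ᵥ v)]

theorem dotProduct_sq_le (v y : Fin d → ℝ) : (v ⬝ᵥ y) ^ 2 ≤ (v ⬝ᵥ v) * (y ⬝ᵥ y) := by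
  simpa using PosSemidef.dotProduct_mulVec_sq_le (Matrix.PosSemidef.one (n := Fin d) (R := ℝ)) v y

/-- The Gram matrix dominates `c I`. With `y = G⁻¹ v` one has `c |y|² ≤ v ⬝ y`, and Cauchy–Schwarz
finishes without any operator monotonicity. -/
theorem dotProduct_gram_inv_le (hc : 0 < c) (v : Fin d → ℝ) :
    v ⬝ᵥ ((gram c x s t)⁻¹ *ᵥ v) ≤ (v ⬝ᵥ v) / c := by
  set y := (gram c x s t)⁻¹ *ᵥ v with hy
  have h1 : c * (y ⬝ᵥ y) ≤ v ⬝ᵥ y := by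
    rw [hy, dotProduct_gram_inv_self x s t hc v]
    have : 0 ≤ ∑ i ∈ Finset.Ico s t, (x i ⬝ᵥ ((gram c x s t)⁻¹ *ᵥ v)) ^ 2 :=
      Finset.sum_nonneg fun _ _ => sq_nonneg _
    linarith
  have h2 := dotProduct_sq_le v y
  have h3 := dotProduct_self_nonneg' y
  have h4 := dotProduct_self_nonneg' v
  rw [le_div_iff₀ hc]
  by_contra! hlt
  have h5 : 0 < v ⬝ᵥ y := by
    by_contra! h0
    nlinarith
  have h6 : (v ⬝ᵥ y) ^ 2 * c ≤ (v ⬝ᵥ v) * (v ⬝ᵥ y) := by nlinarith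
  nlinarith

/-- The inverse Gram norm of `∑ c_i x_i` is at most the Euclidean norm of the coefficients. -/
theorem dotProduct_gram_inv_sum_smul_le (hc : 0 < c) (e : ℕ → ℝ) :
    (∑ i ∈ Finset.Ico s t, e i • x i)
        ⬝ᵥ ((gram c x s t)⁻¹ *ᵥ (∑ i ∈ Finset.Ico s t, e i • x i))
      ≤ ∑ i ∈ Finset.Ico s t, e i ^ 2 := by
  set v := ∑ i ∈ Finset.Ico s t, e i • x i with hv
  set y := (gram c x s t)⁻¹ *ᵥ v with hy
  have h1 : v ⬝ᵥ y = ∑ i ∈ Finset.Ico s t, e i * (x i ⬝ᵥ y) := by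
    rw [hv, sum_dotProduct]
    simp [smul_dotProduct]
  have h2 := sum_sq_dotProduct_gram_inv_le x s t hc v
  rw [← hy] at h2
  have h3 := Finset.sum_mul_sq_le_sq_mul_sq (Finset.Ico s t) e (fun i => x i ⬝ᵥ y)
  rw [← h1] at h3
  have h0 : 0 ≤ ∑ i ∈ Finset.Ico s t, e i ^ 2 := Finset.sum_nonneg fun _ _ => sq_nonneg _
  by_contra! hlt
  have h5 : 0 < v ⬝ᵥ y := lt_of_le_of_lt h0 hlt
  nlinarith

/-- The recursion of the self-normalized sum when one more term is added. -/
theorem gram_inv_update (hc : 0 < c) {t : ℕ} (hst : s ≤ t) (b : Fin d → ℝ) (η : ℝ) :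
    (b + η • x t) ⬝ᵥ ((gram c x s (t + 1))⁻¹ *ᵥ (b + η • x t))
      = b ⬝ᵥ ((gram c x s t)⁻¹ *ᵥ b)
        + (2 * η * (x t ⬝ᵥ ((gram c x s t)⁻¹ *ᵥ b))
            + η ^ 2 * (x t ⬝ᵥ ((gram c x s t)⁻¹ *ᵥ x t))
            - (x t ⬝ᵥ ((gram c x s t)⁻¹ *ᵥ b)) ^ 2)
          / (1 + x t ⬝ᵥ ((gram c x s t)⁻¹ *ᵥ x t)) := by
  have hpsd := posSemidef_gram_inv x s t hc
  have hq := PosSemidef.dotProduct_mulVec_self_nonneg hpsd (x t)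
  have hcomm := dotProduct_mulVec_comm_of_isHermitian hpsd.1 b (x t)
  set y := (gram c x s t)⁻¹ *ᵥ b with hy
  set z := (gram c x s t)⁻¹ *ᵥ x t with hz
  set u := x t ⬝ᵥ y with hu
  set q := x t ⬝ᵥ z with hqd
  have hq1 : (1 + q) ≠ 0 := by positivity
  -- The Sherman–Morrison solution of the updated system, guessed and verified; it avoids an
  -- explicit formula for the inverse.
  have hsol : gram c x s (t + 1) *ᵥ (y + ((η - u) / (1 + q)) • z) = b + η • x t := by
    rw [gram_succ x s hst, Matrix.add_mulVec, Matrix.mulVec_add, Matrix.mulVec_smul, hy,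
      gram_mulVec_inv_mulVec x s t hc, hz, gram_mulVec_inv_mulVec x s t hc, ← hy, ← hz,
      Matrix.vecMulVec_mulVec]
    ext i
    simp only [Pi.add_apply, Pi.smul_apply, smul_eq_mul, dotProduct_add, dotProduct_smul,
      ← hu, ← hqd, MulOpposite.smul_eq_mul_unop, MulOpposite.unop_op]
    field_simp
    ring
  rw [gram_inv_mulVec_eq x s (t + 1) hc hsol]
  simp only [dotProduct_add, add_dotProduct, smul_dotProduct, dotProduct_smul, smul_eq_mul,
    hcomm, ← hu, ← hqd]
  field_simp
  ring

/-- The matrix determinant lemma for a rank-one update. -/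
theorem det_gram_succ (hc : 0 < c) {t : ℕ} (hst : s ≤ t) :
    (gram c x s (t + 1)).det
      = (gram c x s t).det * (1 + x t ⬝ᵥ ((gram c x s t)⁻¹ *ᵥ x t)) := by
  rw [gram_succ x s hst, Matrix.vecMulVec_eq Unit, Matrix.det_add_replicateCol_mul_replicateRow
    ((Matrix.isUnit_iff_isUnit_det _).1 (posDef_gram x s t hc).isUnit)]
  congr 1
  simp [Matrix.det_unique, Matrix.mul_apply, dotProduct, Matrix.mulVec, Finset.sum_mul,
    Finset.mul_sum, mul_assoc]
  exact Finset.sum_comm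

theorem trace_gram : (gram c x s t).trace = c * d + ∑ i ∈ Finset.Ico s t, x i ⬝ᵥ x i := by
  simp [gram, Matrix.trace_add, Matrix.trace_sum, Matrix.trace_vecMulVec]

/-- Every eigenvalue is at most the trace. Compared with the arithmetic–geometric mean inequality
this loses a factor `d ^ d`, which only affects the inside of a logarithm. -/
theorem det_gram_le (hc : 0 < c) :
    (gram c x s t).det ≤ (c * d + ∑ i ∈ Finset.Ico s t, x i ⬝ᵥ x i) ^ d := by
  have hP := posDef_gram x s t hc
  rw [hP.1.det_eq_prod_eigenvalues, ← trace_gram, hP.1.trace_eq_sum_eigenvalues]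
  have h : ∀ i, 0 ≤ hP.1.eigenvalues i := fun i => (hP.eigenvalues_pos i).le
  calc (∏ i, (hP.1.eigenvalues i : ℝ)) ≤ ∏ _i : Fin d, ∑ j, hP.1.eigenvalues j :=
        Finset.prod_le_prod (fun i _ => h i)
          fun i _ => Finset.single_le_sum (fun j _ => h j) (Finset.mem_univ i)
    _ = _ := by simp

theorem det_gram_eq_prod (hc : 0 < c) {t : ℕ} (hst : s ≤ t) :
    (gram c x s t).det
      = c ^ d * ∏ i ∈ Finset.Ico s t, (1 + x i ⬝ᵥ ((gram c x s i)⁻¹ *ᵥ x i)) := by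
  induction t, hst using Nat.le_induction with
  | base => simp [gram]
  | succ t hst ih =>
    rw [det_gram_succ x s hc hst, ih, Finset.prod_Ico_succ_top hst, mul_assoc]

/-- An elliptical potential bound: few terms have a large inverse Gram norm. -/
theorem card_mul_le_of_gram (hc : 0 < c) (hc1 : c ≤ 1) (hd : 1 ≤ d) {t : ℕ} (hst : s ≤ t)
    {A n : ℝ} (hA : ∀ i ∈ Finset.Ico s t, x i ⬝ᵥ x i ≤ A ^ 2) (hn : ((t - s : ℕ) : ℝ) ≤ n)
    (J : Finset ℕ) (hJ : J ⊆ Finset.Ico s t)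
    (hq : ∀ i ∈ J, c ≤ x i ⬝ᵥ ((gram c x s i)⁻¹ *ᵥ x i)) :
    (J.card : ℝ) * c ≤ 2 * (d * Real.log (d + n * A ^ 2 / c)) := by
  have hd' : (1 : ℝ) ≤ d := by exact_mod_cast hd
  have hq0 : ∀ i, 0 ≤ x i ⬝ᵥ ((gram c x s i)⁻¹ *ᵥ x i) := fun i =>
    PosSemidef.dotProduct_mulVec_self_nonneg (posSemidef_gram_inv x s i hc) (x i)
  -- The determinant grows by a factor of at least `1 + c` at each index of `J` and never decreases
  -- at the others.
  have h1 : c ^ d * (1 + c) ^ J.card ≤ (gram c x s t).det := by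
    rw [det_gram_eq_prod x s hc hst]
    refine mul_le_mul_of_nonneg_left ?_ (by positivity)
    calc (1 + c) ^ J.card = ∏ _i ∈ J, (1 + c) := by simp
      _ ≤ ∏ i ∈ J, (1 + x i ⬝ᵥ ((gram c x s i)⁻¹ *ᵥ x i)) :=
        Finset.prod_le_prod (fun _ _ => by positivity) fun i hi => by linarith [hq i hi]
      _ ≤ _ := Finset.prod_le_prod_of_subset_of_one_le hJ
          (fun i _ => by linarith [hq0 i]) fun i _ _ => by linarith [hq0 i]
  have h2 : (gram c x s t).det ≤ (c * (d + n * A ^ 2 / c)) ^ d := by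
    refine (det_gram_le x s t hc).trans (pow_le_pow_left₀ ?_ ?_ _)
    · have : 0 ≤ ∑ i ∈ Finset.Ico s t, x i ⬝ᵥ x i :=
        Finset.sum_nonneg fun i _ => dotProduct_self_nonneg' _
      positivity
    · have : ∑ i ∈ Finset.Ico s t, x i ⬝ᵥ x i ≤ ((t - s : ℕ) : ℝ) * A ^ 2 := by
        refine (Finset.sum_le_card_nsmul _ _ _ hA).trans ?_
        simp
      have h3 : ((t - s : ℕ) : ℝ) * A ^ 2 ≤ n * A ^ 2 :=
        mul_le_mul_of_nonneg_right hn (sq_nonneg _)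
      have : c * (d + n * A ^ 2 / c) = c * d + n * A ^ 2 := by field_simp
      linarith
  have hn0 : 0 ≤ n := le_trans (Nat.cast_nonneg _) hn
  have h3 : (1 + c) ^ J.card ≤ (d + n * A ^ 2 / c) ^ d := by
    have := h1.trans h2
    rw [mul_pow] at this
    exact le_of_mul_le_mul_left this (by positivity)
  have h4 := Real.log_le_log (by positivity) h3
  rw [Real.log_pow, Real.log_pow] at h4
  -- Here `c ≤ 1` enters: the potential gained per index is at least `c / 2`.
  have h5 : c / 2 ≤ Real.log (1 + c) := by
    have := Real.one_sub_inv_le_log_of_pos (x := 1 + c) (by positivity)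
    have h6 : 1 - (1 + c)⁻¹ = c / (1 + c) := by field_simp; ring
    have h7 : c / 2 ≤ c / (1 + c) := div_le_div_of_nonneg_left hc.le (by linarith) (by linarith)
    linarith
  nlinarith [mul_le_mul_of_nonneg_left h5 (Nat.cast_nonneg (α := ℝ) J.card)]

end LinearAlgebra

/-! ### The state of the learner in closed form -/

section Window

/-- The round of the last (re)start before round `k ≥ 1`. -/
def start (w k : ℕ) : ℕ := max 1 (k / w * w)

variable {w k : ℕ}

theorem one_le_start (w k : ℕ) : 1 ≤ start w k := le_max_left _ _

theorem start_le (hk : 1 ≤ k) : start w k ≤ k := max_le hk (Nat.div_mul_le_self k w)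

theorem lt_start_add (hw : 1 ≤ w) (k : ℕ) : k < start w k + w := by
  have h1 : k < k / w * w + w := by
    rw [← Nat.succ_mul, mul_comm]
    exact Nat.lt_mul_div_succ k hw
  have h2 : k / w * w ≤ start w k := le_max_right _ _
  omega

theorem start_succ_of_restart (h : k = 0 ∨ (k + 1) % w = 0) :
    start w (k + 1) = k + 1 := by
  rcases h with rfl | h
  · have := start_le (w := w) (k := 0 + 1) le_rfl
    have := one_le_start w (0 + 1)
    omega
  · rw [start, Nat.div_mul_cancel (Nat.dvd_of_mod_eq_zero h)]
    omega

theorem start_succ_of_not_restart (h : ¬ (k = 0 ∨ (k + 1) % w = 0)) :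
    start w (k + 1) = start w k := by
  have h1 : ¬ w ∣ k + 1 := fun hd => h (Or.inr (Nat.mod_eq_zero_of_dvd hd))
  rw [start, start, Nat.succ_div, if_neg h1, add_zero]

theorem start_eq_of_div_eq {i j : ℕ} (h : i / w = j / w) : start w i = start w j := by
  rw [start, start, h]

theorem div_eq_of_start_le {i : ℕ} (hw : 1 ≤ w) (h1 : start w k ≤ i) (h2 : i ≤ k) :
    i / w = k / w := by
  refine le_antisymm (Nat.div_le_div_right h2) ?_
  rw [Nat.le_div_iff_mul_le hw]
  exact (le_max_right _ _).trans h1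

theorem start_eq_of_mem {i : ℕ} (hw : 1 ≤ w) (h1 : start w k ≤ i) (h2 : i ≤ k) :
    start w i = start w k := start_eq_of_div_eq (div_eq_of_start_le hw h1 h2)

end Window

/-- The regularization `2^{-2ℓ}` of layer `ℓ`. -/
def reg (ℓ : ℕ) : ℝ := (2 : ℝ) ^ (-2 * (ℓ : ℤ))

theorem reg_pos (ℓ : ℕ) : 0 < reg ℓ := by unfold reg; positivity

theorem reg_eq_sq (ℓ : ℕ) : reg ℓ = ((2 : ℝ) ^ (-(ℓ : ℤ))) ^ 2 := by
  rw [reg, ← zpow_natCast, ← zpow_mul]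
  congr 1
  push_cast
  ring

theorem reg_eq_inv (ℓ : ℕ) : reg ℓ = (4 ^ ℓ)⁻¹ := by
  rw [reg_eq_sq, zpow_neg, zpow_natCast, inv_pow, ← pow_mul, mul_comm, pow_mul]
  norm_num

theorem reg_le_one (ℓ : ℕ) : reg ℓ ≤ 1 := by
  rw [reg_eq_inv]
  exact inv_le_one_of_one_le₀ (one_le_pow₀ (by norm_num))

section State

variable {d : ℕ} (w L : ℕ) (a : ℕ → EuclideanSpace ℝ (Fin d)) (r : ℕ → ℝ)

/-- The layer of the arm that is played in round `i`. -/
def lay (i : ℕ) : ℕ := (state w L a r i).layer L (a i)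

/-- The regression weight of round `i` in layer `ℓ`; it is `0` if the round belongs to another
layer. -/
def wgt (ℓ i : ℕ) : ℝ :=
  if lay w L a r i = ℓ then (2 : ℝ) ^ (-(ℓ : ℤ)) / matNorm ((state w L a r i).cov ℓ)⁻¹ (a i) else 0

/-- The weighted arm of round `i` in layer `ℓ`. -/
def feat (ℓ i : ℕ) : Fin d → ℝ := wgt w L a r ℓ i • (a i).ofLp

theorem matNorm_nonneg (M : Matrix (Fin d) (Fin d) ℝ) (x : EuclideanSpace ℝ (Fin d)) :
    0 ≤ matNorm M x := Real.sqrt_nonneg _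

theorem wgt_nonneg (ℓ i : ℕ) : 0 ≤ wgt w L a r ℓ i := by
  unfold wgt
  split_ifs
  · have := matNorm_nonneg ((state w L a r i).cov ℓ)⁻¹ (a i)
    positivity
  · exact le_rfl

theorem layer_spec (s : State d) (x : EuclideanSpace ℝ (Fin d)) :
    (s.layer L x ∈ Finset.Icc 1 L ∧
      (2 : ℝ) ^ (-((s.layer L x : ℕ) : ℤ)) ≤ matNorm (s.cov (s.layer L x))⁻¹ x ∧
      ∀ ℓ ∈ Finset.Icc 1 L, ℓ < s.layer L x → matNorm (s.cov ℓ)⁻¹ x < (2 : ℝ) ^ (-(ℓ : ℤ))) ∨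
    (s.layer L x = L + 1 ∧
      ∀ ℓ ∈ Finset.Icc 1 L, matNorm (s.cov ℓ)⁻¹ x < (2 : ℝ) ^ (-(ℓ : ℤ))) := by
  set S := (Finset.Icc 1 L).filter
    (fun ℓ : ℕ => (2 : ℝ) ^ (-(ℓ : ℤ)) ≤ matNorm (s.cov ℓ)⁻¹ x) with hS
  have hlay : s.layer L x = if h : S.Nonempty then S.min' h else L + 1 := rfl
  rw [hlay]
  split_ifs with h
  · left
    have h1 := Finset.mem_filter.1 (Finset.min'_mem S h)
    refine ⟨h1.1, h1.2, fun ℓ hℓ hlt => ?_⟩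
    by_contra! hge
    exact absurd (Finset.min'_le _ ℓ (Finset.mem_filter.2 ⟨hℓ, hge⟩)) (not_le.2 hlt)
  · right
    refine ⟨rfl, fun ℓ hℓ => ?_⟩
    by_contra! hge
    exact h ⟨ℓ, Finset.mem_filter.2 ⟨hℓ, hge⟩⟩

theorem one_le_lay (i : ℕ) : 1 ≤ lay w L a r i := by
  rcases layer_spec L (state w L a r i) (a i) with h | h
  · exact (Finset.mem_Icc.1 h.1).1
  · rw [lay, h.1]; omega

theorem lay_le (i : ℕ) : lay w L a r i ≤ L + 1 := by
  rcases layer_spec L (state w L a r i) (a i) with h | h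
  · exact (Finset.mem_Icc.1 h.1).2.trans (Nat.le_succ L)
  · exact h.1.le

theorem two_zpow_le_matNorm {i : ℕ} (h : lay w L a r i ≤ L) :
    (2 : ℝ) ^ (-((lay w L a r i : ℕ) : ℤ))
      ≤ matNorm ((state w L a r i).cov (lay w L a r i))⁻¹ (a i) := by
  rcases layer_spec L (state w L a r i) (a i) with h' | h'
  · exact h'.2.1
  · rw [lay, h'.1] at h; omega

theorem matNorm_lt_of_lt_lay {i ℓ : ℕ} (hℓ : 1 ≤ ℓ) (hℓL : ℓ ≤ L) (h : ℓ < lay w L a r i) :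
    matNorm ((state w L a r i).cov ℓ)⁻¹ (a i) < (2 : ℝ) ^ (-(ℓ : ℤ)) := by
  rcases layer_spec L (state w L a r i) (a i) with h' | h'
  · exact h'.2.2 ℓ (Finset.mem_Icc.2 ⟨hℓ, hℓL⟩) h
  · exact h'.2 ℓ (Finset.mem_Icc.2 ⟨hℓ, hℓL⟩)

theorem wgt_le_one {ℓ : ℕ} (hℓ : ℓ ≤ L) (i : ℕ) : wgt w L a r ℓ i ≤ 1 := by
  unfold wgt
  split_ifs with h
  · subst h
    exact div_le_one_of_le₀ (two_zpow_le_matNorm w L a r hℓ) (matNorm_nonneg _ _)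
  · exact zero_le_one

theorem wgt_of_lay_ne {ℓ i : ℕ} (h : lay w L a r i ≠ ℓ) : wgt w L a r ℓ i = 0 := if_neg h

theorem state_succ_of_restart {k : ℕ} (h : k = 0 ∨ (k + 1) % w = 0) :
    state w L a r (k + 1) = State.init d := by rw [state, if_pos h]

theorem state_succ_of_not_restart {k : ℕ} (h : ¬ (k = 0 ∨ (k + 1) % w = 0)) :
    state w L a r (k + 1) = (state w L a r k).update L k (a k) (r k) := by rw [state, if_neg h]

theorem smul_vecMulVec_smul (z : ℝ) (v : Fin d → ℝ) :
    Matrix.vecMulVec (z • v) (z • v) = z ^ 2 • Matrix.vecMulVec v v := by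
  ext i j
  simp [Matrix.vecMulVec_apply]
  ring

/-- Since the weight of a round is zero in all layers but its own, each layer is a regression over
all rounds since the last restart. Every layer can then be indexed by the same deterministic time,
as the martingale arguments require. -/
theorem state_closed_form {k : ℕ} (hk : 1 ≤ k) :
    (∀ ℓ ≤ L, (state w L a r k).cov ℓ = gram (reg ℓ) (feat w L a r ℓ) (start w k) k ∧
      (state w L a r k).vec ℓ
        = ∑ i ∈ Finset.Ico (start w k) k, (wgt w L a r ℓ i * r i) • feat w L a r ℓ i ∧
      (state w L a r k).rounds ℓ
        = (Finset.Ico (start w k) k).filter (fun i => lay w L a r i = ℓ)) ∧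
    ∀ i ∈ Finset.Ico (start w k) k, lay w L a r i ≤ L →
      (state w L a r k).weight i = wgt w L a r (lay w L a r i) i := by
  induction k with
  | zero => omega
  | succ k ih =>
    by_cases hr : k = 0 ∨ (k + 1) % w = 0
    · rw [state_succ_of_restart w L a r hr, start_succ_of_restart hr]
      simp [State.init, gram, reg]
    · rw [state_succ_of_not_restart w L a r hr, start_succ_of_not_restart hr]
      have hk1 : 1 ≤ k := by
        by_contra! h
        exact hr (Or.inl (by omega))
      obtain ⟨ih1, ih2⟩ := ih hk1
      have hs : start w k ≤ k := start_le hk1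
      refine ⟨fun ℓ hℓ => ?_, fun i hi hiL => ?_⟩
      · obtain ⟨h1, h2, h3⟩ := ih1 ℓ hℓ
        refine ⟨?_, ?_, ?_⟩
        · rw [gram_succ _ _ hs, ← h1]
          by_cases hl : lay w L a r k = ℓ
          · have : ℓ = (state w L a r k).layer L (a k) ∧ (state w L a r k).layer L (a k) ≤ L :=
              ⟨hl.symm, (le_of_eq hl).trans hℓ⟩
            simp only [State.update, if_pos this]
            rw [feat, smul_vecMulVec_smul, wgt, if_pos hl, ← this.1]
          · have : ¬ (ℓ = (state w L a r k).layer L (a k) ∧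
                (state w L a r k).layer L (a k) ≤ L) := fun h => hl h.1.symm
            simp only [State.update, if_neg this]
            rw [feat, smul_vecMulVec_smul, wgt_of_lay_ne w L a r hl]
            simp
        · rw [Finset.sum_Ico_succ_top hs, ← h2]
          by_cases hl : lay w L a r k = ℓ
          · have : ℓ = (state w L a r k).layer L (a k) ∧ (state w L a r k).layer L (a k) ≤ L :=
              ⟨hl.symm, (le_of_eq hl).trans hℓ⟩
            simp only [State.update, if_pos this]
            rw [feat, smul_smul, wgt, if_pos hl, ← this.1]
            congr 2
            ring
          · have : ¬ (ℓ = (state w L a r k).layer L (a k) ∧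
                (state w L a r k).layer L (a k) ≤ L) := fun h => hl h.1.symm
            simp only [State.update, if_neg this]
            rw [wgt_of_lay_ne w L a r hl]
            simp
        · rw [← Finset.insert_Ico_right_eq_Ico_add_one hs, Finset.filter_insert, ← h3]
          simp only [State.update]
          by_cases hl : lay w L a r k = ℓ
          · rw [if_pos hl]
            exact if_pos hl.symm
          · rw [if_neg hl]
            exact if_neg (Ne.symm hl)
      · rw [Finset.mem_Ico] at hi
        by_cases hik : i = k
        · subst hik
          have : i = i ∧ (state w L a r i).layer L (a i) ≤ L := ⟨rfl, hiL⟩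
          rw [wgt, if_pos rfl]
          exact if_pos this
        · have : ¬ (i = k ∧ (state w L a r k).layer L (a k) ≤ L) := fun h => hik h.1
          simp only [State.update, if_neg this]
          exact ih2 i (Finset.mem_Ico.2 ⟨hi.1, by omega⟩) hiL

theorem cov_eq_gram {k ℓ : ℕ} (hk : 1 ≤ k) (hℓ : ℓ ≤ L) :
    (state w L a r k).cov ℓ = gram (reg ℓ) (feat w L a r ℓ) (start w k) k :=
  ((state_closed_form w L a r hk).1 ℓ hℓ).1

theorem matNorm_eq_sqrt {k ℓ : ℕ} (hk : 1 ≤ k) (hℓ : ℓ ≤ L) (x : EuclideanSpace ℝ (Fin d)) :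
    matNorm ((state w L a r k).cov ℓ)⁻¹ x
      = √(x.ofLp ⬝ᵥ ((gram (reg ℓ) (feat w L a r ℓ) (start w k) k)⁻¹ *ᵥ x.ofLp)) := by
  rw [matNorm, cov_eq_gram w L a r hk hℓ]

/-- This is the purpose of the weights: a layer's updates all have the same squared norm, equal to
its regularization. The lower bound drives the counting of rounds, the upper bound the concentration
inequality. -/
theorem feat_gram_inv_feat {k ℓ : ℕ} (hk : 1 ≤ k) (hℓ : ℓ ≤ L) (h : lay w L a r k = ℓ) :
    feat w L a r ℓ k
      ⬝ᵥ ((gram (reg ℓ) (feat w L a r ℓ) (start w k) k)⁻¹ *ᵥ feat w L a r ℓ k) = reg ℓ := by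
  have h1 := two_zpow_le_matNorm w L a r (i := k) (h.le.trans hℓ)
  rw [h] at h1
  have h2 : 0 < matNorm ((state w L a r k).cov ℓ)⁻¹ (a k) := lt_of_lt_of_le (by positivity) h1
  have h3 := matNorm_eq_sqrt w L a r hk hℓ (a k)
  have h4 : (a k).ofLp ⬝ᵥ ((gram (reg ℓ) (feat w L a r ℓ) (start w k) k)⁻¹ *ᵥ (a k).ofLp)
      = matNorm ((state w L a r k).cov ℓ)⁻¹ (a k) ^ 2 := by
    rw [h3, Real.sq_sqrt]
    exact PosSemidef.dotProduct_mulVec_self_nonneg (posSemidef_gram_inv _ _ _ (reg_pos ℓ)) _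
  have h5 : feat w L a r ℓ k = wgt w L a r ℓ k • (a k).ofLp := rfl
  rw [h5, Matrix.mulVec_smul, dotProduct_smul, smul_dotProduct, h4, wgt, if_pos h, reg_eq_sq]
  simp only [smul_eq_mul]
  field_simp

theorem feat_gram_inv_feat_le {k ℓ : ℕ} (hk : 1 ≤ k) (hℓ : ℓ ≤ L) :
    feat w L a r ℓ k
      ⬝ᵥ ((gram (reg ℓ) (feat w L a r ℓ) (start w k) k)⁻¹ *ᵥ feat w L a r ℓ k) ≤ reg ℓ := by
  by_cases h : lay w L a r k = ℓ
  · exact (feat_gram_inv_feat w L a r hk hℓ h).le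
  · have : feat w L a r ℓ k = 0 := by rw [feat, wgt_of_lay_ne w L a r h, zero_smul]
    rw [this]
    simpa using (reg_pos ℓ).le

theorem dotProduct_self_eq_norm_sq (x : EuclideanSpace ℝ (Fin d)) : x.ofLp ⬝ᵥ x.ofLp = ‖x‖ ^ 2 := by
  rw [EuclideanSpace.real_norm_sq_eq]
  simp [dotProduct, sq]

theorem feat_dotProduct_self_le {A : ℝ} {ℓ i : ℕ} (hℓ : ℓ ≤ L) (hA : ‖a i‖ ≤ A) :
    feat w L a r ℓ i ⬝ᵥ feat w L a r ℓ i ≤ A ^ 2 := by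
  rw [feat, smul_dotProduct, dotProduct_smul, dotProduct_self_eq_norm_sq, smul_eq_mul, smul_eq_mul]
  have h0 := wgt_nonneg w L a r ℓ i
  have h1 := wgt_le_one w L a r hℓ i
  have h2 : ‖a i‖ ^ 2 ≤ A ^ 2 := pow_le_pow_left₀ (norm_nonneg _) hA 2
  have h3 : wgt w L a r ℓ i * wgt w L a r ℓ i ≤ 1 := mul_le_one₀ h1 h0 h1
  nlinarith [sq_nonneg ‖a i‖]

/-- The covariance of layer `ℓ` dominates `4^{-ℓ} I`. This crude width is used only to multiply the
drift in the optimism step. -/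
theorem matNorm_cov_inv_le {A : ℝ} {k ℓ : ℕ} (hk : 1 ≤ k) (hℓ : ℓ ≤ L)
    {x : EuclideanSpace ℝ (Fin d)} (hA : ‖x‖ ≤ A) :
    matNorm ((state w L a r k).cov ℓ)⁻¹ x ≤ 2 ^ ℓ * A := by
  rw [matNorm_eq_sqrt w L a r hk hℓ]
  have hA0 : 0 ≤ A := (norm_nonneg _).trans hA
  refine Real.sqrt_le_iff.2 ⟨by positivity, ?_⟩
  refine (dotProduct_gram_inv_le _ _ _ (reg_pos ℓ) _).trans ?_
  rw [dotProduct_self_eq_norm_sq, reg_eq_inv, div_inv_eq_mul, mul_pow, ← pow_mul, mul_comm ℓ 2,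
    pow_mul, mul_comm]
  norm_num
  have : ‖x‖ ^ 2 ≤ A ^ 2 := pow_le_pow_left₀ (norm_nonneg _) hA 2
  exact this

/-- The number of rounds of a window that are assigned to layer `ℓ ≤ L`. -/
theorem card_layer_le (hw : 1 ≤ w) (hd : 1 ≤ d) {A : ℝ} {k ℓ : ℕ} (hk : 1 ≤ k) (hℓ : ℓ ≤ L)
    (hA : ∀ i ∈ Finset.Icc (start w k) k, ‖a i‖ ≤ A) :
    (((Finset.Icc (start w k) k).filter (fun i => lay w L a r i = ℓ)).card : ℝ)
      ≤ 2 * 4 ^ ℓ * (d * Real.log (d + w * A ^ 2 * 4 ^ ℓ)) := by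
  have hs : start w k ≤ k + 1 := (start_le hk).trans (Nat.le_succ k)
  have hIcc : Finset.Icc (start w k) k = Finset.Ico (start w k) (k + 1) := by
    ext i; simp only [Finset.mem_Icc, Finset.mem_Ico]; omega
  rw [hIcc] at hA ⊢
  have h := card_mul_le_of_gram (feat w L a r ℓ) (start w k) (reg_pos ℓ) (reg_le_one ℓ) hd hs
    (A := A) (n := w) (fun i hi => feat_dotProduct_self_le w L a r hℓ (hA i hi))
    (by
      have := lt_start_add hw k
      exact_mod_cast (by omega : k + 1 - start w k ≤ w))
    _ (Finset.filter_subset (fun i => lay w L a r i = ℓ) _) (by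
      intro i hi
      rw [Finset.mem_filter, Finset.mem_Ico] at hi
      have h1 : start w i = start w k := start_eq_of_mem hw hi.1.1 (by omega)
      rw [← h1]
      exact (feat_gram_inv_feat w L a r ((one_le_start w k).trans hi.1.1) hℓ hi.2).ge)
  rw [reg_eq_inv, div_inv_eq_mul, ← div_eq_mul_inv, div_le_iff₀ (by positivity)] at h
  linarith

end State

/-! ### Self-normalized sums -/

section SelfNormalized

variable {d : ℕ} (c : ℝ) (x : ℕ → Fin d → ℝ) (η : ℕ → ℝ) (s : ℕ)

/-- The squared self-normalized sum `‖∑_{s ≤ i < t} η_i x_i‖²` in the inverse Gram norm. -/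
def selfNorm (t : ℕ) : ℝ :=
  (∑ i ∈ Finset.Ico s t, η i • x i) ⬝ᵥ
    ((gram c x s t)⁻¹ *ᵥ (∑ i ∈ Finset.Ico s t, η i • x i))

/-- The coefficient of the noise in the increment of `selfNorm`. -/
def drift (t : ℕ) : ℝ :=
  (x t ⬝ᵥ ((gram c x s t)⁻¹ *ᵥ (∑ i ∈ Finset.Ico s t, η i • x i)))
    / (1 + x t ⬝ᵥ ((gram c x s t)⁻¹ *ᵥ x t))

variable {c}

theorem selfNorm_nonneg (hc : 0 < c) (t : ℕ) : 0 ≤ selfNorm c x η s t :=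
  PosSemidef.dotProduct_mulVec_self_nonneg (posSemidef_gram_inv x s t hc) _

theorem selfNorm_self : selfNorm c x η s s = 0 := by simp [selfNorm]

/-- In the rank-one update the cross term is the martingale part, the negative square is dropped,
and the remaining `η² q / (1 + q)` is at most `c η²`. -/
theorem selfNorm_succ_le (hc : 0 < c) {t : ℕ} (hst : s ≤ t)
    (hq : x t ⬝ᵥ ((gram c x s t)⁻¹ *ᵥ x t) ≤ c) :
    selfNorm c x η s (t + 1) ≤ selfNorm c x η s t + 2 * (η t * drift c x η s t) + c * η t ^ 2 := by
  have h := gram_inv_update x s hc hst (∑ i ∈ Finset.Ico s t, η i • x i) (η t)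
  rw [← Finset.sum_Ico_succ_top hst] at h
  rw [selfNorm, h, selfNorm, drift]
  have hq0 := PosSemidef.dotProduct_mulVec_self_nonneg (posSemidef_gram_inv x s t hc) (x t)
  set q := x t ⬝ᵥ ((gram c x s t)⁻¹ *ᵥ x t)
  set u := x t ⬝ᵥ ((gram c x s t)⁻¹ *ᵥ (∑ i ∈ Finset.Ico s t, η i • x i))
  have h1 : (2 * η t * u + η t ^ 2 * q - u ^ 2) / (1 + q)
      = 2 * (η t * (u / (1 + q))) + (η t ^ 2 * q - u ^ 2) / (1 + q) := by
    field_simp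
    ring
  have h2 : (η t ^ 2 * q - u ^ 2) / (1 + q) ≤ c * η t ^ 2 := by
    rw [div_le_iff₀ (by positivity)]
    nlinarith [mul_le_mul_of_nonneg_left hq (sq_nonneg (η t)), sq_nonneg u,
      mul_nonneg (mul_nonneg hc.le (sq_nonneg (η t))) hq0]
  rw [h1]
  linarith

/-- Cauchy–Schwarz in the inverse Gram norm. The size of the martingale increments is thus
controlled by the quantity to be bounded, which is why the drift is truncated at a level. -/
theorem drift_sq_le (hc : 0 < c) {t : ℕ} (hq : x t ⬝ᵥ ((gram c x s t)⁻¹ *ᵥ x t) ≤ c) :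
    drift c x η s t ^ 2 ≤ c * selfNorm c x η s t := by
  have hq0 := PosSemidef.dotProduct_mulVec_self_nonneg (posSemidef_gram_inv x s t hc) (x t)
  have h1 := PosSemidef.dotProduct_mulVec_sq_le (posSemidef_gram_inv x s t hc) (x t)
    (∑ i ∈ Finset.Ico s t, η i • x i)
  have h2 : drift c x η s t ^ 2
      ≤ (x t ⬝ᵥ ((gram c x s t)⁻¹ *ᵥ (∑ i ∈ Finset.Ico s t, η i • x i))) ^ 2 := by
    rw [drift, div_pow]
    exact div_le_self (sq_nonneg _) (one_le_pow₀ (by linarith))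
  refine h2.trans (h1.trans ?_)
  exact mul_le_mul_of_nonneg_right hq (selfNorm_nonneg x η s hc t)

theorem selfNorm_le_sum (hc : 0 < c) {t : ℕ} (hst : s ≤ t)
    (hq : ∀ i ∈ Finset.Ico s t, x i ⬝ᵥ ((gram c x s i)⁻¹ *ᵥ x i) ≤ c) :
    selfNorm c x η s t
      ≤ 2 * ∑ i ∈ Finset.Ico s t, η i * drift c x η s i + c * ∑ i ∈ Finset.Ico s t, η i ^ 2 := by
  induction t, hst using Nat.le_induction with
  | base => simp [selfNorm_self]
  | succ t hst ih =>
    have h1 := ih fun i hi => hq i (Finset.Ico_subset_Ico_right (Nat.le_succ t) hi)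
    have h2 := selfNorm_succ_le x η s hc hst (hq t (Finset.mem_Ico.2 ⟨hst, Nat.lt_succ_self t⟩))
    rw [Finset.sum_Ico_succ_top hst, Finset.sum_Ico_succ_top hst]
    linarith

variable (c) in
/-- The drift, truncated where the self-normalized sum exceeds the level `B`. -/
def truncDrift (B : ℝ) (t : ℕ) : ℝ := if selfNorm c x η s t ≤ B then drift c x η s t else 0

theorem truncDrift_sq_le (hc : 0 < c) {B : ℝ} (hB : 0 ≤ B) {t : ℕ}
    (hq : x t ⬝ᵥ ((gram c x s t)⁻¹ *ᵥ x t) ≤ c) :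
    truncDrift c x η s B t ^ 2 ≤ c * B := by
  unfold truncDrift
  split_ifs with h
  · exact (drift_sq_le x η s hc hq).trans (mul_le_mul_of_nonneg_left h hc.le)
  · simpa using mul_nonneg hc.le hB

/-- If the exponents of the truncated process stay below `2 ι`, then the self-normalized sum is
never truncated. -/
theorem selfNorm_le_of_exponent_le (hc : 0 < c) {g ι : ℝ} (hι : 1 ≤ ι) (hg : 8 * ι ≤ g) {k : ℕ}
    (hq : ∀ i ∈ Finset.Ico s k, x i ⬝ᵥ ((gram c x s i)⁻¹ *ᵥ x i) ≤ c)
    (hV : ∑ i ∈ Finset.Ico s k, η i ^ 2 ≤ g)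
    (hX : ∀ t ∈ Finset.Icc s k, ∑ i ∈ Finset.Ico s t,
      (2 / (9 * c * g) * (η i * truncDrift c x η s (36 * c * g * ι) i)
        - (2 / (9 * c * g) * (η i * truncDrift c x η s (36 * c * g * ι) i)) ^ 2) ≤ 2 * ι) :
    ∀ t ∈ Finset.Icc s k, selfNorm c x η s t ≤ 36 * c * g * ι := by
  intro t
  have hg0 : 0 < g := by linarith
  have hι0 : 0 < ι := by linarith
  induction t using Nat.strong_induction_on with
  | _ t ih =>
  intro ht
  rw [Finset.mem_Icc] at ht
  have hsub : Finset.Ico s t ⊆ Finset.Ico s k := Finset.Ico_subset_Ico_right ht.2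
  have h1 := selfNorm_le_sum x η s hc ht.1 fun i hi => hq i (hsub hi)
  have h2 : ∑ i ∈ Finset.Ico s t, η i * drift c x η s i
      = ∑ i ∈ Finset.Ico s t, η i * truncDrift c x η s (36 * c * g * ι) i := by
    refine Finset.sum_congr rfl fun i hi => ?_
    rw [Finset.mem_Ico] at hi
    -- The bound at time `t` involves only drifts at earlier times, where by induction the
    -- truncation is inactive.
    rw [truncDrift, if_pos (ih i hi.2 (Finset.mem_Icc.2 ⟨hi.1, by omega⟩))]
  have hVt : ∑ i ∈ Finset.Ico s t, η i ^ 2 ≤ g :=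
    (Finset.sum_le_sum_of_subset_of_nonneg hsub fun _ _ _ => sq_nonneg _).trans hV
  have h3 : ∑ i ∈ Finset.Ico s t, (η i * truncDrift c x η s (36 * c * g * ι) i) ^ 2
      ≤ c * (36 * c * g * ι) * g := by
    calc _ ≤ ∑ i ∈ Finset.Ico s t, c * (36 * c * g * ι) * η i ^ 2 := by
          refine Finset.sum_le_sum fun i hi => ?_
          rw [mul_pow, mul_comm]
          exact mul_le_mul_of_nonneg_right
            (truncDrift_sq_le x η s hc (by positivity) (hq i (hsub hi))) (sq_nonneg _)
      _ = c * (36 * c * g * ι) * ∑ i ∈ Finset.Ico s t, η i ^ 2 := by rw [Finset.mul_sum]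
      _ ≤ _ := mul_le_mul_of_nonneg_left hVt (by positivity)
  have h4 := hX t (Finset.mem_Icc.2 ht)
  simp only [Finset.sum_sub_distrib, mul_pow _ (η _ * _), ← Finset.mul_sum] at h4
  set Y := ∑ i ∈ Finset.Ico s t, η i * truncDrift c x η s (36 * c * g * ι) i
  -- With `λ = 2 / (9 c g)`, the exponent bound `2 ι` contributes `9 c g ι` after division by `λ`,
  -- and the quadratic term contributes `8 c g ι`. Doubling and adding `c g` gives at most `35 c g
  -- ι`, below the truncation level `36 c g ι`, so the induction closes.
  have h5 : Y ≤ 9 * c * g * ι + 8 * c * g * ι := by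
    have h6 : 2 / (9 * c * g) * Y ≤ 2 * ι + (2 / (9 * c * g)) ^ 2 * (c * (36 * c * g * ι) * g) := by
      have := mul_le_mul_of_nonneg_left h3 (sq_nonneg (2 / (9 * c * g)))
      linarith
    have h7 : (2 / (9 * c * g)) ^ 2 * (c * (36 * c * g * ι) * g) = 2 / (9 * c * g) * (8 * c * g * ι) := by
      field_simp
      ring
    have h8 : 2 * ι = 2 / (9 * c * g) * (9 * c * g * ι) := by
      field_simp
    rw [h7, h8, ← mul_add] at h6
    exact le_of_mul_le_mul_left h6 (by positivity)
  rw [h2] at h1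
  have h9 : c * ∑ i ∈ Finset.Ico s t, η i ^ 2 ≤ c * g := mul_le_mul_of_nonneg_left hVt hc.le
  have h11 : 0 ≤ c * g * ι := by positivity
  have h10 : c * g ≤ c * g * ι := le_mul_of_one_le_right (by positivity) hι
  linarith

end SelfNormalized

/-! ### Exponential inequalities for martingale differences -/

/-- Subtracting the realized square leaves a linear bound, so that the exponential process is a
supermartingale without reference to conditional variances. -/
theorem exp_sub_sq_le {y : ℝ} (hy : |y| ≤ 1 / 2) : Real.exp (y - y ^ 2) ≤ 1 + y := by
  rw [abs_le] at hy
  rcases le_total 0 y with h | h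
  · have h1 : |y - y ^ 2| ≤ 1 := by
      rw [abs_le]
      constructor <;> nlinarith
    have h2 := Real.abs_exp_sub_one_sub_id_le h1
    rw [abs_le] at h2
    nlinarith [h2.2, mul_nonneg h (sq_nonneg y), mul_nonneg (mul_nonneg h (sq_nonneg y))
      (by linarith : (0 : ℝ) ≤ 2 - y)]
  · have h1 : 0 ≤ y ^ 2 - y := by nlinarith
    have h2 := Real.quadratic_le_exp_of_nonneg h1
    have h3 : 1 ≤ (1 + y) * Real.exp (y ^ 2 - y) := by
      refine le_trans ?_ (mul_le_mul_of_nonneg_left h2 (by linarith))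
      nlinarith [mul_nonneg (sq_nonneg y) (by nlinarith : (0 : ℝ) ≤ 1 + y - y ^ 2 + y ^ 3),
        sq_nonneg y]
    have h5 : Real.exp (y - y ^ 2) * Real.exp (y ^ 2 - y) = 1 := by
      rw [← Real.exp_add]
      simp
    have h6 := Real.exp_pos (y - y ^ 2)
    have h7 := Real.exp_pos (y ^ 2 - y)
    nlinarith

section Martingale

variable {Ω : Type*} {m0 : MeasurableSpace Ω} {μ : Measure Ω}

theorem integral_mul_condExp {m : MeasurableSpace Ω} (hm : m ≤ m0) [IsProbabilityMeasure μ]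
    {f g : Ω → ℝ} (hf : Measurable[m] f) (hfg : Integrable (fun ω => f ω * g ω) μ)
    (hg : Integrable g μ) : ∫ ω, f ω * g ω ∂μ = ∫ ω, f ω * (μ[g | m]) ω ∂μ := by
  rw [← integral_condExp hm (f := fun ω => f ω * g ω)]
  exact integral_congr_ae (condExp_mul_of_stronglyMeasurable_left hf.stronglyMeasurable hfg hg)

variable {F : ℕ → MeasurableSpace Ω} {s k : ℕ}

theorem measurable_sum_of_adapted (hF : Monotone F) {X : ℕ → Ω → ℝ}
    (hX : ∀ i ∈ Finset.Ico s k, Measurable[F (i + 1)] (X i)) {t : ℕ} (ht : t ≤ k) :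
    Measurable[F t] (fun ω => ∑ i ∈ Finset.Ico s t, X i ω) := by
  refine Finset.measurable_fun_sum _ fun i hi => ?_
  rw [Finset.mem_Ico] at hi
  exact (hX i (Finset.mem_Ico.2 ⟨hi.1, by omega⟩)).mono (hF hi.2) le_rfl

/-- `exp (∑ (X_i - X_i²))` has mean at most `1` for bounded martingale differences
`X_i = h_i ξ_i`. -/
theorem integral_exp_sum_sub_sq_le_one [IsProbabilityMeasure μ] (hF : Monotone F)
    (hFm : ∀ i ∈ Finset.Icc s k, F i ≤ m0) {h ξ : ℕ → Ω → ℝ}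
    (hh : ∀ i ∈ Finset.Ico s k, Measurable[F i] (h i))
    (hb : ∀ i ∈ Finset.Ico s k, ∀ ω, |h i ω| ≤ 1 / 2)
    (hξ : ∀ i ∈ Finset.Ico s k, Measurable[F (i + 1)] (ξ i))
    (hξb : ∀ i ∈ Finset.Ico s k, ∀ᵐ ω ∂μ, |ξ i ω| ≤ 1)
    (hmean : ∀ i ∈ Finset.Ico s k, μ[ξ i | F i] =ᵐ[μ] 0) {t : ℕ} (hst : s ≤ t) (htk : t ≤ k) :
    Integrable (fun ω => Real.exp (∑ i ∈ Finset.Ico s t, (h i ω * ξ i ω - (h i ω * ξ i ω) ^ 2))) μ ∧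
    ∫ ω, Real.exp (∑ i ∈ Finset.Ico s t, (h i ω * ξ i ω - (h i ω * ξ i ω) ^ 2)) ∂μ ≤ 1 := by
  have hXm : ∀ i ∈ Finset.Ico s k,
      Measurable[F (i + 1)] (fun ω => h i ω * ξ i ω - (h i ω * ξ i ω) ^ 2) := fun i hi => by
    have h1 := ((hh i hi).mono (hF (Nat.le_succ i)) le_rfl).mul (hξ i hi)
    exact h1.sub (h1.pow_const 2)
  have hXb : ∀ i ∈ Finset.Ico s k, ∀ᵐ ω ∂μ, |h i ω * ξ i ω| ≤ 1 / 2 := fun i hi => by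
    filter_upwards [hξb i hi] with ω hω
    rw [abs_mul]
    calc _ ≤ 1 / 2 * 1 := mul_le_mul (hb i hi ω) hω (abs_nonneg _) (by norm_num)
      _ = 1 / 2 := by norm_num
  have hMm : ∀ t ∈ Finset.Icc s k, Measurable[F t] (fun ω => Real.exp (∑ i ∈ Finset.Ico s t,
      (h i ω * ξ i ω - (h i ω * ξ i ω) ^ 2))) := fun t ht =>
    Real.measurable_exp.comp (measurable_sum_of_adapted hF hXm (Finset.mem_Icc.1 ht).2)
  have hMb : ∀ t ∈ Finset.Icc s k, ∀ᵐ ω ∂μ, ‖Real.exp (∑ i ∈ Finset.Ico s t,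
      (h i ω * ξ i ω - (h i ω * ξ i ω) ^ 2))‖ ≤ Real.exp (t : ℝ) := fun t ht => by
    have hall : ∀ᵐ ω ∂μ, ∀ i ∈ Finset.Ico s k, |h i ω * ξ i ω| ≤ 1 / 2 := by
      rw [Finset.eventually_all]
      exact hXb
    filter_upwards [hall] with ω hω
    rw [Real.norm_eq_abs, Real.abs_exp, Real.exp_le_exp]
    calc _ ≤ ∑ i ∈ Finset.Ico s t, (1 : ℝ) := by
          refine Finset.sum_le_sum fun i hi => ?_
          have h1 := (abs_le.1 (hω i (Finset.Ico_subset_Ico_right (Finset.mem_Icc.1 ht).2 hi))).2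
          nlinarith [sq_nonneg (h i ω * ξ i ω)]
      _ = ((t - s : ℕ) : ℝ) := by simp
      _ ≤ t := by exact_mod_cast Nat.sub_le t s
  have hint : ∀ t ∈ Finset.Icc s k, Integrable (fun ω => Real.exp (∑ i ∈ Finset.Ico s t,
      (h i ω * ξ i ω - (h i ω * ξ i ω) ^ 2))) μ := fun t ht =>
    Integrable.of_bound ((hMm t ht).mono (hFm t ht) le_rfl).aestronglyMeasurable _ (hMb t ht)
  refine ⟨hint t (Finset.mem_Icc.2 ⟨hst, htk⟩), ?_⟩
  induction t, hst using Nat.le_induction with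
  | base => simp
  | succ t hst ih =>
    have ht : t ∈ Finset.Ico s k := Finset.mem_Ico.2 ⟨hst, htk⟩
    have ht' : t ∈ Finset.Icc s k := Finset.mem_Icc.2 ⟨hst, by omega⟩
    have ht1 : t + 1 ∈ Finset.Icc s k := Finset.mem_Icc.2 ⟨by omega, htk⟩
    set M : Ω → ℝ := fun ω => Real.exp (∑ i ∈ Finset.Ico s t,
      (h i ω * ξ i ω - (h i ω * ξ i ω) ^ 2)) with hM
    have hξi : Integrable (ξ t) μ :=
      Integrable.of_bound ((hξ t ht).mono (hFm _ ht1) le_rfl).aestronglyMeasurable 1 (hξb t ht)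
    have hMh : Measurable[F t] (fun ω => M ω * h t ω) := (hMm t ht').mul (hh t ht)
    have hMhb : ∀ᵐ ω ∂μ, ‖M ω * h t ω‖ ≤ Real.exp t * (1 / 2) := by
      filter_upwards [hMb t ht'] with ω hω
      rw [norm_mul]
      exact mul_le_mul hω (hb t ht ω) (norm_nonneg _) (Real.exp_pos _).le
    have hprod : Integrable (fun ω => M ω * h t ω * ξ t ω) μ :=
      hξi.bdd_mul (hMh.mono (hFm t ht') le_rfl).aestronglyMeasurable hMhb
    have hzero : ∫ ω, M ω * h t ω * ξ t ω ∂μ = 0 := by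
      rw [integral_mul_condExp (hFm t ht') hMh hprod hξi]
      rw [integral_congr_ae (g := fun _ => (0 : ℝ))]
      · simp
      · filter_upwards [hmean t ht] with ω hω
        rw [hω]; simp
    -- One more factor `exp (y - y²) ≤ 1 + y` with `y = h_t ξ_t`; the linear part integrates to zero
    -- because `M h_t` is predictable.
    calc ∫ ω, Real.exp (∑ i ∈ Finset.Ico s (t + 1), (h i ω * ξ i ω - (h i ω * ξ i ω) ^ 2)) ∂μ
        ≤ ∫ ω, (M ω + M ω * h t ω * ξ t ω) ∂μ := by
          refine integral_mono_ae (hint (t + 1) ht1) ((hint t ht').add hprod) ?_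
          filter_upwards [hXb t ht] with ω hω
          rw [Finset.sum_Ico_succ_top hst, Real.exp_add]
          have := mul_le_mul_of_nonneg_left (exp_sub_sq_le hω) (Real.exp_pos (∑ i ∈ Finset.Ico s t,
            (h i ω * ξ i ω - (h i ω * ξ i ω) ^ 2))).le
          simp only [hM]
          linarith
      _ = ∫ ω, M ω ∂μ := by
          rw [integral_add (hint t ht') hprod, hzero, add_zero]
      _ ≤ 1 := ih (by omega)

theorem exp_le_one_add_two_mul {y : ℝ} (h0 : 0 ≤ y) (h1 : y ≤ 1) : Real.exp y ≤ 1 + 2 * y := by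
  have h2 := Real.abs_exp_sub_one_sub_id_le (x := y) (by rw [abs_of_nonneg h0]; exact h1)
  rw [abs_le] at h2
  nlinarith [h2.2]

/-- `exp (∑ (ξ_i² - 2 E[ξ_i² | F_i]))` has mean at most `1` if `|ξ_i| ≤ 1`. -/
theorem integral_exp_sum_sq_sub_le_one [IsProbabilityMeasure μ] (hF : Monotone F)
    (hFm : ∀ i ∈ Finset.Icc s k, F i ≤ m0) {ξ : ℕ → Ω → ℝ}
    (hξ : ∀ i ∈ Finset.Ico s k, Measurable[F (i + 1)] (ξ i))
    (hξb : ∀ i ∈ Finset.Ico s k, ∀ᵐ ω ∂μ, |ξ i ω| ≤ 1) {t : ℕ} (hst : s ≤ t) (htk : t ≤ k) :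
    Integrable (fun ω => Real.exp (∑ i ∈ Finset.Ico s t,
      (ξ i ω ^ 2 - 2 * (μ[fun ω => ξ i ω ^ 2 | F i]) ω))) μ ∧
    ∫ ω, Real.exp (∑ i ∈ Finset.Ico s t,
      (ξ i ω ^ 2 - 2 * (μ[fun ω => ξ i ω ^ 2 | F i]) ω)) ∂μ ≤ 1 := by
  set v : ℕ → Ω → ℝ := fun i => μ[fun ω => ξ i ω ^ 2 | F i] with hv
  have hvm : ∀ i, Measurable[F i] (v i) := fun i => stronglyMeasurable_condExp.measurable
  have hv0 : ∀ i, ∀ᵐ ω ∂μ, 0 ≤ v i ω := fun i =>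
    condExp_nonneg (Filter.Eventually.of_forall fun ω => sq_nonneg _)
  have hXm : ∀ i ∈ Finset.Ico s k,
      Measurable[F (i + 1)] (fun ω => ξ i ω ^ 2 - 2 * v i ω) := fun i hi =>
    ((hξ i hi).pow_const 2).sub (((hvm i).mono (hF (Nat.le_succ i)) le_rfl).const_mul 2)
  have hsqb : ∀ i ∈ Finset.Ico s k, ∀ᵐ ω ∂μ, ξ i ω ^ 2 ≤ 1 := fun i hi => by
    filter_upwards [hξb i hi] with ω hω
    exact (sq_le_one_iff_abs_le_one _).2 hω
  have hMm : ∀ t ∈ Finset.Icc s k, Measurable[F t] (fun ω => Real.exp (∑ i ∈ Finset.Ico s t,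
      (ξ i ω ^ 2 - 2 * v i ω))) := fun t ht =>
    Real.measurable_exp.comp (measurable_sum_of_adapted hF hXm (Finset.mem_Icc.1 ht).2)
  have hMb : ∀ t ∈ Finset.Icc s k, ∀ᵐ ω ∂μ, ‖Real.exp (∑ i ∈ Finset.Ico s t,
      (ξ i ω ^ 2 - 2 * v i ω))‖ ≤ Real.exp (t : ℝ) := fun t ht => by
    have hall : ∀ᵐ ω ∂μ, ∀ i ∈ Finset.Ico s k, ξ i ω ^ 2 ≤ 1 := by
      rw [Finset.eventually_all]
      exact hsqb
    filter_upwards [hall, ae_all_iff.2 hv0] with ω hω hω0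
    rw [Real.norm_eq_abs, Real.abs_exp, Real.exp_le_exp]
    calc _ ≤ ∑ i ∈ Finset.Ico s t, (1 : ℝ) := by
          refine Finset.sum_le_sum fun i hi => ?_
          have h1 := hω i (Finset.Ico_subset_Ico_right (Finset.mem_Icc.1 ht).2 hi)
          linarith [hω0 i]
      _ = ((t - s : ℕ) : ℝ) := by simp
      _ ≤ t := by exact_mod_cast Nat.sub_le t s
  have hint : ∀ t ∈ Finset.Icc s k, Integrable (fun ω => Real.exp (∑ i ∈ Finset.Ico s t,
      (ξ i ω ^ 2 - 2 * v i ω))) μ := fun t ht =>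
    Integrable.of_bound ((hMm t ht).mono (hFm t ht) le_rfl).aestronglyMeasurable _ (hMb t ht)
  refine ⟨hint t (Finset.mem_Icc.2 ⟨hst, htk⟩), ?_⟩
  induction t, hst using Nat.le_induction with
  | base => simp
  | succ t hst ih =>
    have ht : t ∈ Finset.Ico s k := Finset.mem_Ico.2 ⟨hst, htk⟩
    have ht' : t ∈ Finset.Icc s k := Finset.mem_Icc.2 ⟨hst, by omega⟩
    have ht1 : t + 1 ∈ Finset.Icc s k := Finset.mem_Icc.2 ⟨by omega, htk⟩
    set M : Ω → ℝ := fun ω => Real.exp (∑ i ∈ Finset.Ico s t, (ξ i ω ^ 2 - 2 * v i ω)) with hM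
    have hsqm : Measurable[F (t + 1)] (fun ω => ξ t ω ^ 2) := (hξ t ht).pow_const 2
    have hξi : Integrable (fun ω => ξ t ω ^ 2) μ := by
      refine Integrable.of_bound (hsqm.mono (hFm _ ht1) le_rfl).aestronglyMeasurable 1 ?_
      filter_upwards [hsqb t ht] with ω hω
      rwa [Real.norm_eq_abs, abs_of_nonneg (sq_nonneg _)]
    have hNm : Measurable[F t] (fun ω => M ω * Real.exp (-(2 * v t ω))) :=
      (hMm t ht').mul (Real.measurable_exp.comp ((hvm t).const_mul 2).neg)
    have hNb : ∀ᵐ ω ∂μ, ‖M ω * Real.exp (-(2 * v t ω))‖ ≤ Real.exp t * 1 := by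
      filter_upwards [hMb t ht', hv0 t] with ω hω hω0
      rw [norm_mul]
      refine mul_le_mul hω ?_ (norm_nonneg _) (Real.exp_pos _).le
      rw [Real.norm_eq_abs, Real.abs_exp, Real.exp_le_one_iff]
      linarith
    have hNi : Integrable (fun ω => M ω * Real.exp (-(2 * v t ω))) μ :=
      Integrable.of_bound (hNm.mono (hFm t ht') le_rfl).aestronglyMeasurable _ hNb
    have hprod : Integrable (fun ω => M ω * Real.exp (-(2 * v t ω)) * ξ t ω ^ 2) μ :=
      hξi.bdd_mul (hNm.mono (hFm t ht') le_rfl).aestronglyMeasurable hNb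
    have hprodv : Integrable (fun ω => M ω * Real.exp (-(2 * v t ω)) * v t ω) μ :=
      integrable_condExp.bdd_mul (hNm.mono (hFm t ht') le_rfl).aestronglyMeasurable hNb
    have hcond : ∫ ω, M ω * Real.exp (-(2 * v t ω)) * ξ t ω ^ 2 ∂μ
        = ∫ ω, M ω * Real.exp (-(2 * v t ω)) * v t ω ∂μ :=
      integral_mul_condExp (hFm t ht') hNm hprod hξi
    calc ∫ ω, Real.exp (∑ i ∈ Finset.Ico s (t + 1), (ξ i ω ^ 2 - 2 * v i ω)) ∂μ
        ≤ ∫ ω, (M ω * Real.exp (-(2 * v t ω))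
            + 2 * (M ω * Real.exp (-(2 * v t ω)) * ξ t ω ^ 2)) ∂μ := by
          refine integral_mono_ae (hint (t + 1) ht1) (hNi.add (hprod.const_mul 2)) ?_
          filter_upwards [hsqb t ht] with ω hω
          rw [Finset.sum_Ico_succ_top hst, Real.exp_add, sub_eq_add_neg, Real.exp_add]
          have := mul_le_mul_of_nonneg_left (exp_le_one_add_two_mul (sq_nonneg (ξ t ω)) hω)
            (mul_pos (Real.exp_pos (∑ i ∈ Finset.Ico s t, (ξ i ω ^ 2 - 2 * v i ω)))
              (Real.exp_pos (-(2 * v t ω)))).le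
          simp only [hM]
          linarith
      _ = ∫ ω, (M ω * Real.exp (-(2 * v t ω))
            + 2 * (M ω * Real.exp (-(2 * v t ω)) * v t ω)) ∂μ := by
          rw [integral_add hNi (hprod.const_mul 2), integral_const_mul, hcond,
            ← integral_const_mul, ← integral_add hNi (hprodv.const_mul 2)]
      _ ≤ ∫ ω, M ω ∂μ := by
          refine integral_mono (hNi.add (hprodv.const_mul 2)) (hint t ht') fun ω => ?_
          -- The compensator `2 v` exactly pays for the conditional mean of `exp (ξ²) ≤ 1 + 2 ξ²`.
          have h1 : Real.exp (-(2 * v t ω)) * (1 + 2 * v t ω) ≤ 1 := by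
            have h2 := Real.add_one_le_exp (2 * v t ω)
            have h3 := mul_le_mul_of_nonneg_left h2 (Real.exp_pos (-(2 * v t ω))).le
            rw [← Real.exp_add, neg_add_cancel, Real.exp_zero] at h3
            linarith
          have h4 := mul_le_mul_of_nonneg_left h1 (Real.exp_pos (∑ i ∈ Finset.Ico s t,
            (ξ i ω ^ 2 - 2 * v i ω))).le
          simp only [hM]
          linarith
      _ ≤ 1 := ih (by omega)

theorem measure_le_exp_neg_of_integral_exp_le_one [IsProbabilityMeasure μ] {f : Ω → ℝ}
    (hf : Integrable (fun ω => Real.exp (f ω)) μ) (h : ∫ ω, Real.exp (f ω) ∂μ ≤ 1) (z : ℝ) :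
    μ {ω | z ≤ f ω} ≤ ENNReal.ofReal (Real.exp (-z)) := by
  have h1 := mul_meas_ge_le_integral_of_nonneg
    (Filter.Eventually.of_forall fun ω => (Real.exp_pos (f ω)).le) hf (Real.exp z)
  simp only [Real.exp_le_exp] at h1
  rw [← ofReal_measureReal]
  refine ENNReal.ofReal_le_ofReal ?_
  rw [Real.exp_neg, ← one_div, le_div_iff₀ (Real.exp_pos z), mul_comm]
  exact h1.trans h

end Martingale

/-! ### Measurability of the algorithm -/

section Measurability

variable {Ω : Type*} {m : MeasurableSpace Ω} {d : ℕ}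

theorem measurable_det {M : Ω → Matrix (Fin d) (Fin d) ℝ}
    (hM : ∀ p q, Measurable (fun ω => M ω p q)) : Measurable (fun ω => (M ω).det) := by
  simp_rw [Matrix.det_apply']
  exact Finset.measurable_fun_sum _ fun σ _ =>
    (Finset.measurable_fun_prod _ fun i _ => hM (σ i) i).const_mul _

/-- By Cramer's formula the entries are determinants times the inverse of a determinant. -/
theorem measurable_matrix_inv {M : Ω → Matrix (Fin d) (Fin d) ℝ}
    (hM : ∀ p q, Measurable (fun ω => M ω p q)) (p q : Fin d) :
    Measurable (fun ω => (M ω)⁻¹ p q) := by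
  simp_rw [Matrix.inv_def, Matrix.smul_apply, Ring.inverse_eq_inv', Matrix.adjugate_apply,
    smul_eq_mul]
  refine (measurable_det hM).inv.mul (measurable_det fun i j => ?_)
  simp_rw [Matrix.updateRow_apply]
  split_ifs
  · exact measurable_const
  · exact hM i j

theorem measurable_dotProduct_mulVec {M : Ω → Matrix (Fin d) (Fin d) ℝ} {u v : Ω → Fin d → ℝ}
    (hM : ∀ p q, Measurable (fun ω => M ω p q)) (hu : ∀ p, Measurable (fun ω => u ω p))
    (hv : ∀ p, Measurable (fun ω => v ω p)) :
    Measurable (fun ω => u ω ⬝ᵥ (M ω *ᵥ v ω)) := by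
  simp only [dotProduct, Matrix.mulVec]
  exact Finset.measurable_fun_sum _ fun p _ => (hu p).mul
    (Finset.measurable_fun_sum _ fun q _ => (hM p q).mul (hv q))

theorem measurable_coord {x : Ω → EuclideanSpace ℝ (Fin d)} (hx : Measurable x) (p : Fin d) :
    Measurable (fun ω => (x ω).ofLp p) :=
  (EuclideanSpace.proj p : EuclideanSpace ℝ (Fin d) →L[ℝ] ℝ).continuous.measurable.comp hx

theorem measurable_matNorm_inv {M : Ω → Matrix (Fin d) (Fin d) ℝ}
    (hM : ∀ p q, Measurable (fun ω => M ω p q)) {x : Ω → EuclideanSpace ℝ (Fin d)}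
    (hx : Measurable x) : Measurable (fun ω => matNorm (M ω)⁻¹ (x ω)) :=
  (measurable_dotProduct_mulVec (measurable_matrix_inv hM) (measurable_coord hx)
    (measurable_coord hx)).sqrt

/-- Describes the layer by finitely many inequalities between norms, from which measurability can be
read off. -/
theorem layer_eq_iff (L : ℕ) (s : State d) (x : EuclideanSpace ℝ (Fin d)) (ℓ : ℕ) :
    (ℓ = s.layer L x ∧ s.layer L x ≤ L) ↔
      (ℓ ∈ Finset.Icc 1 L ∧ (2 : ℝ) ^ (-(ℓ : ℤ)) ≤ matNorm (s.cov ℓ)⁻¹ x ∧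
        ∀ ℓ' ∈ Finset.Icc 1 L, ℓ' < ℓ → matNorm (s.cov ℓ')⁻¹ x < (2 : ℝ) ^ (-(ℓ' : ℤ))) := by
  rcases layer_spec L s x with h | h
  · constructor
    · rintro ⟨rfl, -⟩
      exact h
    · rintro ⟨h1, h2, h3⟩
      refine ⟨?_, (Finset.mem_Icc.1 h.1).2⟩
      rcases lt_trichotomy ℓ (s.layer L x) with hlt | heq | hgt
      · exact absurd h2 (not_le.2 (h.2.2 ℓ h1 hlt))
      · exact heq
      · exact absurd h.2.1 (not_le.2 (h3 _ h.1 hgt))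
  · constructor
    · rintro ⟨-, h1⟩
      omega
    · rintro ⟨h1, h2, -⟩
      exact absurd h2 (not_le.2 (h.2 ℓ h1))

theorem measurableSet_layer_eq (L : ℕ) {s : Ω → State d} {x : Ω → EuclideanSpace ℝ (Fin d)}
    (hs : ∀ ℓ p q, Measurable (fun ω => (s ω).cov ℓ p q)) (hx : Measurable x) (ℓ : ℕ) :
    MeasurableSet {ω | ℓ = (s ω).layer L (x ω) ∧ (s ω).layer L (x ω) ≤ L} := by
  simp_rw [layer_eq_iff]
  refine (MeasurableSet.const _).inter ((measurableSet_le measurable_const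
    (measurable_matNorm_inv (hs ℓ) hx)).inter ?_)
  have : {ω | ∀ ℓ' ∈ Finset.Icc 1 L, ℓ' < ℓ →
      matNorm ((s ω).cov ℓ')⁻¹ (x ω) < (2 : ℝ) ^ (-(ℓ' : ℤ))}
      = ⋂ ℓ' ∈ Finset.Icc 1 L, {ω | ℓ' < ℓ →
        matNorm ((s ω).cov ℓ')⁻¹ (x ω) < (2 : ℝ) ^ (-(ℓ' : ℤ))} := by
    ext ω
    simp
  rw [show (fun ω => ∀ ℓ' ∈ Finset.Icc 1 L, ℓ' < ℓ →
      matNorm ((s ω).cov ℓ')⁻¹ (x ω) < (2 : ℝ) ^ (-(ℓ' : ℤ))) = _ from this]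
  refine Finset.measurableSet_biInter _ fun ℓ' _ => ?_
  by_cases h : ℓ' < ℓ
  · simp only [h, true_imp_iff]
    exact measurableSet_lt (measurable_matNorm_inv (hs ℓ') hx) measurable_const
  · simp [h]

variable (w L : ℕ) {a : ℕ → Ω → EuclideanSpace ℝ (Fin d)} (r : Ω → ℕ → ℝ)

/-- Layers, weights and covariances depend on the arms alone. Hence nothing is assumed about the
rewards, and the weight of round `i` is known before its noise. -/
theorem measurable_state_cov {k : ℕ} (ha : ∀ i ∈ Finset.Ico 1 k, Measurable (a i)) (ℓ : ℕ)
    (p q : Fin d) :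
    Measurable (fun ω => (state w L (fun i => a i ω) (r ω) k).cov ℓ p q) := by
  induction k generalizing ℓ p q with
  | zero => simp only [state]; exact measurable_const
  | succ k ih =>
    by_cases hr : k = 0 ∨ (k + 1) % w = 0
    · simp_rw [state_succ_of_restart w L _ _ hr]
      exact measurable_const
    · simp_rw [state_succ_of_not_restart w L _ _ hr]
      have hk : 1 ≤ k := by
        by_contra! h
        exact hr (Or.inl (by omega))
      have ih' := ih fun i hi => ha i (Finset.Ico_subset_Ico_right (Nat.le_succ k) hi)
      have hak : Measurable (a k) := ha k (Finset.mem_Ico.2 ⟨hk, Nat.lt_succ_self k⟩)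
      have heq : (fun ω => ((state w L (fun i => a i ω) (r ω) k).update L k (a k ω)
            (r ω k)).cov ℓ p q)
          = fun ω => if ω ∈ {ω | ℓ = (state w L (fun i => a i ω) (r ω) k).layer L (a k ω) ∧
              (state w L (fun i => a i ω) (r ω) k).layer L (a k ω) ≤ L} then
            (state w L (fun i => a i ω) (r ω) k).cov ℓ p q
              + ((2 : ℝ) ^ (-(ℓ : ℤ))
                / matNorm ((state w L (fun i => a i ω) (r ω) k).cov ℓ)⁻¹ (a k ω)) ^ 2
                * ((a k ω).ofLp p * (a k ω).ofLp q)
            else (state w L (fun i => a i ω) (r ω) k).cov ℓ p q := by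
        funext ω
        simp only [State.update, Set.mem_ofPred_eq]
        split_ifs with h
        · rw [← h.1]
          simp [Matrix.vecMulVec_apply]
        · rfl
      rw [heq]
      refine Measurable.ite (measurableSet_layer_eq L ih' hak ℓ) ?_ (ih' ℓ p q)
      exact (ih' ℓ p q).add (((measurable_const.div (measurable_matNorm_inv (ih' ℓ) hak)).pow_const
        2).mul ((measurable_coord hak p).mul (measurable_coord hak q)))

theorem measurable_wgt {k ℓ : ℕ} (hk : 1 ≤ k) (hℓ : ℓ ≤ L)
    (ha : ∀ i ∈ Finset.Icc 1 k, Measurable (a i)) :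
    Measurable (fun ω => wgt w L (fun i => a i ω) (r ω) ℓ k) := by
  have hcov := measurable_state_cov w L r (a := a) (k := k) fun i hi =>
    ha i (Finset.mem_Icc.2 ⟨(Finset.mem_Ico.1 hi).1, (Finset.mem_Ico.1 hi).2.le⟩)
  have hak := ha k (Finset.mem_Icc.2 ⟨hk, le_rfl⟩)
  have heq : (fun ω => wgt w L (fun i => a i ω) (r ω) ℓ k)
      = fun ω => if ω ∈ {ω | ℓ = (state w L (fun i => a i ω) (r ω) k).layer L (a k ω) ∧
              (state w L (fun i => a i ω) (r ω) k).layer L (a k ω) ≤ L} then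
            (2 : ℝ) ^ (-(ℓ : ℤ))
                / matNorm ((state w L (fun i => a i ω) (r ω) k).cov ℓ)⁻¹ (a k ω)
            else 0 := by
    funext ω
    by_cases h : lay w L (fun i => a i ω) (r ω) k = ℓ
    · have h' : ω ∈ {ω | ℓ = (state w L (fun i => a i ω) (r ω) k).layer L (a k ω) ∧
          (state w L (fun i => a i ω) (r ω) k).layer L (a k ω) ≤ L} :=
        ⟨h.symm, (le_of_eq h).trans hℓ⟩
      rw [if_pos h', wgt, if_pos h]
    · have h' : ω ∉ {ω | ℓ = (state w L (fun i => a i ω) (r ω) k).layer L (a k ω) ∧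
          (state w L (fun i => a i ω) (r ω) k).layer L (a k ω) ≤ L} := fun hω => h hω.1.symm
      rw [if_neg h', wgt, if_neg h]
  rw [heq]
  exact Measurable.ite (measurableSet_layer_eq L hcov hak ℓ)
    (measurable_const.div (measurable_matNorm_inv (hcov ℓ) hak)) measurable_const

theorem measurable_feat {k ℓ : ℕ} (hk : 1 ≤ k) (hℓ : ℓ ≤ L)
    (ha : ∀ i ∈ Finset.Icc 1 k, Measurable (a i)) (p : Fin d) :
    Measurable (fun ω => feat w L (fun i => a i ω) (r ω) ℓ k p) := by
  simp only [feat, Pi.smul_apply, smul_eq_mul]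
  exact (measurable_wgt w L r hk hℓ ha).mul
    (measurable_coord (ha k (Finset.mem_Icc.2 ⟨hk, le_rfl⟩)) p)

theorem measurable_gram {c : ℝ} {x : ℕ → Ω → Fin d → ℝ} {s t : ℕ}
    (hx : ∀ i ∈ Finset.Ico s t, ∀ p, Measurable (fun ω => x i ω p)) (p q : Fin d) :
    Measurable (fun ω => gram c (fun i => x i ω) s t p q) := by
  simp only [gram, Matrix.add_apply, Matrix.sum_apply, Matrix.vecMulVec_apply]
  exact measurable_const.add (Finset.measurable_fun_sum _ fun i hi => (hx i hi p).mul (hx i hi q))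

/-- Predictability: the features are needed up to time `t`, the noises only before `t`. -/
theorem measurable_truncDrift {c B : ℝ} {x : ℕ → Ω → Fin d → ℝ} {η : ℕ → Ω → ℝ} {s t : ℕ}
    (hst : s ≤ t)
    (hx : ∀ i ∈ Finset.Icc s t, ∀ p, Measurable (fun ω => x i ω p))
    (hη : ∀ i ∈ Finset.Ico s t, Measurable (η i)) :
    Measurable (fun ω => truncDrift c (fun i => x i ω) (fun i => η i ω) s B t) := by
  have hx' : ∀ i ∈ Finset.Ico s t, ∀ p, Measurable (fun ω => x i ω p) := fun i hi =>
    hx i (Finset.Ico_subset_Icc_self hi)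
  have hxt := hx t (Finset.mem_Icc.2 ⟨hst, le_rfl⟩)
  have hG := measurable_matrix_inv (measurable_gram (c := c) hx')
  have hb : ∀ p, Measurable (fun ω => (∑ i ∈ Finset.Ico s t, η i ω • x i ω) p) := fun p => by
    simp only [Finset.sum_apply, Pi.smul_apply, smul_eq_mul]
    exact Finset.measurable_fun_sum _ fun i hi => (hη i hi).mul (hx' i hi p)
  unfold truncDrift
  refine Measurable.ite (measurableSet_le (measurable_dotProduct_mulVec hG hb hb)
    measurable_const) ?_ measurable_const
  exact (measurable_dotProduct_mulVec hG hxt hb).div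
    (measurable_const.add (measurable_dotProduct_mulVec hG hxt hxt))

end Measurability

/-! ### The filtration generated by arms and noises. -/

section History

variable {Ω : Type*} {d : ℕ} (a : ℕ → Ω → EuclideanSpace ℝ (Fin d)) (ε : ℕ → Ω → ℝ)

theorem history_mono : Monotone (history a ε) := by
  intro i j hij
  refine sup_le_sup ?_ ?_
  · exact biSup_mono fun t ht => Finset.Icc_subset_Icc_right hij ht
  · exact biSup_mono fun t ht => Finset.Icc_subset_Icc_right (by omega) ht

theorem measurable_arm_history {i k : ℕ} (hi : i ∈ Finset.Icc 1 k) :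
    Measurable[history a ε k] (a i) := by
  refine Measurable.mono (comap_measurable (a i)) ?_ le_rfl
  exact (le_biSup (fun t => MeasurableSpace.comap (a t) inferInstance) hi).trans le_sup_left

theorem measurable_noise_history {i k : ℕ} (hi : i ∈ Finset.Icc 1 (k - 1)) :
    Measurable[history a ε k] (ε i) := by
  refine Measurable.mono (comap_measurable (ε i)) ?_ le_rfl
  exact (le_biSup (fun t => MeasurableSpace.comap (ε t) inferInstance) hi).trans le_sup_right

theorem history_le {m0 : MeasurableSpace Ω} {K k : ℕ} (hk : k ≤ K)
    (ha : ∀ i ∈ Finset.Icc 1 K, Measurable (a i)) (hε : ∀ i ∈ Finset.Icc 1 K, Measurable (ε i)) :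
    history a ε k ≤ m0 := by
  refine sup_le (iSup₂_le fun t ht => ?_) (iSup₂_le fun t ht => ?_)
  · exact (ha t (Finset.Icc_subset_Icc_right hk ht)).comap_le
  · exact (hε t (Finset.Icc_subset_Icc_right (by omega) ht)).comap_le

end History

/-! ### Deviation events -/

section Deviation

variable {d : ℕ}

/-- The weighted noise of round `i` in layer `ℓ`. -/
def wnoise (w L : ℕ) (a : ℕ → EuclideanSpace ℝ (Fin d)) (r ξ : ℕ → ℝ) (ℓ i : ℕ) : ℝ :=
  wgt w L a r ℓ i * ξ i

/-- The exponent at time `t` of the truncated exponential process of layer `ℓ` and level `g`. -/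
def exponent (w L : ℕ) (ι : ℝ) (a : ℕ → EuclideanSpace ℝ (Fin d)) (r ξ : ℕ → ℝ) (ℓ s t : ℕ)
    (g : ℝ) : ℝ :=
  ∑ i ∈ Finset.Ico s t,
    (2 / (9 * reg ℓ * g) * (wnoise w L a r ξ ℓ i * truncDrift (reg ℓ) (feat w L a r ℓ)
        (wnoise w L a r ξ ℓ) s (36 * reg ℓ * g * ι) i)
      - (2 / (9 * reg ℓ * g) * (wnoise w L a r ξ ℓ i * truncDrift (reg ℓ) (feat w L a r ℓ)
        (wnoise w L a r ξ ℓ) s (36 * reg ℓ * g * ι) i)) ^ 2)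

/-- In round `k`, the exponential process of some layer, time and level exceeds `2 ι`. -/
def Deviates (w L : ℕ) (ι : ℝ) (a : ℕ → EuclideanSpace ℝ (Fin d)) (r ξ : ℕ → ℝ) (k : ℕ) : Prop :=
  ∃ ℓ ∈ Finset.Icc 1 L, ∃ t ∈ Finset.Icc (start w k) k, ∃ j ∈ Finset.range (w + 1),
    2 * ι ≤ exponent w L ι a r ξ ℓ (start w k) t (8 * ι + j)

/-- The correct level `g` depends on the random sum `V` of squared noises. As `V ≤ w`, rounding `V`
up to an integer places `g` on the finite grid over which deviations were excluded. -/
theorem selfNorm_le_of_not_deviates {w L : ℕ} (hw : 1 ≤ w) {ι : ℝ} (hι : 1 ≤ ι)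
    {a : ℕ → EuclideanSpace ℝ (Fin d)} {r ξ : ℕ → ℝ} {k : ℕ} (hk : 1 ≤ k)
    (hξ : ∀ i ∈ Finset.Ico (start w k) k, |ξ i| ≤ 1) (h : ¬ Deviates w L ι a r ξ k)
    {ℓ : ℕ} (hℓ : ℓ ∈ Finset.Icc 1 L) :
    selfNorm (reg ℓ) (feat w L a r ℓ) (wnoise w L a r ξ ℓ) (start w k) k
      ≤ 36 * reg ℓ * ι
        * (∑ i ∈ Finset.Ico (start w k) k, wnoise w L a r ξ ℓ i ^ 2 + 9 * ι) := by
  have hℓL := (Finset.mem_Icc.1 hℓ).2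
  set V := ∑ i ∈ Finset.Ico (start w k) k, wnoise w L a r ξ ℓ i ^ 2 with hV
  have hV0 : 0 ≤ V := Finset.sum_nonneg fun _ _ => sq_nonneg _
  have hVw : V ≤ w := by
    calc V ≤ ∑ i ∈ Finset.Ico (start w k) k, (1 : ℝ) := by
          refine Finset.sum_le_sum fun i hi => ?_
          rw [wnoise, mul_pow]
          have h1 := pow_le_one₀ (n := 2) (wgt_nonneg w L a r ℓ i) (wgt_le_one w L a r hℓL i)
          have h2 := (sq_le_one_iff_abs_le_one _).2 (hξ i hi)
          exact mul_le_one₀ h1 (sq_nonneg _) h2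
      _ = ((k - start w k : ℕ) : ℝ) := by simp
      _ ≤ w := by
          have := lt_start_add hw k
          exact_mod_cast (by omega : k - start w k ≤ w)
  have hc := reg_pos ℓ
  have key := selfNorm_le_of_exponent_le (feat w L a r ℓ) (wnoise w L a r ξ ℓ) (start w k) hc
    (g := 8 * ι + ⌈V⌉₊) hι (by linarith [Nat.cast_nonneg (α := ℝ) ⌈V⌉₊]) (k := k)
    (fun i hi => by
      rw [Finset.mem_Ico] at hi
      rw [← start_eq_of_mem hw hi.1 hi.2.le]
      exact feat_gram_inv_feat_le w L a r ((one_le_start w k).trans hi.1) hℓL)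
    (by linarith [Nat.le_ceil V])
    (fun t ht => by
      by_contra! hlt
      refine h ⟨ℓ, hℓ, t, ht, ⌈V⌉₊, ?_, hlt.le⟩
      rw [Finset.mem_range, Nat.lt_succ_iff]
      exact Nat.ceil_le.2 hVw)
    k (Finset.mem_Icc.2 ⟨start_le hk, le_rfl⟩)
  refine key.trans ?_
  have h1 : (⌈V⌉₊ : ℝ) ≤ V + 1 := (Nat.ceil_lt_add_one hV0).le
  have h2 : 8 * ι + (⌈V⌉₊ : ℝ) ≤ V + 9 * ι := by linarith
  calc 36 * reg ℓ * (8 * ι + ⌈V⌉₊) * ι = 36 * reg ℓ * ι * (8 * ι + ⌈V⌉₊) := by ring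
    _ ≤ _ := mul_le_mul_of_nonneg_left h2 (by positivity)

variable {Ω : Type*} [MeasurableSpace Ω] {μ : Measure Ω}
  {K : ℕ} {a : ℕ → Ω → EuclideanSpace ℝ (Fin d)} {ε : ℕ → Ω → ℝ} {R : ℝ}

theorem abs_div_le_one (hR : 0 ≤ R) {y : ℝ} (h : |y| ≤ R) : |y / R| ≤ 1 := by
  rw [abs_div, abs_of_nonneg hR]
  exact div_le_one_of_le₀ h hR

/-- The square is at most `16/9 · ι / g`, and `g ≥ 8 ι` makes this at most `2/9 < 1/4`. This is the
boundedness that the exponential inequality requires, and the reason why the grid of levels starts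
at `8 ι`. -/
theorem abs_mul_truncDrift_le {w L : ℕ} (hw : 1 ≤ w) {ι g : ℝ} (hι : 1 ≤ ι) (hg : 8 * ι ≤ g)
    (a : ℕ → EuclideanSpace ℝ (Fin d)) (r ξ : ℕ → ℝ) {ℓ i k : ℕ} (hℓ : ℓ ≤ L)
    (hi : i ∈ Finset.Ico (start w k) k) :
    |2 / (9 * reg ℓ * g) * (wgt w L a r ℓ i * truncDrift (reg ℓ) (feat w L a r ℓ)
        (wnoise w L a r ξ ℓ) (start w k) (36 * reg ℓ * g * ι) i)| ≤ 1 / 2 := by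
  have hc := reg_pos ℓ
  have hg0 : 0 < g := by linarith
  rw [Finset.mem_Ico] at hi
  have hq := feat_gram_inv_feat_le w L a r ((one_le_start w k).trans hi.1) hℓ
  rw [start_eq_of_mem hw hi.1 hi.2.le] at hq
  have h1 := truncDrift_sq_le (feat w L a r ℓ) (wnoise w L a r ξ ℓ) (start w k) hc
    (B := 36 * reg ℓ * g * ι) (by positivity) hq
  refine abs_le_of_sq_le_sq ?_ (by norm_num)
  rw [mul_pow, mul_pow]
  have h2 := pow_le_one₀ (n := 2) (wgt_nonneg w L a r ℓ i) (wgt_le_one w L a r hℓ i)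
  set T := truncDrift (reg ℓ) (feat w L a r ℓ) (wnoise w L a r ξ ℓ) (start w k)
    (36 * reg ℓ * g * ι) i
  have h3 : wgt w L a r ℓ i ^ 2 * T ^ 2 ≤ 1 * (reg ℓ * (36 * reg ℓ * g * ι)) :=
    mul_le_mul h2 h1 (sq_nonneg _) zero_le_one
  refine (mul_le_mul_of_nonneg_left h3 (sq_nonneg _)).trans ?_
  have h4 : (2 / (9 * reg ℓ * g)) ^ 2 * (1 * (reg ℓ * (36 * reg ℓ * g * ι))) = 16 / 9 * (ι / g) := by
    field_simp
    ring
  rw [h4]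
  have h5 : ι / g ≤ 1 / 8 := by
    rw [div_le_div_iff₀ hg0 (by norm_num)]
    linarith
  linarith

theorem condExp_div_eq_zero {m : MeasurableSpace Ω} {f : Ω → ℝ} (h : μ[f | m] =ᵐ[μ] 0) (R : ℝ) :
    μ[fun ω => f ω / R | m] =ᵐ[μ] 0 := by
  have h1 : (fun ω => f ω / R) = R⁻¹ • f := by
    funext ω
    simp [div_eq_inv_mul]
  rw [h1]
  filter_upwards [condExp_smul R⁻¹ f m (μ := μ), h] with ω h2 h3
  rw [h2, Pi.smul_apply, h3]
  simp

/-- The weight times the truncated drift is measurable with respect to the history before the noise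
of the same round, so the exponential supermartingale and Markov's inequality apply. -/
theorem measure_exponent_le [IsProbabilityMeasure μ] (ha : ∀ i ∈ Finset.Icc 1 K, Measurable (a i))
    (hε : ∀ i ∈ Finset.Icc 1 K, Measurable (ε i)) (hR : 0 ≤ R)
    (hεR : ∀ i ∈ Finset.Icc 1 K, ∀ᵐ ω ∂μ, |ε i ω| ≤ R)
    (hmean : ∀ i ∈ Finset.Icc 1 K, μ[ε i | history a ε i] =ᵐ[μ] 0)
    (r : Ω → ℕ → ℝ) {w L : ℕ} (hw : 1 ≤ w) {ι g : ℝ} (hι : 1 ≤ ι) (hg : 8 * ι ≤ g)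
    {ℓ k t : ℕ} (hℓ : ℓ ≤ L) (hk : k ∈ Finset.Icc 1 K) (ht : t ∈ Finset.Icc (start w k) k) (z : ℝ) :
    μ {ω | z ≤ exponent w L ι (fun i => a i ω) (r ω) (fun i => ε i ω / R) ℓ (start w k) t g}
      ≤ ENNReal.ofReal (Real.exp (-z)) := by
  rw [Finset.mem_Icc] at hk ht
  set s := start w k with hs
  have hs1 : 1 ≤ s := one_le_start w k
  have hmem : ∀ i ∈ Finset.Ico s k, i ∈ Finset.Icc 1 K := fun i hi => by
    rw [Finset.mem_Ico] at hi
    rw [Finset.mem_Icc]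
    omega
  set h : ℕ → Ω → ℝ := fun i ω => 2 / (9 * reg ℓ * g) * (wgt w L (fun i => a i ω) (r ω) ℓ i *
    truncDrift (reg ℓ) (feat w L (fun i => a i ω) (r ω) ℓ)
        (wnoise w L (fun i => a i ω) (r ω) (fun i => ε i ω / R) ℓ) s (36 * reg ℓ * g * ι) i) with hh
  have hnoise : ∀ i ∈ Finset.Ico s k, Measurable[history a ε (i + 1)] (fun ω => ε i ω / R) :=
    fun i hi => by
      rw [Finset.mem_Ico] at hi
      exact (measurable_noise_history a ε (Finset.mem_Icc.2 ⟨hs1.trans hi.1, by omega⟩)).div_const R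
  have key := integral_exp_sum_sub_sq_le_one (μ := μ) (s := s) (k := k) (history_mono a ε)
    (fun i hi => history_le a ε ((Finset.mem_Icc.1 hi).2.trans hk.2) ha hε)
    (h := h) (ξ := fun i ω => ε i ω / R)
    (fun i hi => by
      rw [Finset.mem_Ico] at hi
      have harm : ∀ j ∈ Finset.Icc 1 i, Measurable[history a ε i] (a j) := fun j hj =>
        measurable_arm_history a ε hj
      have harm' : ∀ i' ≤ i, ∀ j ∈ Finset.Icc 1 i', Measurable[history a ε i] (a j) :=
        fun i' hi' j hj => harm j (Finset.Icc_subset_Icc_right hi' hj)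
      refine Measurable.const_mul (Measurable.mul ?_ ?_) _
      · exact measurable_wgt (m := history a ε i) w L r (hs1.trans hi.1) hℓ harm
      · refine measurable_truncDrift (m := history a ε i)
          (x := fun j ω => feat w L (fun i => a i ω) (r ω) ℓ j)
          (η := fun j ω => wnoise w L (fun i => a i ω) (r ω) (fun i => ε i ω / R) ℓ j)
          hi.1 (fun j hj p => ?_) fun j hj => ?_
        · rw [Finset.mem_Icc] at hj
          exact measurable_feat (m := history a ε i) w L r (hs1.trans hj.1) hℓ (harm' j hj.2) p
        · rw [Finset.mem_Ico] at hj
          refine Measurable.mul (measurable_wgt (m := history a ε i) w L r (hs1.trans hj.1) hℓ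
            (harm' j hj.2.le)) ?_
          exact (measurable_noise_history a ε
            (Finset.mem_Icc.2 ⟨hs1.trans hj.1, by omega⟩)).div_const R)
    (fun i hi ω => abs_mul_truncDrift_le hw hι hg _ _ _ hℓ hi)
    hnoise
    (fun i hi => by
      filter_upwards [hεR i (hmem i hi)] with ω hω
      exact abs_div_le_one hR hω)
    (fun i hi => condExp_div_eq_zero (hmean i (hmem i hi)) R) ht.1 ht.2
  have hex : ∀ ω, exponent w L ι (fun i => a i ω) (r ω) (fun i => ε i ω / R) ℓ s t g
      = ∑ i ∈ Finset.Ico s t, (h i ω * (ε i ω / R) - (h i ω * (ε i ω / R)) ^ 2) := fun ω => by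
    refine Finset.sum_congr rfl fun i _ => ?_
    simp only [hh, wnoise]
    ring
  simp_rw [hex]
  exact measure_le_exp_neg_of_integral_exp_le_one key.1 key.2 z

/-- A union bound over `L` layers, at most `w` times in the window and `w + 1` levels. -/
theorem measure_deviates_le [IsProbabilityMeasure μ] (ha : ∀ i ∈ Finset.Icc 1 K, Measurable (a i))
    (hε : ∀ i ∈ Finset.Icc 1 K, Measurable (ε i)) (hR : 0 ≤ R)
    (hεR : ∀ i ∈ Finset.Icc 1 K, ∀ᵐ ω ∂μ, |ε i ω| ≤ R)
    (hmean : ∀ i ∈ Finset.Icc 1 K, μ[ε i | history a ε i] =ᵐ[μ] 0)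
    (r : Ω → ℕ → ℝ) {w L : ℕ} (hw : 1 ≤ w) {ι : ℝ} (hι : 1 ≤ ι)
    {k : ℕ} (hk : k ∈ Finset.Icc 1 K) :
    μ {ω | Deviates w L ι (fun i => a i ω) (r ω) (fun i => ε i ω / R) k}
      ≤ ENNReal.ofReal (L * w * (w + 1) * Real.exp (-(2 * ι))) := by
  have hsub : {ω | Deviates w L ι (fun i => a i ω) (r ω) (fun i => ε i ω / R) k}
      ⊆ ⋃ q ∈ Finset.Icc 1 L ×ˢ Finset.Icc (start w k) k ×ˢ Finset.range (w + 1),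
        {ω | 2 * ι ≤ exponent w L ι (fun i => a i ω) (r ω) (fun i => ε i ω / R) q.1 (start w k)
          q.2.1 (8 * ι + q.2.2)} := by
    rintro ω ⟨ℓ, hℓ, t, ht, j, hj, h⟩
    simp only [Set.mem_iUnion]
    exact ⟨(ℓ, t, j), by simp only [Finset.mem_product]; exact ⟨hℓ, ht, hj⟩, h⟩
  refine (measure_mono hsub).trans ((measure_biUnion_finset_le _ _).trans ?_)
  refine (Finset.sum_le_card_nsmul _ _ (ENNReal.ofReal (Real.exp (-(2 * ι)))) ?_).trans ?_
  · intro q hq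
    simp only [Finset.mem_product] at hq
    exact measure_exponent_le ha hε hR hεR hmean r hw hι
      (by linarith [Nat.cast_nonneg (α := ℝ) q.2.2]) (Finset.mem_Icc.1 hq.1).2 hk hq.2.1 _
  · rw [nsmul_eq_mul, ← ENNReal.ofReal_natCast, ← ENNReal.ofReal_mul (Nat.cast_nonneg _)]
    refine ENNReal.ofReal_le_ofReal (mul_le_mul_of_nonneg_right ?_ (Real.exp_pos _).le)
    have h1 : k + 1 - start w k ≤ w := by
      have := lt_start_add hw k
      omega
    have h2 : (Finset.Icc 1 L ×ˢ Finset.Icc (start w k) k ×ˢ Finset.range (w + 1)).card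
        ≤ L * w * (w + 1) := by
      simp only [Finset.card_product, Nat.card_Icc, Finset.card_range, Nat.add_sub_cancel]
      rw [mul_assoc]
      exact Nat.mul_le_mul_left _ (Nat.mul_le_mul_right _ h1)
    exact_mod_cast h2

/-- Markov's inequality for the number of events that occur. -/
theorem measure_card_ge_le {ι' : Type*} (S : Finset ι') (E : ι' → Set Ω) {p z : ℝ}
    (hz : 0 < z) (hE : ∀ i ∈ S, μ (E i) ≤ ENNReal.ofReal p) :
    μ {ω | z ≤ ∑ i ∈ S, (E i).indicator (fun _ => (1 : ℝ)) ω}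
      ≤ ENNReal.ofReal (S.card * p / z) := by
  -- The events need not be measurable; measurable hulls have the same measure and make the count a
  -- measurable function.
  set f : Ω → ENNReal := fun ω => ∑ i ∈ S, (toMeasurable μ (E i)).indicator (fun _ => 1) ω with hf
  have hfm : Measurable f := Finset.measurable_fun_sum _ fun i _ =>
    measurable_const.indicator (measurableSet_toMeasurable μ (E i))
  have hsub : {ω | z ≤ ∑ i ∈ S, (E i).indicator (fun _ => (1 : ℝ)) ω}
      ⊆ {ω | ENNReal.ofReal z ≤ f ω} := by
    intro ω hω
    refine (ENNReal.ofReal_le_ofReal (Set.mem_ofPred_eq ▸ hω)).trans ?_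
    rw [ENNReal.ofReal_sum_of_nonneg fun i _ => Set.indicator_nonneg (fun _ _ => zero_le_one) _]
    refine Finset.sum_le_sum fun i _ => ?_
    by_cases h : ω ∈ E i
    · rw [Set.indicator_of_mem h, Set.indicator_of_mem (subset_toMeasurable μ _ h)]
      simp
    · rw [Set.indicator_of_notMem h]
      simp
  refine (measure_mono hsub).trans ?_
  have hz' : ENNReal.ofReal z ≠ 0 := by simpa using hz
  refine (meas_ge_le_lintegral_div hfm.aemeasurable hz' ENNReal.ofReal_ne_top).trans ?_
  have hint : ∫⁻ ω, f ω ∂μ ≤ ENNReal.ofReal (S.card * p) := by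
    rw [lintegral_finsetSum _ fun i _ =>
      measurable_const.indicator (measurableSet_toMeasurable μ (E i))]
    have h1 : ∀ i ∈ S, ∫⁻ ω, (toMeasurable μ (E i)).indicator (fun _ => (1 : ENNReal)) ω ∂μ
        ≤ ENNReal.ofReal p := fun i hi => by
      rw [lintegral_indicator_const (measurableSet_toMeasurable μ _), measure_toMeasurable, one_mul]
      exact hE i hi
    refine (Finset.sum_le_card_nsmul _ _ _ h1).trans ?_
    rw [nsmul_eq_mul, ← ENNReal.ofReal_natCast, ← ENNReal.ofReal_mul (Nat.cast_nonneg _)]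
  rw [ENNReal.ofReal_div_of_pos hz]
  exact ENNReal.div_le_div_right hint _

/-- The sum of the squared noises is controlled by the sum of the conditional variances. -/
theorem measure_sum_sq_noise_ge_le [IsProbabilityMeasure μ] (ha : ∀ i ∈ Finset.Icc 1 K, Measurable (a i))
    (hε : ∀ i ∈ Finset.Icc 1 K, Measurable (ε i)) (hR : 0 ≤ R)
    (hεR : ∀ i ∈ Finset.Icc 1 K, ∀ᵐ ω ∂μ, |ε i ω| ≤ R) {σ : ℕ → Ω → ℝ}
    (hvar : ∀ i ∈ Finset.Icc 1 K,
      μ[fun ω => ε i ω ^ 2 | history a ε i] =ᵐ[μ] fun ω => σ i ω ^ 2)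
    (hK : 1 ≤ K) {VK : ℝ} (hV : ∀ᵐ ω ∂μ, ∑ i ∈ Finset.Icc 1 K, σ i ω ^ 2 ≤ VK) (z : ℝ) :
    μ {ω | 2 * VK + R ^ 2 * z < ∑ i ∈ Finset.Icc 1 K, ε i ω ^ 2} ≤ ENNReal.ofReal (Real.exp (-z)) := by
  have hIcc : ∀ i, i ∈ Finset.Ico 1 (K + 1) ↔ i ∈ Finset.Icc 1 K := fun i => by
    simp only [Finset.mem_Ico, Finset.mem_Icc]; omega
  have hIco : Finset.Ico 1 (K + 1) = Finset.Icc 1 K := Finset.ext hIcc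
  -- For `R = 0` the noise vanishes almost surely and normalization by `R` would be meaningless.
  rcases hR.eq_or_lt with hR0 | hRpos
  · refine le_of_eq_of_le ?_ bot_le
    have h1 : ∀ᵐ ω ∂μ, ∀ i ∈ Finset.Icc 1 K, |ε i ω| ≤ R := by
      rw [Finset.eventually_all]
      exact hεR
    have h2 : ∀ᵐ ω ∂μ, ¬ (2 * VK + R ^ 2 * z < ∑ i ∈ Finset.Icc 1 K, ε i ω ^ 2) := by
      filter_upwards [h1, hV] with ω h1 h2
      have h3 : ∑ i ∈ Finset.Icc 1 K, ε i ω ^ 2 = 0 := Finset.sum_eq_zero fun i hi => by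
        have := h1 i hi
        rw [← hR0] at this
        rw [abs_nonpos_iff.1 this]
        simp
      have h4 : 0 ≤ ∑ i ∈ Finset.Icc 1 K, σ i ω ^ 2 := Finset.sum_nonneg fun _ _ => sq_nonneg _
      rw [h3, ← hR0]
      simp only [not_lt]
      nlinarith
    exact measure_eq_zero_iff_ae_notMem.2 h2
  -- The filtration is needed up to time `K + 1`, but arms are measurable only up to round `K`;
  -- freezing the arm at time `K` changes nothing earlier.
  set F : ℕ → MeasurableSpace Ω := history (fun t => a (min t K)) ε with hF
  have hFeq : ∀ i ∈ Finset.Icc 1 K, F i = history a ε i := fun i hi => by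
    rw [Finset.mem_Icc] at hi
    rw [hF, history, history]
    congr 1
    refine iSup_congr fun t => iSup_congr fun ht => ?_
    rw [min_eq_left ((Finset.mem_Icc.1 ht).2.trans hi.2)]
  have hFle : ∀ i ∈ Finset.Icc 1 (K + 1), F i ≤ ‹MeasurableSpace Ω› := fun i hi => by
    rw [Finset.mem_Icc] at hi
    refine sup_le (iSup₂_le fun t ht => ?_) (iSup₂_le fun t ht => ?_)
    · rw [Finset.mem_Icc] at ht
      exact (ha _ (Finset.mem_Icc.2 ⟨by omega, by omega⟩)).comap_le
    · rw [Finset.mem_Icc] at ht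
      exact (hε t (Finset.mem_Icc.2 ⟨ht.1, by omega⟩)).comap_le
  have hnoise : ∀ i ∈ Finset.Ico 1 (K + 1), Measurable[F (i + 1)] (fun ω => ε i ω / R) :=
    fun i hi => by
      rw [Finset.mem_Ico] at hi
      exact (measurable_noise_history _ ε (Finset.mem_Icc.2 ⟨hi.1, by omega⟩)).div_const R
  have key := integral_exp_sum_sq_sub_le_one (μ := μ) (s := 1) (k := K + 1) (history_mono _ ε)
    hFle hnoise (fun i hi => by
      filter_upwards [hεR i ((hIcc i).1 hi)] with ω hω
      exact abs_div_le_one hR hω) (t := K + 1) (by omega) le_rfl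
  have hcond : ∀ᵐ ω ∂μ, ∀ i ∈ Finset.Icc 1 K,
      (μ[fun ω => (ε i ω / R) ^ 2 | F i]) ω = σ i ω ^ 2 / R ^ 2 := by
    rw [Finset.eventually_all]
    intro i hi
    have h1 : (fun ω => (ε i ω / R) ^ 2) = (R ^ 2)⁻¹ • fun ω => ε i ω ^ 2 := by
      funext ω
      simp only [Pi.smul_apply, smul_eq_mul, div_pow]
      rw [div_eq_inv_mul]
    rw [h1, hFeq i hi]
    filter_upwards [condExp_smul (R ^ 2)⁻¹ (fun ω => ε i ω ^ 2) (history a ε i) (μ := μ),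
      hvar i hi] with ω h2 h3
    rw [h2, Pi.smul_apply, h3, smul_eq_mul, div_eq_inv_mul]
  have hmain := measure_le_exp_neg_of_integral_exp_le_one key.1 key.2 z
  refine le_trans (measure_mono_ae ?_) hmain
  filter_upwards [hcond, hV] with ω h1 h2 h3
  have h3' : 2 * VK + R ^ 2 * z < ∑ i ∈ Finset.Icc 1 K, ε i ω ^ 2 := h3
  change z ≤ ∑ i ∈ Finset.Ico 1 (K + 1), ((ε i ω / R) ^ 2
    - 2 * (μ[fun ω => (ε i ω / R) ^ 2 | F i]) ω)
  have h4 : ∑ i ∈ Finset.Ico 1 (K + 1), ((ε i ω / R) ^ 2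
      - 2 * (μ[fun ω => (ε i ω / R) ^ 2 | F i]) ω)
      = (∑ i ∈ Finset.Icc 1 K, ε i ω ^ 2 - 2 * ∑ i ∈ Finset.Icc 1 K, σ i ω ^ 2) / R ^ 2 := by
    rw [hIco, Finset.mul_sum, ← Finset.sum_sub_distrib, Finset.sum_div]
    refine Finset.sum_congr rfl fun i hi => ?_
    rw [h1 i hi, div_pow]
    ring
  rw [h4, le_div_iff₀ (by positivity)]
  linarith

end Deviation

/-! ### The confidence bounds on a typical event -/

section Confidence

variable {d : ℕ}

theorem sqrt_dotProduct_mulVec_add_le {M : Matrix (Fin d) (Fin d) ℝ} (hM : M.PosSemidef)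
    (x y : Fin d → ℝ) :
    √((x + y) ⬝ᵥ (M *ᵥ (x + y))) ≤ √(x ⬝ᵥ (M *ᵥ x)) + √(y ⬝ᵥ (M *ᵥ y)) := by
  refine Real.sqrt_le_iff.2 ⟨by positivity, ?_⟩
  have h1 := (le_abs_self _).trans (abs_dotProduct_mulVec_le hM x y)
  have h2 := Real.sq_sqrt (PosSemidef.dotProduct_mulVec_self_nonneg hM x)
  have h3 := Real.sq_sqrt (PosSemidef.dotProduct_mulVec_self_nonneg hM y)
  rw [Matrix.mulVec_add, dotProduct_add, add_dotProduct, add_dotProduct,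
    dotProduct_mulVec_comm_of_isHermitian hM.1 y x]
  nlinarith

theorem sqrt_add_le_add {x y : ℝ} (hx : 0 ≤ x) (hy : 0 ≤ y) : √(x + y) ≤ √x + √y := by
  refine Real.sqrt_le_iff.2 ⟨by positivity, ?_⟩
  nlinarith [Real.sq_sqrt hx, Real.sq_sqrt hy, Real.sqrt_nonneg x, Real.sqrt_nonneg y]

theorem inner_eq_dotProduct (x y : EuclideanSpace ℝ (Fin d)) :
    inner ℝ x y = x.ofLp ⬝ᵥ y.ofLp := by
  rw [EuclideanSpace.inner_eq_star_dotProduct, dotProduct_comm]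
  simp

variable (w L : ℕ) (a : ℕ → EuclideanSpace ℝ (Fin d)) (r ε : ℕ → ℝ)
  (θ : ℕ → EuclideanSpace ℝ (Fin d)) (k ℓ : ℕ)

/-- The weighted effect of the drift of the feature vector between rounds `i` and `k`. -/
def bias (i : ℕ) : ℝ := wgt w L a r ℓ i * inner ℝ (a i) (θ i - θ k)

/-- The sum of the squared biases in the window of round `k`. -/
def biasSq : ℝ := ∑ i ∈ Finset.Ico (start w k) k, bias w L a r θ k ℓ i ^ 2

/-- The sum of the squared weighted noises in the window of round `k`. -/
def noiseSq : ℝ := ∑ i ∈ Finset.Ico (start w k) k, wnoise w L a r ε ℓ i ^ 2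

/-- The squared self-normalized noise of layer `ℓ` at round `k`. -/
def selfNoise : ℝ :=
  selfNorm (reg ℓ) (feat w L a r ℓ) (wnoise w L a r ε ℓ) (start w k) k

/-- The weighted sum of the squared residuals of layer `ℓ` at round `k`. -/
def residualSq : ℝ := ∑ i ∈ Finset.Ico (start w k) k,
  wgt w L a r ℓ i ^ 2 * (r i - inner ℝ ((state w L a r k).theta ℓ) (a i)) ^ 2

/-- The vector whose image under `Σ⁻¹` is the estimation error. -/
def errVec : Fin d → ℝ :=
  (∑ i ∈ Finset.Ico (start w k) k, bias w L a r θ k ℓ i • feat w L a r ℓ i)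
    + (-reg ℓ) • (θ k).ofLp
    + ∑ i ∈ Finset.Ico (start w k) k, wnoise w L a r ε ℓ i • feat w L a r ℓ i

/-- The estimation error in the norm of the covariance matrix. -/
def errNorm : ℝ :=
  √(errVec w L a r ε θ k ℓ ⬝ᵥ
    ((gram (reg ℓ) (feat w L a r ℓ) (start w k) k)⁻¹ *ᵥ errVec w L a r ε θ k ℓ))

theorem biasSq_nonneg : 0 ≤ biasSq w L a r θ k ℓ := Finset.sum_nonneg fun _ _ => sq_nonneg _

theorem noiseSq_nonneg : 0 ≤ noiseSq w L a r ε k ℓ := Finset.sum_nonneg fun _ _ => sq_nonneg _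

theorem selfNoise_nonneg : 0 ≤ selfNoise w L a r ε k ℓ := selfNorm_nonneg _ _ _ (reg_pos ℓ) _

theorem residualSq_nonneg : 0 ≤ residualSq w L a r k ℓ :=
  Finset.sum_nonneg fun _ _ => by positivity

variable {w L a r ε θ k ℓ}

/-- The triangle inequality for the three sources of error: drift of the feature vector,
regularization and noise. -/
theorem errNorm_le {B : ℝ} (hB : ‖θ k‖ ≤ B) :
    errNorm w L a r ε θ k ℓ
      ≤ √(biasSq w L a r θ k ℓ) + (2 : ℝ) ^ (-(ℓ : ℤ)) * B + √(selfNoise w L a r ε k ℓ) := by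
  have hpsd := posSemidef_gram_inv (feat w L a r ℓ) (start w k) k (reg_pos ℓ)
  refine (sqrt_dotProduct_mulVec_add_le hpsd _ _).trans (add_le_add ?_ le_rfl)
  refine (sqrt_dotProduct_mulVec_add_le hpsd _ _).trans (add_le_add ?_ ?_)
  · exact Real.sqrt_le_sqrt (dotProduct_gram_inv_sum_smul_le _ _ _ (reg_pos ℓ) _)
  · have hB0 : 0 ≤ B := (norm_nonneg _).trans hB
    refine Real.sqrt_le_iff.2 ⟨by positivity, ?_⟩
    refine (dotProduct_gram_inv_le _ _ _ (reg_pos ℓ) _).trans ?_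
    rw [smul_dotProduct, dotProduct_smul, dotProduct_self_eq_norm_sq, div_le_iff₀ (reg_pos ℓ),
      mul_pow, ← reg_eq_sq]
    simp only [smul_eq_mul]
    have h1 : ‖θ k‖ ^ 2 ≤ B ^ 2 := pow_le_pow_left₀ (norm_nonneg _) hB 2
    have := mul_le_mul_of_nonneg_left h1 (sq_nonneg (reg ℓ))
    linarith

/-- The normal equations after splitting each reward into the mean under the current `θ k`, the
effect of the change from `θ k` to `θ i`, and the noise. -/
theorem theta_sub_eq (hr : ∀ i, r i = inner ℝ (θ i) (a i) + ε i) (hk : 1 ≤ k) (hℓ : ℓ ≤ L) :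
    ((state w L a r k).theta ℓ).ofLp - (θ k).ofLp
      = (gram (reg ℓ) (feat w L a r ℓ) (start w k) k)⁻¹ *ᵥ errVec w L a r ε θ k ℓ := by
  obtain ⟨h1, h2, -⟩ := (state_closed_form w L a r hk).1 ℓ hℓ
  symm
  rw [State.theta, h1]
  have h3 : errVec w L a r ε θ k ℓ = (state w L a r k).vec ℓ
      - gram (reg ℓ) (feat w L a r ℓ) (start w k) k *ᵥ (θ k).ofLp := by
    have h4 : gram (reg ℓ) (feat w L a r ℓ) (start w k) k *ᵥ (θ k).ofLp
        = reg ℓ • (θ k).ofLp + ∑ i ∈ Finset.Ico (start w k) k,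
          (wgt w L a r ℓ i * inner ℝ (a i) (θ k)) • feat w L a r ℓ i := by
      rw [gram, Matrix.add_mulVec, Matrix.smul_mulVec, Matrix.one_mulVec, Matrix.sum_mulVec]
      congr 1
      refine Finset.sum_congr rfl fun i _ => ?_
      rw [Matrix.vecMulVec_mulVec, inner_eq_dotProduct]
      ext p
      simp [feat, smul_dotProduct, mul_comm]
    have h5 : ∀ i, (wgt w L a r ℓ i * r i) • feat w L a r ℓ i
        = bias w L a r θ k ℓ i • feat w L a r ℓ i + wnoise w L a r ε ℓ i • feat w L a r ℓ i
          + (wgt w L a r ℓ i * inner ℝ (a i) (θ k)) • feat w L a r ℓ i := fun i => by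
      rw [← add_smul, ← add_smul, bias, wnoise, hr i, inner_sub_right, real_inner_comm (a i) (θ i)]
      congr 1
      ring
    rw [h2, h4, errVec, Finset.sum_congr rfl fun i _ => h5 i, Finset.sum_add_distrib,
      Finset.sum_add_distrib, neg_smul]
    abel
  rw [h3, Matrix.mulVec_sub,
    gram_inv_mulVec_eq _ _ _ (reg_pos ℓ) (y := (θ k).ofLp) rfl]

theorem abs_inner_theta_sub_le (hr : ∀ i, r i = inner ℝ (θ i) (a i) + ε i) (hk : 1 ≤ k)
    (hℓ : ℓ ≤ L) (x : EuclideanSpace ℝ (Fin d)) :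
    |inner ℝ x ((state w L a r k).theta ℓ) - inner ℝ x (θ k)|
      ≤ matNorm ((state w L a r k).cov ℓ)⁻¹ x * errNorm w L a r ε θ k ℓ := by
  rw [inner_eq_dotProduct, inner_eq_dotProduct, ← dotProduct_sub, theta_sub_eq hr hk hℓ,
    matNorm_eq_sqrt w L a r hk hℓ]
  exact abs_dotProduct_mulVec_le (posSemidef_gram_inv _ _ _ (reg_pos ℓ)) _ _

theorem varHat_eq_residualSq {R δ : ℝ} (hk : 1 ≤ k) (hℓ : ℓ ≤ L)
    (h : 64 * √(Real.log (4 * ((w : ℝ) + 1) ^ 2 * L / δ)) ≤ (2 : ℝ) ^ ℓ) :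
    varHat R δ w L a r k ℓ = residualSq w L a r k ℓ := by
  obtain ⟨h1, h2⟩ := state_closed_form w L a r hk
  obtain ⟨-, -, h3⟩ := h1 ℓ hℓ
  simp only [varHat]
  rw [if_pos h, residualSq, h3, Finset.sum_filter]
  refine Finset.sum_congr rfl fun i hi => ?_
  split_ifs with hl
  · rw [h2 i hi (hl.le.trans hℓ), hl]
  · rw [wgt_of_lay_ne w L a r hl]
    simp

/-- On low layers the variance estimate is simply the worst case `R²` per round. -/
theorem noiseSq_le_varHat_of_low {R δ : ℝ} (hk : 1 ≤ k) (hℓ : ℓ ≤ L)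
    (hε : ∀ i ∈ Finset.Ico (start w k) k, |ε i| ≤ R)
    (h : ¬ 64 * √(Real.log (4 * ((w : ℝ) + 1) ^ 2 * L / δ)) ≤ (2 : ℝ) ^ ℓ) :
    noiseSq w L a r ε k ℓ ≤ varHat R δ w L a r k ℓ := by
  obtain ⟨-, -, h3⟩ := (state_closed_form w L a r hk).1 ℓ hℓ
  simp only [varHat]
  rw [if_neg h, noiseSq, h3, mul_comm, ← nsmul_eq_mul, ← Finset.sum_const, Finset.sum_filter]
  refine Finset.sum_le_sum fun i hi => ?_
  split_ifs with hl
  · rw [wnoise, mul_pow]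
    have h1 := pow_le_one₀ (n := 2) (wgt_nonneg w L a r ℓ i) (wgt_le_one w L a r hℓ i)
    have h2 : ε i ^ 2 ≤ R ^ 2 := sq_le_sq' (by linarith [(abs_le.1 (hε i hi)).1])
      (abs_le.1 (hε i hi)).2
    calc _ ≤ 1 * ε i ^ 2 := mul_le_mul_of_nonneg_right h1 (sq_nonneg _)
      _ ≤ _ := by linarith
  · rw [wnoise, wgt_of_lay_ne w L a r hl]
    simp

theorem errNorm_sq :
    errNorm w L a r ε θ k ℓ ^ 2 = errVec w L a r ε θ k ℓ ⬝ᵥ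
    ((gram (reg ℓ) (feat w L a r ℓ) (start w k) k)⁻¹ *ᵥ errVec w L a r ε θ k ℓ) :=
  Real.sq_sqrt (PosSemidef.dotProduct_mulVec_self_nonneg
    (posSemidef_gram_inv _ _ _ (reg_pos ℓ)) _)

/-- The residuals and the noises differ by the biases and the estimation error. -/
theorem residual_noise_comparison (hr : ∀ i, r i = inner ℝ (θ i) (a i) + ε i) (hk : 1 ≤ k)
    (hℓ : ℓ ≤ L) :
    noiseSq w L a r ε k ℓ ≤ 2 * residualSq w L a r k ℓ + 4 * biasSq w L a r θ k ℓ
        + 4 * errNorm w L a r ε θ k ℓ ^ 2 ∧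
      residualSq w L a r k ℓ ≤ 2 * noiseSq w L a r ε k ℓ + 4 * biasSq w L a r θ k ℓ
        + 4 * errNorm w L a r ε θ k ℓ ^ 2 := by
  set y := (gram (reg ℓ) (feat w L a r ℓ) (start w k) k)⁻¹ *ᵥ errVec w L a r ε θ k ℓ with hy
  have h1 : ∑ i ∈ Finset.Ico (start w k) k, (feat w L a r ℓ i ⬝ᵥ y) ^ 2
      ≤ errNorm w L a r ε θ k ℓ ^ 2 := by
    rw [errNorm_sq]
    exact sum_sq_dotProduct_gram_inv_le _ _ _ (reg_pos ℓ) _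
  have h2 : ∀ i, wgt w L a r ℓ i * (r i - inner ℝ ((state w L a r k).theta ℓ) (a i))
      = wnoise w L a r ε ℓ i + bias w L a r θ k ℓ i - feat w L a r ℓ i ⬝ᵥ y := fun i => by
    rw [hy, ← theta_sub_eq hr hk hℓ, dotProduct_sub, feat, smul_dotProduct, smul_dotProduct,
      ← inner_eq_dotProduct, ← inner_eq_dotProduct, wnoise, bias, hr i, inner_sub_right,
      real_inner_comm (a i) (θ i), real_inner_comm (a i) ((state w L a r k).theta ℓ)]
    simp only [smul_eq_mul]
    ring
  have h3 : residualSq w L a r k ℓ = ∑ i ∈ Finset.Ico (start w k) k,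
      (wnoise w L a r ε ℓ i + bias w L a r θ k ℓ i - feat w L a r ℓ i ⬝ᵥ y) ^ 2 := by
    rw [residualSq]
    refine Finset.sum_congr rfl fun i _ => ?_
    rw [← h2 i, mul_pow]
  constructor
  · calc noiseSq w L a r ε k ℓ
        ≤ 2 * residualSq w L a r k ℓ + 4 * biasSq w L a r θ k ℓ
          + 4 * ∑ i ∈ Finset.Ico (start w k) k, (feat w L a r ℓ i ⬝ᵥ y) ^ 2 := by
          rw [noiseSq, h3, biasSq, Finset.mul_sum, Finset.mul_sum, Finset.mul_sum,
            ← Finset.sum_add_distrib, ← Finset.sum_add_distrib]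
          refine Finset.sum_le_sum fun i _ => ?_
          nlinarith [sq_nonneg (wnoise w L a r ε ℓ i + 2 * (bias w L a r θ k ℓ i
            - feat w L a r ℓ i ⬝ᵥ y)), sq_nonneg (bias w L a r θ k ℓ i + feat w L a r ℓ i ⬝ᵥ y)]
      _ ≤ _ := by linarith
  · calc residualSq w L a r k ℓ
        ≤ 2 * noiseSq w L a r ε k ℓ + 4 * biasSq w L a r θ k ℓ
          + 4 * ∑ i ∈ Finset.Ico (start w k) k, (feat w L a r ℓ i ⬝ᵥ y) ^ 2 := by
          rw [noiseSq, h3, biasSq, Finset.mul_sum, Finset.mul_sum, Finset.mul_sum,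
            ← Finset.sum_add_distrib, ← Finset.sum_add_distrib]
          refine Finset.sum_le_sum fun i _ => ?_
          nlinarith [sq_nonneg (wnoise w L a r ε ℓ i - (bias w L a r θ k ℓ i
            - feat w L a r ℓ i ⬝ᵥ y)), sq_nonneg (bias w L a r θ k ℓ i + feat w L a r ℓ i ⬝ᵥ y)]
      _ ≤ _ := by linarith

theorem errNorm_sq_le {B : ℝ} (hB : ‖θ k‖ ≤ B) :
    errNorm w L a r ε θ k ℓ ^ 2
      ≤ 3 * (biasSq w L a r θ k ℓ + reg ℓ * B ^ 2 + selfNoise w L a r ε k ℓ) := by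
  have h1 := errNorm_le (w := w) (L := L) (a := a) (r := r) (ε := ε) (ℓ := ℓ) hB
  have h0 : 0 ≤ errNorm w L a r ε θ k ℓ := Real.sqrt_nonneg _
  have h2 := pow_le_pow_left₀ h0 h1 2
  have h3 := Real.sq_sqrt (biasSq_nonneg w L a r θ k ℓ)
  have h4 := Real.sq_sqrt (selfNoise_nonneg w L a r ε k ℓ)
  rw [reg_eq_sq]
  set X := √(biasSq w L a r θ k ℓ)
  set Y := (2 : ℝ) ^ (-(ℓ : ℤ)) with hY
  set Z := √(selfNoise w L a r ε k ℓ)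
  nlinarith [sq_nonneg (X - Y * B), sq_nonneg (X - Z), sq_nonneg (Y * B - Z)]

/-- Squaring the threshold gives `64² = 4096`. This small factor lets the estimation error be
absorbed whenever residuals and noises are exchanged. -/
theorem reg_mul_le_of_high {ι : ℝ} (hι : 0 ≤ ι) (h : 64 * √ι ≤ (2 : ℝ) ^ ℓ) :
    reg ℓ * ι ≤ 1 / 4096 := by
  have h1 := pow_le_pow_left₀ (by positivity) h 2
  rw [mul_pow, Real.sq_sqrt hι, ← pow_mul, mul_comm ℓ 2, pow_mul] at h1
  rw [reg_eq_inv, inv_mul_le_iff₀ (by positivity)]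
  norm_num at h1
  linarith

/-- The bound on the noise part involves the unobserved squared noises. On low layers they are below
the variance estimate. On high layers they are bounded by residuals plus the error itself, which
reappears with a small factor and is moved to the left. Only the drift is not covered by the radius.
-/
theorem errNorm_le_betaHat {R B δ : ℝ} (hr : ∀ i, r i = inner ℝ (θ i) (a i) + ε i) (hk : 1 ≤ k)
    (hℓ : ℓ ≤ L) (hR : 0 ≤ R) (hB : ‖θ k‖ ≤ B)
    (hε : ∀ i ∈ Finset.Ico (start w k) k, |ε i| ≤ R)
    (hι : 1 ≤ Real.log (4 * (w : ℝ) ^ 2 * L / δ))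
    (hι1 : Real.log (4 * (w : ℝ) ^ 2 * L / δ) ≤ Real.log (4 * ((w : ℝ) + 1) ^ 2 * L / δ))
    (hBR : B ≤ 60 * R * Real.log (4 * (w : ℝ) ^ 2 * L / δ) ∨ R = 0)
    (hS : selfNoise w L a r ε k ℓ ≤ 36 * reg ℓ * Real.log (4 * (w : ℝ) ^ 2 * L / δ)
      * (noiseSq w L a r ε k ℓ + 9 * R ^ 2 * Real.log (4 * (w : ℝ) ^ 2 * L / δ))) :
    errNorm w L a r ε θ k ℓ ≤ betaHat R B δ w L a r k ℓ + 2 * √(biasSq w L a r θ k ℓ) := by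
  have hc := reg_pos ℓ
  have hmain := errNorm_le (w := w) (L := L) (a := a) (r := r) (ε := ε) (ℓ := ℓ) hB
  have hE0 := biasSq_nonneg w L a r θ k ℓ
  have hV0 := noiseSq_nonneg w L a r ε k ℓ
  have hS0 := selfNoise_nonneg w L a r ε k ℓ
  have hres0 := residualSq_nonneg w L a r k ℓ
  have hN := errNorm_sq_le (w := w) (L := L) (a := a) (r := r) (ε := ε) (ℓ := ℓ) hB
  have hcmp := (residual_noise_comparison (w := w) hr hk hℓ).1
  have hB0 : 0 ≤ B := (norm_nonneg _).trans hB
  unfold betaHat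
  have hzp : (2 : ℝ) ^ (-2 * (ℓ : ℤ) + 4) = 16 * reg ℓ := by
    rw [zpow_add₀ (by norm_num), reg]
    norm_num
    ring
  rw [hzp]
  set ι := Real.log (4 * (w : ℝ) ^ 2 * L / δ) with hιd
  set ι1 := Real.log (4 * ((w : ℝ) + 1) ^ 2 * L / δ) with hι1d
  set W := varHat R δ w L a r k ℓ with hW
  have hι0 : 0 ≤ ι := by linarith
  have hR2 : R ^ 2 * ι ≤ R ^ 2 * ι1 := mul_le_mul_of_nonneg_left hι1 (sq_nonneg R)
  have hR2' : 0 ≤ R ^ 2 * ι := by positivity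
  have hkey : 0 ≤ W ∧ selfNoise w L a r ε k ℓ
      ≤ 256 * (reg ℓ * ι) * (8 * W + 6 * R ^ 2 * ι1) + biasSq w L a r θ k ℓ := by
    by_cases hhigh : 64 * √ι1 ≤ (2 : ℝ) ^ ℓ
    · have hWr : W = residualSq w L a r k ℓ := varHat_eq_residualSq hk hℓ hhigh
      rw [hWr]
      refine ⟨hres0, ?_⟩
      have ht1 : reg ℓ * ι1 ≤ 1 / 4096 := reg_mul_le_of_high (by linarith) hhigh
      have ht : reg ℓ * ι ≤ 1 / 4096 := (mul_le_mul_of_nonneg_left hι1 hc.le).trans ht1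
      have ht0 : 0 ≤ reg ℓ * ι := by positivity
      set t := reg ℓ * ι with htd
      set S := selfNoise w L a r ε k ℓ
      set V := noiseSq w L a r ε k ℓ with hVd
      set E := biasSq w L a r θ k ℓ
      set U := residualSq w L a r k ℓ
      have hS' : S ≤ 36 * (t * V) + 324 * (t * (R ^ 2 * ι)) := by
        have : 36 * reg ℓ * ι * (V + 9 * R ^ 2 * ι)
          = 36 * (t * V) + 324 * (t * (R ^ 2 * ι)) := by rw [htd]; ring
        linarith
      have htU : 0 ≤ t * U := mul_nonneg ht0 hres0
      have htE : t * E ≤ 1 / 4096 * E := mul_le_mul_of_nonneg_right ht hE0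
      have htR : 0 ≤ t * (R ^ 2 * ι) := mul_nonneg ht0 hR2'
      have htR1 : t * (R ^ 2 * ι) ≤ t * (R ^ 2 * ι1) := mul_le_mul_of_nonneg_left hR2 ht0
      have hgoal : S ≤ 2048 * (t * U) + 1536 * (t * (R ^ 2 * ι)) + E := by
        rcases hBR with hBR | hR0
        · have hB2 : reg ℓ * B ^ 2 ≤ R ^ 2 * ι := by
            have h1 : B ^ 2 ≤ (60 * R * ι) ^ 2 := pow_le_pow_left₀ hB0 hBR 2
            have h2 : reg ℓ * B ^ 2 ≤ 3600 * (t * (R ^ 2 * ι)) := by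
              have := mul_le_mul_of_nonneg_left h1 hc.le
              rw [htd]
              linarith
            have h3 : t * (R ^ 2 * ι) ≤ 1 / 4096 * (R ^ 2 * ι) :=
              mul_le_mul_of_nonneg_right ht hR2'
            linarith
          -- Substituting this into `hS'` produces `432 t S` with `432 t ≤ 432 / 4096`, so the terms
          -- in `S` can be absorbed on the left.
          have hV : V ≤ 2 * U + 16 * E + 12 * (R ^ 2 * ι) + 12 * S := by linarith
          have htV := mul_le_mul_of_nonneg_left hV ht0
          have htS : t * S ≤ 1 / 4096 * S := mul_le_mul_of_nonneg_right ht hS0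
          have htV' : t * V ≤ 2 * (t * U) + 16 * (t * E) + 12 * (t * (R ^ 2 * ι))
              + 12 * (t * S) := by linarith
          linarith
        · have hVz : V = 0 := by
            rw [hVd, noiseSq]
            refine Finset.sum_eq_zero fun i hi => ?_
            have := hε i hi
            rw [hR0] at this
            rw [wnoise, abs_nonpos_iff.1 this]
            simp
          rw [hVz, mul_zero] at hS'
          linarith
      have : 256 * t * (8 * U + 6 * R ^ 2 * ι1) = 2048 * (t * U) + 1536 * (t * (R ^ 2 * ι1)) := by
        ring
      rw [this]
      linarith
    · have hVW : noiseSq w L a r ε k ℓ ≤ W := noiseSq_le_varHat_of_low hk hℓ hε hhigh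
      refine ⟨hV0.trans hVW, ?_⟩
      have ht0 : 0 ≤ reg ℓ * ι := by positivity
      have h1 : 36 * reg ℓ * ι * (noiseSq w L a r ε k ℓ + 9 * R ^ 2 * ι)
          ≤ 256 * (reg ℓ * ι) * (8 * W + 6 * R ^ 2 * ι1) := by
        have h2 : 36 * (noiseSq w L a r ε k ℓ + 9 * R ^ 2 * ι)
            ≤ 256 * (8 * W + 6 * R ^ 2 * ι1) := by linarith
        have := mul_le_mul_of_nonneg_left h2 ht0
        linarith
      linarith
  obtain ⟨hW0, hkey⟩ := hkey
  have hRι1 : 0 ≤ R ^ 2 * ι1 := hR2'.trans hR2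
  have hin : 0 ≤ 8 * W + 6 * R ^ 2 * ι1 + 16 * reg ℓ := by linarith
  have h1 : √(selfNoise w L a r ε k ℓ)
      ≤ √(256 * (reg ℓ * ι) * (8 * W + 6 * R ^ 2 * ι1 + 16 * reg ℓ)) + √(biasSq w L a r θ k ℓ) := by
    refine (Real.sqrt_le_sqrt ?_).trans (sqrt_add_le_add (by positivity) hE0)
    have : 0 ≤ 256 * (reg ℓ * ι) * (16 * reg ℓ) := by positivity
    linarith
  have h2 : √(256 * (reg ℓ * ι) * (8 * W + 6 * R ^ 2 * ι1 + 16 * reg ℓ))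
      = 16 * (2 : ℝ) ^ (-(ℓ : ℤ)) * √(8 * W + 6 * R ^ 2 * ι1 + 16 * reg ℓ) * √ι := by
    have h3 : 256 * (reg ℓ * ι) * (8 * W + 6 * R ^ 2 * ι1 + 16 * reg ℓ)
        = (16 * (2 : ℝ) ^ (-(ℓ : ℤ))) ^ 2 * ((8 * W + 6 * R ^ 2 * ι1 + 16 * reg ℓ) * ι) := by
      rw [mul_pow, ← reg_eq_sq]
      ring
    rw [h3, Real.sqrt_mul (sq_nonneg _), Real.sqrt_sq (by positivity),
      Real.sqrt_mul hin, mul_assoc (16 * (2 : ℝ) ^ (-(ℓ : ℤ)))]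
  have h3 : 0 ≤ 6 * (2 : ℝ) ^ (-(ℓ : ℤ)) * R * ι := by positivity
  linarith

/-- The converse comparison: on high layers the residuals exceed the true noises only by constant
factors and lower-order terms, so the radius adapts to the realized noise. -/
theorem betaHat_le_of_high {R B δ : ℝ} (hr : ∀ i, r i = inner ℝ (θ i) (a i) + ε i) (hk : 1 ≤ k)
    (hℓ : ℓ ≤ L) (hR : 0 ≤ R) (hB : ‖θ k‖ ≤ B)
    (hι : 1 ≤ Real.log (4 * (w : ℝ) ^ 2 * L / δ))
    (hι1 : Real.log (4 * (w : ℝ) ^ 2 * L / δ) ≤ Real.log (4 * ((w : ℝ) + 1) ^ 2 * L / δ))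
    (hS : selfNoise w L a r ε k ℓ ≤ 36 * reg ℓ * Real.log (4 * (w : ℝ) ^ 2 * L / δ)
      * (noiseSq w L a r ε k ℓ + 9 * R ^ 2 * Real.log (4 * (w : ℝ) ^ 2 * L / δ)))
    (hhigh : 64 * √(Real.log (4 * ((w : ℝ) + 1) ^ 2 * L / δ)) ≤ (2 : ℝ) ^ ℓ) :
    betaHat R B δ w L a r k ℓ
      ≤ (2 : ℝ) ^ (-(ℓ : ℤ)) * Real.log (4 * ((w : ℝ) + 1) ^ 2 * L / δ)
          * (80 * √(noiseSq w L a r ε k ℓ) + 16 * (11 * B + 5 * R + 4))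
        + 3 * √(biasSq w L a r θ k ℓ) := by
  have hc := reg_pos ℓ
  have hc1 := reg_le_one ℓ
  have hE0 := biasSq_nonneg w L a r θ k ℓ
  have hV0 := noiseSq_nonneg w L a r ε k ℓ
  have hS0 := selfNoise_nonneg w L a r ε k ℓ
  have hN := errNorm_sq_le (w := w) (L := L) (a := a) (r := r) (ε := ε) (ℓ := ℓ) hB
  have hcmp := (residual_noise_comparison (w := w) hr hk hℓ).2
  have hB0 : 0 ≤ B := (norm_nonneg _).trans hB
  unfold betaHat
  have hzp : (2 : ℝ) ^ (-2 * (ℓ : ℤ) + 4) = 16 * reg ℓ := by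
    rw [zpow_add₀ (by norm_num), reg]
    norm_num
    ring
  rw [hzp, varHat_eq_residualSq hk hℓ hhigh]
  set ι := Real.log (4 * (w : ℝ) ^ 2 * L / δ) with hιd
  set ι1 := Real.log (4 * ((w : ℝ) + 1) ^ 2 * L / δ) with hι1d
  have hι0 : 0 ≤ ι := by linarith
  have hι10 : 1 ≤ ι1 := by linarith
  have ht1 : reg ℓ * ι1 ≤ 1 / 4096 := reg_mul_le_of_high (by linarith) hhigh
  have ht : reg ℓ * ι ≤ 1 / 4096 := (mul_le_mul_of_nonneg_left hι1 hc.le).trans ht1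
  have ht0 : 0 ≤ reg ℓ * ι := by positivity
  set S := selfNoise w L a r ε k ℓ
  set V := noiseSq w L a r ε k ℓ with hVd
  set E := biasSq w L a r θ k ℓ
  set U := residualSq w L a r k ℓ
  set ρ := (2 : ℝ) ^ (-(ℓ : ℤ)) with hρ
  have hρ0 : 0 < ρ := by positivity
  have hR2 : R ^ 2 * ι ≤ R ^ 2 * ι1 := mul_le_mul_of_nonneg_left hι1 (sq_nonneg R)
  have hS' : S ≤ 36 / 4096 * (V + 9 * R ^ 2 * ι) := by
    have h1 : 36 * reg ℓ * ι * (V + 9 * R ^ 2 * ι) = (reg ℓ * ι) * (36 * (V + 9 * R ^ 2 * ι)) := by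
      ring
    rw [h1] at hS
    have := mul_le_mul_of_nonneg_right ht (by positivity : 0 ≤ 36 * (V + 9 * R ^ 2 * ι))
    linarith
  have hregB : reg ℓ * B ^ 2 ≤ B ^ 2 * ι1 := by
    have : reg ℓ * B ^ 2 ≤ 1 * B ^ 2 := mul_le_mul_of_nonneg_right hc1 (sq_nonneg B)
    nlinarith [sq_nonneg B]
  have hU : 8 * U + 6 * R ^ 2 * ι1 + 16 * reg ℓ
      ≤ 25 * V + 144 * E + (10 * B + 4 * R + 4) ^ 2 * ι1 := by
    have h1 : 0 ≤ (80 * B + 4 * B ^ 2 + 80 * (B * R) + 32 * R) * ι1 := by positivity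
    have h2 : (10 * B + 4 * R + 4) ^ 2 * ι1 = 96 * (B ^ 2 * ι1) + 16 * (R ^ 2 * ι1) + 16 * ι1
        + (80 * B + 4 * B ^ 2 + 80 * (B * R) + 32 * R) * ι1 := by ring
    have h3 : 0 ≤ R ^ 2 * ι1 := by positivity
    linarith
  have hsq : √(8 * U + 6 * R ^ 2 * ι1 + 16 * reg ℓ)
      ≤ 5 * √V + 12 * √E + (10 * B + 4 * R + 4) * √ι1 := by
    refine (Real.sqrt_le_sqrt hU).trans ?_
    refine (sqrt_add_le_add (by positivity) (by positivity)).trans ?_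
    rw [Real.sqrt_mul (sq_nonneg _), Real.sqrt_sq (by positivity)]
    refine add_le_add ?_ le_rfl
    refine (sqrt_add_le_add (by positivity) (by positivity)).trans ?_
    rw [Real.sqrt_mul (by norm_num), Real.sqrt_mul (by norm_num),
      show (25 : ℝ) = 5 ^ 2 by norm_num, show (144 : ℝ) = 12 ^ 2 by norm_num,
      Real.sqrt_sq (by norm_num), Real.sqrt_sq (by norm_num)]
  have hsι : √ι ≤ √ι1 := Real.sqrt_le_sqrt hι1
  have hsι1 : √ι1 * √ι1 = ι1 := Real.mul_self_sqrt (by linarith)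
  have hsι2 : √ι ≤ ι1 := by
    have : 1 ≤ √ι1 := Real.one_le_sqrt.2 hι10
    nlinarith
  -- Turns the term `16 · 12 ρ √ι √E` into `3 √E`, removing logarithms from the drift.
  have hρι : ρ * √ι ≤ 1 / 64 := by
    refine abs_le_of_sq_le_sq' ?_ (by norm_num) |>.2
    rw [mul_pow, Real.sq_sqrt hι0, hρ, ← reg_eq_sq]
    linarith
  have hsE := Real.sqrt_nonneg E
  have hsV := Real.sqrt_nonneg V
  have h1 : 16 * ρ * √(8 * U + 6 * R ^ 2 * ι1 + 16 * reg ℓ) * √ι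
      ≤ 16 * ρ * (5 * √V + 12 * √E + (10 * B + 4 * R + 4) * √ι1) * √ι := by
    gcongr
  have h2 : 16 * ρ * (5 * √V + 12 * √E + (10 * B + 4 * R + 4) * √ι1) * √ι
      = 80 * (ρ * √V * √ι) + 192 * (ρ * √ι) * √E
        + 16 * ρ * (10 * B + 4 * R + 4) * (√ι1 * √ι) := by ring
  have h3 : ρ * √V * √ι ≤ ρ * √V * ι1 := by gcongr
  have h4 : ρ * √ι * √E ≤ 1 / 64 * √E := mul_le_mul_of_nonneg_right hρι hsE
  have h5 : √ι1 * √ι ≤ ι1 := by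
    calc √ι1 * √ι ≤ √ι1 * √ι1 := by gcongr
      _ = ι1 := hsι1
  have h6 : 16 * ρ * (10 * B + 4 * R + 4) * (√ι1 * √ι) ≤ 16 * ρ * (10 * B + 4 * R + 4) * ι1 := by
    gcongr
  have h7 : 6 * ρ * R * ι ≤ 6 * ρ * R * ι1 := by gcongr
  have h8 : ρ * B ≤ ρ * B * ι1 := le_mul_of_one_le_right (by positivity) hι10
  have h9 : 0 ≤ ρ * R * ι1 := by positivity
  have h10 : 0 ≤ ρ * B * ι1 := by positivity
  rw [h2] at h1
  linarith

end Confidence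

/-! ### The regret on a typical event -/

section Regret

variable {d : ℕ} {w L K : ℕ} {a : ℕ → EuclideanSpace ℝ (Fin d)} {r ε : ℕ → ℝ}
  {θ : ℕ → EuclideanSpace ℝ (Fin d)}

/-- The variation of the feature vectors in the window of round `k`, before round `k`. -/
def windowVariation (w : ℕ) (θ : ℕ → EuclideanSpace ℝ (Fin d)) (k : ℕ) : ℝ :=
  ∑ j ∈ Finset.Ico (start w k) k, ‖θ (j + 1) - θ j‖

theorem windowVariation_nonneg (k : ℕ) : 0 ≤ windowVariation w θ k :=
  Finset.sum_nonneg fun _ _ => norm_nonneg _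

theorem norm_sub_le_windowVariation {i k : ℕ} (hi : i ∈ Finset.Ico (start w k) k) :
    ‖θ i - θ k‖ ≤ windowVariation w θ k := by
  rw [Finset.mem_Ico] at hi
  have h1 : θ k - θ i = ∑ j ∈ Finset.Ico i k, (θ (j + 1) - θ j) :=
    (Finset.sum_Ico_sub θ hi.2.le).symm
  rw [norm_sub_rev, h1]
  refine (norm_sum_le _ _).trans ?_
  exact Finset.sum_le_sum_of_subset_of_nonneg (Finset.Ico_subset_Ico_left hi.1)
    fun _ _ _ => norm_nonneg _

/-- At most `w` rounds, each biased by at most `A` times the variation in the window. -/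
theorem sqrt_biasSq_le (hw : 1 ≤ w) {A : ℝ} {k ℓ : ℕ} (hℓ : ℓ ≤ L)
    (hA : ∀ i ∈ Finset.Ico (start w k) k, ‖a i‖ ≤ A) (hA0 : 0 ≤ A) :
    √(biasSq w L a r θ k ℓ) ≤ √w * A * windowVariation w θ k := by
  have hΔ := windowVariation_nonneg (w := w) (θ := θ) k
  refine Real.sqrt_le_iff.2 ⟨by positivity, ?_⟩
  rw [mul_pow, mul_pow, Real.sq_sqrt (Nat.cast_nonneg w)]
  have h1 : ∀ i ∈ Finset.Ico (start w k) k,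
      bias w L a r θ k ℓ i ^ 2 ≤ A ^ 2 * windowVariation w θ k ^ 2 := fun i hi => by
    rw [← mul_pow]
    refine sq_le_sq.2 ?_
    rw [bias, abs_mul, abs_of_nonneg (wgt_nonneg w L a r ℓ i), abs_of_nonneg (mul_nonneg hA0 hΔ)]
    calc _ ≤ 1 * (‖a i‖ * ‖θ i - θ k‖) :=
          mul_le_mul (wgt_le_one w L a r hℓ i) (abs_real_inner_le_norm _ _) (abs_nonneg _)
            zero_le_one
      _ ≤ 1 * (A * windowVariation w θ k) := by
          gcongr
          · exact hA i hi
          · exact norm_sub_le_windowVariation hi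
      _ = _ := one_mul _
  refine (Finset.sum_le_card_nsmul _ _ _ h1).trans ?_
  rw [nsmul_eq_mul, Nat.card_Ico, mul_assoc]
  have h2 : ((k - start w k : ℕ) : ℝ) ≤ w := by
    have := lt_start_add hw k
    exact_mod_cast (by omega : k - start w k ≤ w)
  exact mul_le_mul_of_nonneg_right h2 (by positivity)

theorem index_le {R B δ : ℝ} {k ℓ : ℕ} (hℓ : ℓ ∈ Set.Icc 1 L) (x : EuclideanSpace ℝ (Fin d)) :
    index R B δ w L a r k x ≤ inner ℝ x ((state w L a r k).theta ℓ)
      + betaHat R B δ w L a r k ℓ * matNorm ((state w L a r k).cov ℓ)⁻¹ x := by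
  have hbdd : BddBelow (Set.range fun ℓ : Set.Icc 1 L => inner ℝ x ((state w L a r k).theta ℓ)
      + betaHat R B δ w L a r k ℓ * matNorm ((state w L a r k).cov ℓ)⁻¹ x) :=
    (Set.finite_range _).bddBelow
  exact ciInf_le hbdd ⟨ℓ, hℓ⟩

theorem le_index {R B δ : ℝ} {k : ℕ} (hL : 1 ≤ L) {x : EuclideanSpace ℝ (Fin d)} {z : ℝ}
    (h : ∀ ℓ ∈ Set.Icc 1 L, z ≤ inner ℝ x ((state w L a r k).theta ℓ)
      + betaHat R B δ w L a r k ℓ * matNorm ((state w L a r k).cov ℓ)⁻¹ x) :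
    z ≤ index R B δ w L a r k x := by
  have : Nonempty (Set.Icc 1 L) := ⟨⟨1, ⟨le_rfl, hL⟩⟩⟩
  exact le_ciInf fun ℓ => h ℓ ℓ.2

/-- The regret of a typical round whose layer is large. -/
theorem inner_le_of_typical {A R B δ Q : ℝ} (hr : ∀ i, r i = inner ℝ (θ i) (a i) + ε i) {k ℓ : ℕ}
    (hw : 1 ≤ w) (hk : 1 ≤ k)
    (hℓ : ℓ ∈ Set.Icc 1 L) (hlay : lay w L a r k = ℓ + 1) (hA : 0 ≤ A) (hR : 0 ≤ R)
    (hB : ‖θ k‖ ≤ B)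
    (hε : ∀ i ∈ Finset.Ico (start w k) k, |ε i| ≤ R)
    (ha : ∀ i ∈ Finset.Ico (start w k) k, ‖a i‖ ≤ A)
    (hι : 1 ≤ Real.log (4 * (w : ℝ) ^ 2 * L / δ))
    (hι1 : Real.log (4 * (w : ℝ) ^ 2 * L / δ) ≤ Real.log (4 * ((w : ℝ) + 1) ^ 2 * L / δ))
    (hBR : B ≤ 60 * R * Real.log (4 * (w : ℝ) ^ 2 * L / δ) ∨ R = 0)
    (hS : ∀ ℓ ∈ Set.Icc 1 L, selfNoise w L a r ε k ℓ
      ≤ 36 * reg ℓ * Real.log (4 * (w : ℝ) ^ 2 * L / δ)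
        * (noiseSq w L a r ε k ℓ + 9 * R ^ 2 * Real.log (4 * (w : ℝ) ^ 2 * L / δ)))
    (hhigh : 64 * √(Real.log (4 * ((w : ℝ) + 1) ^ 2 * L / δ)) ≤ (2 : ℝ) ^ ℓ)
    (hQ : noiseSq w L a r ε k ℓ ≤ Q) {x : EuclideanSpace ℝ (Fin d)} (hx : ‖x‖ ≤ A)
    (hopt : index R B δ w L a r k x ≤ index R B δ w L a r k (a k)) :
    inner ℝ x (θ k) - inner ℝ (a k) (θ k)
      ≤ (2 * A * 2 ^ L + 8) * (√w * A * windowVariation w θ k)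
        + 2 * reg ℓ * Real.log (4 * ((w : ℝ) + 1) ^ 2 * L / δ)
          * (80 * √Q + 16 * (11 * B + 5 * R + 4)) := by
  have hB0 : 0 ≤ B := (norm_nonneg _).trans hB
  have hL : 1 ≤ L := hℓ.1.trans hℓ.2
  have hΔ := windowVariation_nonneg (w := w) (θ := θ) k
  have hbias : ∀ m ∈ Set.Icc 1 L, √(biasSq w L a r θ k m) ≤ √w * A * windowVariation w θ k :=
    fun m hm => sqrt_biasSq_le hw hm.2 ha hA
  have herr : ∀ m ∈ Set.Icc 1 L, errNorm w L a r ε θ k m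
      ≤ betaHat R B δ w L a r k m + 2 * (√w * A * windowVariation w θ k) := fun m hm => by
    have h1 := errNorm_le_betaHat hr hk hm.2 hR hB hε hι hι1 hBR (hS m hm)
    linarith [hbias m hm]
  have hβ := betaHat_le_of_high hr hk hℓ.2 hR hB hι hι1 (hS ℓ hℓ) hhigh
  set e := √w * A * windowVariation w θ k with he
  have he0 : 0 ≤ e := by positivity
  set ι1 := Real.log (4 * ((w : ℝ) + 1) ^ 2 * L / δ) with hι1d
  have hι10 : 0 ≤ ι1 := by linarith
  -- Optimism must hold in every layer because the index is a minimum. Drift violates it by at most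
  -- the width `2^L A` times `2 e`.
  have hopt1 : inner ℝ x (θ k) - 2 * A * 2 ^ L * e ≤ index R B δ w L a r k x := by
    refine le_index hL fun m hm => ?_
    have h1 := (abs_le.1 (abs_inner_theta_sub_le (w := w) hr hk hm.2 x (ε := ε))).1
    have h2 := matNorm_cov_inv_le w L a r hk hm.2 hx
    have h3 := matNorm_nonneg ((state w L a r k).cov m)⁻¹ x
    have h4 := mul_le_mul_of_nonneg_left (herr m hm) h3
    have h5 : (2 : ℝ) ^ m ≤ 2 ^ L := pow_le_pow_right₀ (by norm_num) hm.2
    have h6 : matNorm ((state w L a r k).cov m)⁻¹ x ≤ 2 ^ L * A :=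
      h2.trans (mul_le_mul_of_nonneg_right h5 hA)
    have h7 := mul_le_mul_of_nonneg_right h6 he0
    linarith
  have hak := index_le (R := R) (B := B) (δ := δ) (w := w) (a := a) (r := r) (k := k) hℓ (a k)
  have h1 := (abs_le.1 (abs_inner_theta_sub_le (w := w) hr hk hℓ.2 (a k) (ε := ε))).2
  -- The layer is minimal, so the width just below it is under the threshold.
  have h2 := matNorm_lt_of_lt_lay w L a r hℓ.1 hℓ.2 (i := k) (by omega)
  have h3 := matNorm_nonneg ((state w L a r k).cov ℓ)⁻¹ (a k)
  set ν := matNorm ((state w L a r k).cov ℓ)⁻¹ (a k)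
  set ρ := (2 : ℝ) ^ (-(ℓ : ℤ)) with hρ
  have hρ0 : 0 < ρ := by positivity
  have hρ1 : ρ ≤ 1 := by
    rw [hρ, zpow_neg]
    exact inv_le_one_of_one_le₀ (one_le_zpow₀ (by norm_num) (by positivity))
  have hβ' : betaHat R B δ w L a r k ℓ
      ≤ ρ * ι1 * (80 * √Q + 16 * (11 * B + 5 * R + 4)) + 3 * e := by
    refine hβ.trans (add_le_add ?_ (by linarith [hbias ℓ hℓ]))
    have := Real.sqrt_le_sqrt hQ
    gcongr
  set β' := ρ * ι1 * (80 * √Q + 16 * (11 * B + 5 * R + 4)) + 3 * e with hβ'd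
  have hβ'0 : 0 ≤ β' := by positivity
  have h4 : ν * (betaHat R B δ w L a r k ℓ + errNorm w L a r ε θ k ℓ) ≤ ρ * (2 * β' + 2 * e) := by
    calc _ ≤ ν * (2 * β' + 2 * e) :=
          mul_le_mul_of_nonneg_left (by linarith [herr ℓ hℓ]) h3
      _ ≤ _ := mul_le_mul_of_nonneg_right h2.le (by positivity)
  have h5 : ρ * (2 * β' + 2 * e) = 2 * reg ℓ * ι1 * (80 * √Q + 16 * (11 * B + 5 * R + 4))
      + ρ * (8 * e) := by
    rw [hβ'd, reg_eq_sq, ← hρ]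
    ring
  have h6 : ρ * (8 * e) ≤ 1 * (8 * e) := mul_le_mul_of_nonneg_right hρ1 (by positivity)
  linarith

/-- Exchange the sums: an increment is seen only by later rounds of the same window, fewer than `w`
in number. -/
theorem sum_windowVariation_le (hw : 1 ≤ w) (K : ℕ) :
    ∑ k ∈ Finset.Icc 1 K, windowVariation w θ k
      ≤ w * ∑ j ∈ Finset.Icc 1 (K - 1), ‖θ (j + 1) - θ j‖ := by
  have h1 : ∑ k ∈ Finset.Icc 1 K, windowVariation w θ k
      = ∑ j ∈ Finset.Icc 1 (K - 1), ∑ _k ∈ (Finset.Icc 1 K).filter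
        (fun k => start w k ≤ j ∧ j < k), ‖θ (j + 1) - θ j‖ := by
    refine Finset.sum_comm' fun k j => ?_
    simp only [Finset.mem_Icc, Finset.mem_Ico, Finset.mem_filter]
    have := one_le_start w k
    constructor
    · rintro ⟨h1, h2⟩
      exact ⟨⟨h1, h2⟩, by omega, by omega⟩
    · rintro ⟨⟨h1, h2⟩, -⟩
      exact ⟨h1, h2⟩
  rw [h1, Finset.mul_sum]
  refine Finset.sum_le_sum fun j _ => ?_
  rw [Finset.sum_const, nsmul_eq_mul]
  refine mul_le_mul_of_nonneg_right ?_ (norm_nonneg _)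
  have h2 : (Finset.Icc 1 K).filter (fun k => start w k ≤ j ∧ j < k) ⊆ Finset.Ico (j + 1) (j + w) := by
    intro k hk
    rw [Finset.mem_filter] at hk
    rw [Finset.mem_Ico]
    have := lt_start_add hw k
    omega
  have h3 := Finset.card_le_card h2
  rw [Nat.card_Ico] at h3
  exact_mod_cast (by omega : _ ≤ w)

/-- The rounds of the `m`-th window. -/
def windowRounds (w K m : ℕ) : Finset ℕ := (Finset.Icc 1 K).filter (fun k => k / w = m)

theorem sum_windowRounds (f : ℕ → ℝ) :
    ∑ m ∈ Finset.range (K / w + 1), ∑ k ∈ windowRounds w K m, f k = ∑ k ∈ Finset.Icc 1 K, f k := by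
  refine Finset.sum_fiberwise_of_maps_to (fun k hk => ?_) f
  rw [Finset.mem_range, Nat.lt_succ_iff]
  exact Nat.div_le_div_right (Finset.mem_Icc.1 hk).2

theorem windowRounds_subset (m : ℕ) (h : (windowRounds w K m).Nonempty) :
    ∃ k ∈ Finset.Icc 1 K, windowRounds w K m ⊆ Finset.Icc (start w k) k := by
  have hmax := Finset.max'_mem _ h
  have hmax' := Finset.mem_filter.1 hmax
  refine ⟨(windowRounds w K m).max' h, hmax'.1, fun i hi => ?_⟩
  have hi' := Finset.mem_filter.1 hi
  rw [Finset.mem_Icc, ← start_eq_of_div_eq (hi'.2.trans hmax'.2.symm)]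
  exact ⟨start_le (Finset.mem_Icc.1 hi'.1).1, Finset.le_max' _ _ hi⟩

theorem card_windowRounds_le (hw : 1 ≤ w) (m : ℕ) : (windowRounds w K m).card ≤ w := by
  rcases (windowRounds w K m).eq_empty_or_nonempty with h | h
  · simp [h]
  · obtain ⟨k, hk, hsub⟩ := windowRounds_subset m h
    have h1 := Finset.card_le_card hsub
    rw [Nat.card_Icc] at h1
    have := lt_start_add hw k
    omega

theorem card_windowRounds_layer_le (hw : 1 ≤ w) (hd : 1 ≤ d) {A : ℝ}
    (hA : ∀ i ∈ Finset.Icc 1 K, ‖a i‖ ≤ A) (m : ℕ) {j : ℕ} (hj : j ≤ L) :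
    (((windowRounds w K m).filter (fun i => lay w L a r i = j)).card : ℝ)
      ≤ 2 * 4 ^ j * (d * Real.log (d + w * A ^ 2 * 4 ^ L)) := by
  have hd' : (1 : ℝ) ≤ d := by exact_mod_cast hd
  have hlog : Real.log (d + w * A ^ 2 * 4 ^ j) ≤ Real.log (d + w * A ^ 2 * 4 ^ L) := by
    refine Real.log_le_log (by positivity) ?_
    gcongr
    norm_num
  rcases (windowRounds w K m).eq_empty_or_nonempty with h | h
  · rw [h]
    simp only [Finset.filter_empty, Finset.card_empty, Nat.cast_zero]
    have : 0 ≤ Real.log (d + w * A ^ 2 * 4 ^ L) :=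
      Real.log_nonneg (le_add_of_le_of_nonneg hd' (by positivity))
    positivity
  · obtain ⟨k, hk, hsub⟩ := windowRounds_subset m h
    have hk' := Finset.mem_Icc.1 hk
    have h1 := card_layer_le w L a r hw hd hk'.1 hj (A := A) fun i hi => by
      have := one_le_start w k
      rw [Finset.mem_Icc] at hi
      exact hA i (Finset.mem_Icc.2 ⟨by omega, by omega⟩)
    have h2 : (((windowRounds w K m).filter (fun i => lay w L a r i = j)).card : ℝ)
        ≤ ((Finset.Icc (start w k) k).filter (fun i => lay w L a r i = j)).card := by
      exact_mod_cast Finset.card_le_card (Finset.filter_subset_filter _ hsub)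
    refine h2.trans (h1.trans ?_)
    gcongr

/-- In one window, the sum over the rounds of a function of the layer. -/
theorem sum_windowRounds_layer (m : ℕ) (f : ℕ → ℝ) :
    ∑ k ∈ windowRounds w K m, f (lay w L a r k)
      = ∑ j ∈ Finset.Icc 1 (L + 1),
        ((windowRounds w K m).filter (fun i => lay w L a r i = j)).card * f j := by
  rw [← Finset.sum_fiberwise_of_maps_to (s := windowRounds w K m) (t := Finset.Icc 1 (L + 1))
    (g := fun k => lay w L a r k) fun k _ =>
      Finset.mem_Icc.2 ⟨one_le_lay w L a r k, lay_le w L a r k⟩]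
  refine Finset.sum_congr rfl fun j _ => ?_
  rw [← nsmul_eq_mul, ← Finset.sum_const]
  exact Finset.sum_congr rfl fun i hi => by rw [(Finset.mem_filter.1 hi).2]

/-- The cost `4^{-(j-1)}` of a round in layer `j ≤ L` cancels against the count `2 · 4^j` up to the
factor `8`. The top layer `L + 1` has no counting bound beyond the window length. -/
theorem sum_reg_layer_le (hw : 1 ≤ w) (hd : 1 ≤ d) {A : ℝ}
    (hA : ∀ i ∈ Finset.Icc 1 K, ‖a i‖ ≤ A) (m : ℕ) :
    ∑ k ∈ windowRounds w K m, reg (lay w L a r k - 1)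
      ≤ 8 * L * (d * Real.log (d + w * A ^ 2 * 4 ^ L)) + w * reg L := by
  rw [sum_windowRounds_layer m fun j => reg (j - 1), Finset.sum_Icc_succ_top (by omega)]
  refine add_le_add ?_ ?_
  · have h1 : ∀ j ∈ Finset.Icc 1 L,
        (((windowRounds w K m).filter (fun i => lay w L a r i = j)).card : ℝ) * reg (j - 1)
          ≤ 8 * (d * Real.log (d + w * A ^ 2 * 4 ^ L)) := fun j hj => by
      rw [Finset.mem_Icc] at hj
      refine (mul_le_mul_of_nonneg_right (card_windowRounds_layer_le hw hd hA m hj.2)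
        (reg_pos _).le).trans (le_of_eq ?_)
      obtain ⟨i, rfl⟩ : ∃ i, j = i + 1 := ⟨j - 1, by omega⟩
      rw [Nat.add_sub_cancel, reg_eq_inv, pow_succ]
      field_simp
      ring
    refine (Finset.sum_le_card_nsmul _ _ _ h1).trans (le_of_eq ?_)
    rw [Nat.card_Icc, Nat.add_sub_cancel, nsmul_eq_mul]
    ring
  · rw [Nat.add_sub_cancel]
    refine mul_le_mul_of_nonneg_right ?_ (reg_pos L).le
    exact_mod_cast (Finset.card_filter_le _ _).trans (card_windowRounds_le hw m)

/-- Counts the rounds in which the layer below the played one does not exist or is not high. There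
are few of them because `4^j` is at most logarithmic. -/
theorem card_low_layer_le (hw : 1 ≤ w) (hd : 1 ≤ d) {A ι : ℝ} (hι : 1 ≤ ι)
    (hhigh : 64 * √ι ≤ (2 : ℝ) ^ L)
    (hA : ∀ i ∈ Finset.Icc 1 K, ‖a i‖ ≤ A) (m : ℕ) :
    ∑ k ∈ windowRounds w K m,
      (if 2 ≤ lay w L a r k ∧ 64 * √ι ≤ (2 : ℝ) ^ (lay w L a r k - 1) then (0 : ℝ) else 1)
      ≤ 32768 * L * ι * (d * Real.log (d + w * A ^ 2 * 4 ^ L)) := by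
  have hd' : (1 : ℝ) ≤ d := by exact_mod_cast hd
  have hlog : 0 ≤ Real.log (d + w * A ^ 2 * 4 ^ L) :=
    Real.log_nonneg (le_add_of_le_of_nonneg hd' (by positivity))
  have hsι : 1 ≤ √ι := Real.one_le_sqrt.2 hι
  have hL : 1 ≤ L := by
    by_contra! h
    have : L = 0 := by omega
    rw [this] at hhigh
    norm_num at hhigh
    linarith
  rw [sum_windowRounds_layer m fun j => if 2 ≤ j ∧ 64 * √ι ≤ (2 : ℝ) ^ (j - 1) then (0 : ℝ) else 1,
    Finset.sum_Icc_succ_top (by omega), if_pos ⟨by omega, by simpa using hhigh⟩, mul_zero, add_zero]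
  have h1 : ∀ j ∈ Finset.Icc 1 L,
      (((windowRounds w K m).filter (fun i => lay w L a r i = j)).card : ℝ)
        * (if 2 ≤ j ∧ 64 * √ι ≤ (2 : ℝ) ^ (j - 1) then (0 : ℝ) else 1)
        ≤ 32768 * ι * (d * Real.log (d + w * A ^ 2 * 4 ^ L)) := fun j hj => by
    rw [Finset.mem_Icc] at hj
    split_ifs with h
    · rw [mul_zero]
      positivity
    · rw [mul_one]
      refine (card_windowRounds_layer_le hw hd hA m hj.2).trans ?_
      -- The threshold applies to layer `j - 1`, whence the extra factor `4` in `16384 = 4 · 64²`.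
      -- Layer `1` is covered since `64 √ι ≥ 64`.
      have h4 : (4 : ℝ) ^ j ≤ 16384 * ι := by
        obtain ⟨i, rfl⟩ : ∃ i, j = i + 1 := ⟨j - 1, by omega⟩
        have h5 : (2 : ℝ) ^ i ≤ 64 * √ι := by
          by_contra! hlt
          refine h ⟨?_, by simpa using hlt.le⟩
          by_contra! hi
          have : i = 0 := by omega
          rw [this] at hlt
          norm_num at hlt
          linarith
        have h6 := pow_le_pow_left₀ (by positivity) h5 2
        rw [mul_pow, Real.sq_sqrt (by linarith), ← pow_mul, mul_comm i 2, pow_mul] at h6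
        rw [pow_succ]
        norm_num at h6
        linarith
      have h7 : 0 ≤ d * Real.log (d + w * A ^ 2 * 4 ^ L) := by positivity
      nlinarith
  refine (Finset.sum_le_card_nsmul _ _ _ h1).trans (le_of_eq ?_)
  rw [Nat.card_Icc, Nat.add_sub_cancel, nsmul_eq_mul]
  ring

/-- Cauchy–Schwarz over the windows; this turns noise per window into the total noise. -/
theorem sum_sqrt_windowRounds_le (f : ℕ → ℝ) (hf : ∀ i, 0 ≤ f i) :
    ∑ m ∈ Finset.range (K / w + 1), √(∑ i ∈ windowRounds w K m, f i)
      ≤ √(((K / w + 1 : ℕ) : ℝ) * ∑ i ∈ Finset.Icc 1 K, f i) := by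
  refine Real.le_sqrt_of_sq_le ?_
  have h := sq_sum_le_card_mul_sum_sq (s := Finset.range (K / w + 1))
    (f := fun m => √(∑ i ∈ windowRounds w K m, f i))
  rw [Finset.card_range] at h
  refine h.trans (le_of_eq ?_)
  rw [← sum_windowRounds (w := w)]
  congr 1
  exact Finset.sum_congr rfl fun m _ => Real.sq_sqrt (Finset.sum_nonneg fun i _ => hf i)

end Regret

/-! ### Summation of the regret over all rounds and windows. -/

section TotalRegret

variable {d : ℕ} {w L K : ℕ} {a : ℕ → EuclideanSpace ℝ (Fin d)} {r ε : ℕ → ℝ}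
  {θ : ℕ → EuclideanSpace ℝ (Fin d)}

/-- Replaces a sum depending on the round and the layer by one common to the whole window, including
its later rounds, so that it can be factored out. -/
theorem noiseSq_le_sum_windowRounds (hw : 1 ≤ w) {k ℓ : ℕ} (hk : k ∈ Finset.Icc 1 K) (hℓ : ℓ ≤ L) :
    noiseSq w L a r ε k ℓ ≤ ∑ i ∈ windowRounds w K (k / w), ε i ^ 2 := by
  have hk' := Finset.mem_Icc.1 hk
  calc noiseSq w L a r ε k ℓ ≤ ∑ i ∈ Finset.Ico (start w k) k, ε i ^ 2 := by
        refine Finset.sum_le_sum fun i _ => ?_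
        rw [wnoise, mul_pow]
        exact mul_le_of_le_one_left (sq_nonneg _)
          (pow_le_one₀ (wgt_nonneg w L a r ℓ i) (wgt_le_one w L a r hℓ i))
    _ ≤ _ := by
        refine Finset.sum_le_sum_of_subset_of_nonneg (fun i hi => ?_) fun _ _ _ => sq_nonneg _
        rw [Finset.mem_Ico] at hi
        have := one_le_start w k
        refine Finset.mem_filter.2 ⟨Finset.mem_Icc.2 ⟨by omega, by omega⟩, ?_⟩
        exact div_eq_of_start_le hw hi.1 hi.2.le

/-- The regret of one round is at most `2`. -/
theorem regret_round_le_two {D : Set (EuclideanSpace ℝ (Fin d))} {θ x : EuclideanSpace ℝ (Fin d)}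
    (hx : x ∈ D) (hD : ∀ y ∈ D, inner ℝ y θ ∈ Set.Icc (-1 : ℝ) 1) :
    sSup ((fun y => inner ℝ y θ) '' D) - inner ℝ x θ ≤ 2 := by
  have h1 : sSup ((fun y => inner ℝ y θ) '' D) ≤ 1 := by
    refine csSup_le ⟨_, x, hx, rfl⟩ ?_
    rintro _ ⟨y, hy, rfl⟩
    exact (hD y hy).2
  have h2 := (hD x hx).1
  linarith

/-- Failed rounds and low-layer rounds are charged `2` each; every other round is charged its drift
and its layer cost. The four sums are bounded separately. -/
theorem regret_le_of_typical {A R B δ : ℝ} {D : ℕ → Set (EuclideanSpace ℝ (Fin d))}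
    (hw : 1 ≤ w) (hd : 1 ≤ d) (hA : 0 ≤ A) (hR : 0 ≤ R) (hB0 : 0 ≤ B)
    (hr : ∀ i, r i = inner ℝ (θ i) (a i) + ε i)
    (hB : ∀ k ∈ Finset.Icc 1 K, ‖θ k‖ ≤ B)
    (hDA : ∀ k ∈ Finset.Icc 1 K, ∀ x ∈ D k, ‖x‖ ≤ A)
    (hDm : ∀ k ∈ Finset.Icc 1 K, ∀ x ∈ D k, inner ℝ x (θ k) ∈ Set.Icc (-1 : ℝ) 1)
    (hε : ∀ k ∈ Finset.Icc 1 K, |ε k| ≤ R)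
    (hplay : ∀ k ∈ Finset.Icc 1 K, a k ∈ D k ∧
      ∀ x ∈ D k, index R B δ w L a r k x ≤ index R B δ w L a r k (a k))
    (hι : 1 ≤ Real.log (4 * (w : ℝ) ^ 2 * L / δ))
    (hι1 : Real.log (4 * (w : ℝ) ^ 2 * L / δ) ≤ Real.log (4 * ((w : ℝ) + 1) ^ 2 * L / δ))
    (hBR : B ≤ 60 * R * Real.log (4 * (w : ℝ) ^ 2 * L / δ) ∨ R = 0)
    (hhigh : 64 * √(Real.log (4 * ((w : ℝ) + 1) ^ 2 * L / δ)) ≤ (2 : ℝ) ^ L)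
    (bad : Set ℕ)
    (hS : ∀ k ∈ Finset.Icc 1 K, k ∉ bad → ∀ ℓ ∈ Set.Icc 1 L, selfNoise w L a r ε k ℓ
      ≤ 36 * reg ℓ * Real.log (4 * (w : ℝ) ^ 2 * L / δ)
        * (noiseSq w L a r ε k ℓ + 9 * R ^ 2 * Real.log (4 * (w : ℝ) ^ 2 * L / δ))) :
    ∑ k ∈ Finset.Icc 1 K, (sSup ((fun x => inner ℝ x (θ k)) '' D k) - inner ℝ (a k) (θ k))
      ≤ 2 * ∑ k ∈ Finset.Icc 1 K, bad.indicator (fun _ => (1 : ℝ)) k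
        + (2 * A * 2 ^ L + 8) * (√w * A * (w * ∑ j ∈ Finset.Icc 1 (K - 1), ‖θ (j + 1) - θ j‖))
        + 65536 * L * Real.log (4 * ((w : ℝ) + 1) ^ 2 * L / δ)
          * (d * Real.log (d + w * A ^ 2 * 4 ^ L)) * (K / w + 1 : ℕ)
        + 2 * Real.log (4 * ((w : ℝ) + 1) ^ 2 * L / δ)
          * (8 * L * (d * Real.log (d + w * A ^ 2 * 4 ^ L)) + w * reg L)
          * (80 * √((K / w + 1 : ℕ) * ∑ i ∈ Finset.Icc 1 K, ε i ^ 2)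
            + 16 * (11 * B + 5 * R + 4) * (K / w + 1 : ℕ)) := by
  set ι := Real.log (4 * (w : ℝ) ^ 2 * L / δ) with hιd
  set ι1 := Real.log (4 * ((w : ℝ) + 1) ^ 2 * L / δ) with hι1d
  set Λ := d * Real.log (d + w * A ^ 2 * 4 ^ L) with hΛ
  set C1 := 16 * (11 * B + 5 * R + 4) with hC1
  have hC10 : 0 ≤ C1 := by positivity
  have hι10 : 1 ≤ ι1 := hι.trans hι1
  have haA : ∀ i ∈ Finset.Icc 1 K, ‖a i‖ ≤ A := fun i hi => hDA i hi _ (hplay i hi).1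
  set low : ℕ → ℝ := fun k =>
    if 2 ≤ lay w L a r k ∧ 64 * √ι1 ≤ (2 : ℝ) ^ (lay w L a r k - 1) then (0 : ℝ) else 1 with hlow
  set Q : ℕ → ℝ := fun m => ∑ i ∈ windowRounds w K m, ε i ^ 2 with hQ
  have hround : ∀ k ∈ Finset.Icc 1 K,
      sSup ((fun x => inner ℝ x (θ k)) '' D k) - inner ℝ (a k) (θ k)
        ≤ 2 * bad.indicator (fun _ => (1 : ℝ)) k + 2 * low k
          + (2 * A * 2 ^ L + 8) * (√w * A * windowVariation w θ k)
          + 2 * ι1 * (reg (lay w L a r k - 1) * (80 * √(Q (k / w)) + C1)) := fun k hk => by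
    have hk' := Finset.mem_Icc.1 hk
    have h2 := regret_round_le_two (hplay k hk).1 (hDm k hk)
    have hΔ := windowVariation_nonneg (w := w) (θ := θ) k
    have hnn1 : 0 ≤ (2 * A * 2 ^ L + 8) * (√w * A * windowVariation w θ k) := by positivity
    have hnn2 : 0 ≤ 2 * ι1 * (reg (lay w L a r k - 1) * (80 * √(Q (k / w)) + C1)) := by
      have := reg_pos (lay w L a r k - 1)
      positivity
    have hlow0 : 0 ≤ low k := by
      simp only [hlow]
      split_ifs <;> norm_num
    have hbad0 : 0 ≤ bad.indicator (fun _ => (1 : ℝ)) k :=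
      Set.indicator_nonneg (fun _ _ => zero_le_one) k
    by_cases hb : k ∈ bad
    · rw [Set.indicator_of_mem hb]
      linarith
    by_cases hl : 2 ≤ lay w L a r k ∧ 64 * √ι1 ≤ (2 : ℝ) ^ (lay w L a r k - 1)
    · have hmem : ∀ i ∈ Finset.Ico (start w k) k, i ∈ Finset.Icc 1 K := fun i hi => by
        have := one_le_start w k
        rw [Finset.mem_Ico] at hi
        exact Finset.mem_Icc.2 ⟨by omega, by omega⟩
      have hle := lay_le w L a r k
      have hℓ : lay w L a r k - 1 ∈ Set.Icc 1 L := ⟨by omega, by omega⟩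
      have key : ∀ x ∈ D k, inner ℝ x (θ k) - inner ℝ (a k) (θ k)
          ≤ (2 * A * 2 ^ L + 8) * (√w * A * windowVariation w θ k)
            + 2 * reg (lay w L a r k - 1) * ι1 * (80 * √(Q (k / w)) + C1) := fun x hx =>
        inner_le_of_typical hr hw hk'.1 hℓ (by omega) hA hR (hB k hk)
          (fun i hi => hε i (hmem i hi)) (fun i hi => haA i (hmem i hi)) hι hι1 hBR (hS k hk hb)
          hl.2 (noiseSq_le_sum_windowRounds hw hk hℓ.2) (hDA k hk x hx) ((hplay k hk).2 x hx)
      have hsup : sSup ((fun x => inner ℝ x (θ k)) '' D k)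
          ≤ inner ℝ (a k) (θ k) + ((2 * A * 2 ^ L + 8) * (√w * A * windowVariation w θ k)
            + 2 * reg (lay w L a r k - 1) * ι1 * (80 * √(Q (k / w)) + C1)) := by
        refine csSup_le ⟨_, a k, (hplay k hk).1, rfl⟩ ?_
        rintro _ ⟨x, hx, rfl⟩
        have := key x hx
        simp only
        linarith
      linarith
    · have : low k = 1 := if_neg hl
      rw [this]
      linarith
  refine (Finset.sum_le_sum hround).trans ?_
  rw [Finset.sum_add_distrib, Finset.sum_add_distrib, Finset.sum_add_distrib, ← Finset.mul_sum,
    ← Finset.mul_sum, ← Finset.mul_sum, ← Finset.mul_sum, ← Finset.mul_sum]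
  have hvar : (2 * A * 2 ^ L + 8) * (√w * A * ∑ k ∈ Finset.Icc 1 K, windowVariation w θ k)
      ≤ (2 * A * 2 ^ L + 8) * (√w * A * (w * ∑ j ∈ Finset.Icc 1 (K - 1), ‖θ (j + 1) - θ j‖)) := by
    have := sum_windowVariation_le (θ := θ) hw K
    gcongr
  have hlowsum : ∑ k ∈ Finset.Icc 1 K, low k ≤ 32768 * L * ι1 * Λ * (K / w + 1 : ℕ) := by
    rw [← sum_windowRounds (w := w)]
    refine (Finset.sum_le_card_nsmul _ _ _ fun m _ =>
      card_low_layer_le (a := a) (r := r) hw hd hι10 hhigh haA m).trans (le_of_eq ?_)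
    rw [Finset.card_range, nsmul_eq_mul]
    ring
  set Z := 8 * L * Λ + w * reg L with hZ
  have hmainsum : ∑ k ∈ Finset.Icc 1 K, reg (lay w L a r k - 1) * (80 * √(Q (k / w)) + C1)
      ≤ Z * (80 * √((K / w + 1 : ℕ) * ∑ i ∈ Finset.Icc 1 K, ε i ^ 2)
            + C1 * (K / w + 1 : ℕ)) := by
    rw [← sum_windowRounds (w := w)]
    have h1 : ∀ m ∈ Finset.range (K / w + 1), ∑ k ∈ windowRounds w K m,
        reg (lay w L a r k - 1) * (80 * √(Q (k / w)) + C1) ≤ Z * (80 * √(Q m) + C1) := fun m _ => by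
      have h2 : ∑ k ∈ windowRounds w K m, reg (lay w L a r k - 1) * (80 * √(Q (k / w)) + C1)
          = (∑ k ∈ windowRounds w K m, reg (lay w L a r k - 1)) * (80 * √(Q m) + C1) := by
        rw [Finset.sum_mul]
        refine Finset.sum_congr rfl fun k hk => ?_
        rw [(Finset.mem_filter.1 hk).2]
      rw [h2]
      exact mul_le_mul_of_nonneg_right (sum_reg_layer_le hw hd haA m) (by positivity)
    refine (Finset.sum_le_sum h1).trans ?_
    rw [← Finset.mul_sum, Finset.sum_add_distrib, ← Finset.mul_sum, Finset.sum_const,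
      Finset.card_range, nsmul_eq_mul, mul_comm ((K / w + 1 : ℕ) : ℝ) C1]
    have hd' : (1 : ℝ) ≤ d := by exact_mod_cast hd
    have hZ0 : 0 ≤ Z := by
      have := (reg_pos L).le
      have : 0 ≤ Real.log (d + w * A ^ 2 * 4 ^ L) :=
        Real.log_nonneg (le_add_of_le_of_nonneg hd' (by positivity))
      positivity
    refine mul_le_mul_of_nonneg_left (add_le_add (mul_le_mul_of_nonneg_left ?_ (by norm_num))
      le_rfl) hZ0
    exact sum_sqrt_windowRounds_le (fun i => ε i ^ 2) fun i => sq_nonneg _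
  have hfin := mul_le_mul_of_nonneg_left hmainsum (by positivity : 0 ≤ 2 * ι1)
  linarith

end TotalRegret

/-! ### The choice of the parameters -/

section Parameters

/-- All exponents in the parameters and in the rate have denominators dividing `30`. Passing to 30th
roots turns the balancing into polynomial identities. -/
theorem rpow_eq_root_pow {x : ℝ} (hx : 0 ≤ x) (n : ℕ) {e : ℝ} (he : e = n / 30) :
    x ^ e = (x ^ (1 / 30 : ℝ)) ^ n := by
  rw [← Real.rpow_natCast, ← Real.rpow_mul hx, he]
  congr 1
  ring

theorem root_pow_thirty {x : ℝ} (hx : 0 ≤ x) : (x ^ (1 / 30 : ℝ)) ^ 30 = x := by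
  rw [← rpow_eq_root_pow hx 30 (e := 1) (by norm_num), Real.rpow_one]

/-- The properties of the window size `w` and of `α` in terms of which the regret is bounded:
`w² B_K`, `d K / w` and `d √(K V_K / w)` are at most of the order of `T`, and `α² w` is of the
order of `d`. -/
structure GoodParameters (C d K BK VK w α T : ℝ) : Prop where
  one_le_w : 1 ≤ w
  alpha_pos : 0 < α
  drift_le : w ^ 2 * BK ≤ C * T
  windows_le : d * K / w ≤ C * T
  variance_le : d * √(K * VK / w) ≤ C * T
  alpha_le : α ^ 2 * w ≤ C * d
  le_alpha : d ≤ C * (α ^ 2 * w)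

/-- Ensures that rounding the window size up costs only a constant factor: the unrounded size `u` is
bounded below. -/
theorem one_le_mul_of_inv_le_pow {c u : ℝ} (hc : 0 < c) (hu : 0 < u) (h : 1 ≤ c * u ^ 3) :
    1 ≤ (1 + c) * u := by
  by_contra! hlt
  have h1 : u < 1 := by nlinarith
  have h2 : u ^ 3 ≤ u := by
    calc u ^ 3 = u * u ^ 2 := by ring
      _ ≤ u * 1 := mul_le_mul_of_nonneg_left (pow_le_one₀ hu.le h1.le) hu.le
      _ = u := mul_one u
  nlinarith

theorem rpow_sixth_pow {x : ℝ} (hx : 0 ≤ x) : (x ^ (1 / 6 : ℝ)) ^ 6 = x := by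
  rw [← Real.rpow_natCast, ← Real.rpow_mul hx]
  norm_num

/-- The case of a small total variance. All quantities are 30th powers: `d = p³⁰`, `K = q³⁰`,
`B_K = b³⁰`, `V_K = v³⁰`. -/
theorem goodParameters_of_small_variance {p q b v c Y W : ℝ} (hp : 1 ≤ p) (hq : 0 < q)
    (hb : 0 < b) (hv : 0 < v) (hc : 0 < c) (hbc : b ^ 30 ≤ c * q ^ 30)
    (hreg : v ^ 3 * p ≤ q ^ 2 * b) (hW1 : p ^ 10 * q ^ 10 / b ^ 10 ≤ W)
    (hW2 : W ≤ p ^ 10 * q ^ 10 / b ^ 10 + 1) (hW3 : 1 ≤ W) (hY : 0 < Y)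
    (hY6 : Y ^ 6 = v ^ 30 * q ^ 30 * W) {T : ℝ} (hT : p ^ 20 * b ^ 10 * q ^ 20 ≤ T) :
    GoodParameters ((3 + c) ^ 2) (p ^ 30) (q ^ 30) (b ^ 30) (v ^ 30) W
      (p ^ 5 * √W * b ^ 10 / (q ^ 10 + Y)) T := by
  have hp0 : 0 < p := by linarith
  set u := p ^ 10 * q ^ 10 / b ^ 10 with hu
  have hu0 : 0 < u := by positivity
  have hub : u * b ^ 10 = p ^ 10 * q ^ 10 := by rw [hu]; field_simp
  have hW0 : 0 < W := by linarith
  have hu3 : 1 ≤ c * u ^ 3 := by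
    have h1 : u ^ 3 * b ^ 30 = p ^ 30 * q ^ 30 := by
      calc u ^ 3 * b ^ 30 = (u * b ^ 10) ^ 3 := by ring
        _ = _ := by rw [hub]; ring
    have h2 : q ^ 30 ≤ p ^ 30 * q ^ 30 := le_mul_of_one_le_left (by positivity) (one_le_pow₀ hp)
    have h3 : b ^ 30 ≤ c * u ^ 3 * b ^ 30 := by
      calc b ^ 30 ≤ c * (u ^ 3 * b ^ 30) := by
            rw [h1]; exact hbc.trans (mul_le_mul_of_nonneg_left h2 hc.le)
        _ = _ := by ring
    by_contra! hlt
    have := mul_lt_mul_of_pos_right hlt (by positivity : 0 < b ^ 30)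
    linarith
  have hu1 := one_le_mul_of_inv_le_pow hc hu0 hu3
  have hWu : W ≤ (2 + c) * u := by linarith
  have hT0 : 0 ≤ T := le_trans (by positivity) hT
  have hC1 : (1 : ℝ) ≤ (3 + c) ^ 2 := one_le_pow₀ (by linarith)
  have hTC : T ≤ (3 + c) ^ 2 * T := le_mul_of_one_le_left hT0 hC1
  -- In this regime `V_K u ≤ K`, so the term `K^{1/3}` dominates the denominator of `α`.
  have hYq : Y ≤ (2 + c) * q ^ 10 := by
    refine le_of_pow_le_pow_left₀ (n := 6) (by norm_num) (by positivity) ?_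
    rw [hY6]
    have h1 : v ^ 30 * u ≤ q ^ 30 := by
      rw [hu, mul_div_assoc', div_le_iff₀ (by positivity)]
      have := pow_le_pow_left₀ (by positivity) hreg 10
      have h2 := mul_le_mul_of_nonneg_right this (by positivity : 0 ≤ q ^ 10)
      calc v ^ 30 * (p ^ 10 * q ^ 10) = (v ^ 3 * p) ^ 10 * q ^ 10 := by ring
        _ ≤ _ := h2
        _ = _ := by ring
    calc v ^ 30 * q ^ 30 * W ≤ v ^ 30 * q ^ 30 * ((2 + c) * u) := by gcongr
      _ = (2 + c) * (q ^ 30 * (v ^ 30 * u)) := by ring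
      _ ≤ (2 + c) * (q ^ 30 * q ^ 30) := by gcongr
      _ ≤ (2 + c) ^ 6 * (q ^ 30 * q ^ 30) := by
          refine mul_le_mul_of_nonneg_right ?_ (by positivity)
          exact le_self_pow₀ (by linarith) (by norm_num)
      _ = _ := by ring
  have hα : (p ^ 5 * √W * b ^ 10 / (q ^ 10 + Y)) ^ 2 * W
      = p ^ 10 * W ^ 2 * b ^ 20 / (q ^ 10 + Y) ^ 2 := by
    rw [div_pow, mul_pow, mul_pow, Real.sq_sqrt hW0.le]
    ring
  refine ⟨hW3, by positivity, ?_, ?_, ?_, ?_, ?_⟩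
  · calc W ^ 2 * b ^ 30 ≤ ((2 + c) * u) ^ 2 * b ^ 30 := by gcongr
      _ = (2 + c) ^ 2 * ((u * b ^ 10) ^ 2 * b ^ 10) := by ring
      _ = (2 + c) ^ 2 * (p ^ 20 * b ^ 10 * q ^ 20) := by rw [hub]; ring
      _ ≤ (3 + c) ^ 2 * T := by gcongr; norm_num
  · refine le_trans ?_ hTC
    refine le_trans ?_ hT
    rw [div_le_iff₀ hW0]
    calc p ^ 30 * q ^ 30 = p ^ 20 * q ^ 20 * (p ^ 10 * q ^ 10) := by ring
      _ = p ^ 20 * b ^ 10 * q ^ 20 * u := by rw [← hub]; ring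
      _ ≤ _ := by gcongr
  · refine le_trans ?_ hTC
    refine le_trans ?_ hT
    have h1 : √(q ^ 30 * v ^ 30 / W) ≤ q ^ 20 * b ^ 10 / p ^ 10 := by
      refine Real.sqrt_le_iff.2 ⟨by positivity, ?_⟩
      rw [div_le_iff₀ hW0]
      have h2 := pow_le_pow_left₀ (by positivity) hreg 10
      calc q ^ 30 * v ^ 30 = q ^ 30 * (v ^ 3 * p) ^ 10 / p ^ 10 := by field_simp
        _ ≤ q ^ 30 * (q ^ 2 * b) ^ 10 / p ^ 10 := by gcongr
        _ = q ^ 40 * b ^ 10 * (p ^ 10 * q ^ 10) / p ^ 20 := by field_simp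
        _ = (q ^ 20 * b ^ 10 / p ^ 10) ^ 2 * u := by rw [← hub]; field_simp
        _ ≤ _ := by gcongr
    calc p ^ 30 * √(q ^ 30 * v ^ 30 / W) ≤ p ^ 30 * (q ^ 20 * b ^ 10 / p ^ 10) := by gcongr
      _ = _ := by field_simp
  · rw [hα, div_le_iff₀ (by positivity)]
    calc p ^ 10 * W ^ 2 * b ^ 20 ≤ p ^ 10 * ((2 + c) * u) ^ 2 * b ^ 20 := by gcongr
      _ = (2 + c) ^ 2 * p ^ 10 * (u * b ^ 10) ^ 2 := by ring
      _ = (2 + c) ^ 2 * p ^ 30 * (q ^ 10) ^ 2 := by rw [hub]; ring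
      _ ≤ (3 + c) ^ 2 * p ^ 30 * (q ^ 10 + Y) ^ 2 := by
          gcongr
          · norm_num
          · linarith
  · rw [hα, mul_div_assoc', le_div_iff₀ (by positivity)]
    calc p ^ 30 * (q ^ 10 + Y) ^ 2 ≤ p ^ 30 * ((3 + c) * q ^ 10) ^ 2 := by
          gcongr
          linarith
      _ = (3 + c) ^ 2 * (p ^ 10 * (p ^ 10 * q ^ 10) ^ 2) := by ring
      _ = (3 + c) ^ 2 * (p ^ 10 * u ^ 2 * b ^ 20) := by rw [← hub]; ring
      _ ≤ _ := by gcongr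

/-- The case of a large total variance. -/
theorem goodParameters_of_large_variance {p q b v c Y W : ℝ} (hp : 1 ≤ p) (hq : 0 < q)
    (hb : 0 < b) (hv : 0 < v) (hc : 0 < c) (hbc : b ^ 30 ≤ c * q ^ 30)
    (hreg : q ^ 2 * b ≤ v ^ 3 * p) (hW1 : p ^ 12 * (q ^ 6 * v ^ 6) / b ^ 12 ≤ W)
    (hW2 : W ≤ p ^ 12 * (q ^ 6 * v ^ 6) / b ^ 12 + 1) (hW3 : 1 ≤ W) (hY : 0 < Y)
    (hY6 : Y ^ 6 = v ^ 30 * q ^ 30 * W) {T : ℝ} (hT : p ^ 24 * v ^ 12 * b ^ 6 * q ^ 12 ≤ T) :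
    GoodParameters ((3 + c) ^ 2) (p ^ 30) (q ^ 30) (b ^ 30) (v ^ 30) W
      (p ^ 5 * √W * b ^ 10 / (q ^ 10 + Y)) T := by
  have hp0 : 0 < p := by linarith
  set u := p ^ 12 * (q ^ 6 * v ^ 6) / b ^ 12 with hu
  have hu0 : 0 < u := by positivity
  have hub : u * b ^ 12 = p ^ 12 * (q ^ 6 * v ^ 6) := by rw [hu]; field_simp
  have hW0 : 0 < W := by linarith
  have hu3 : 1 ≤ c * u ^ 3 := by
    have h1 : u ^ 3 * b ^ 36 = p ^ 36 * q ^ 18 * v ^ 18 := by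
      calc u ^ 3 * b ^ 36 = (u * b ^ 12) ^ 3 := by ring
        _ = _ := by rw [hub]; ring
    have h2 : q ^ 30 ≤ p ^ 30 * q ^ 30 := le_mul_of_one_le_left (by positivity) (one_le_pow₀ hp)
    have h3 : b ^ 36 ≤ c * u ^ 3 * b ^ 36 := by
      calc b ^ 36 = b ^ 30 * b ^ 6 := by ring
        _ ≤ c * (p ^ 30 * q ^ 30) * b ^ 6 := by
            gcongr
            exact hbc.trans (mul_le_mul_of_nonneg_left h2 hc.le)
        _ = c * (p ^ 30 * q ^ 18) * (q ^ 2 * b) ^ 6 := by ring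
        _ ≤ c * (p ^ 30 * q ^ 18) * (v ^ 3 * p) ^ 6 := by gcongr
        _ = c * (u ^ 3 * b ^ 36) := by rw [h1]; ring
        _ = _ := by ring
    by_contra! hlt
    have := mul_lt_mul_of_pos_right hlt (by positivity : 0 < b ^ 36)
    linarith
  have hu1 := one_le_mul_of_inv_le_pow hc hu0 hu3
  have hWu : W ≤ (2 + c) * u := by linarith
  have hT0 : 0 ≤ T := le_trans (by positivity) hT
  have hC1 : (1 : ℝ) ≤ (3 + c) ^ 2 := one_le_pow₀ (by linarith)
  have hTC : T ≤ (3 + c) ^ 2 * T := le_mul_of_one_le_left hT0 hC1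
  have hqv : q ^ 30 ≤ v ^ 30 * u := by
    rw [hu, mul_div_assoc', le_div_iff₀ (by positivity)]
    calc q ^ 30 * b ^ 12 = q ^ 6 * (q ^ 2 * b) ^ 12 := by ring
      _ ≤ q ^ 6 * (v ^ 3 * p) ^ 12 := by gcongr
      _ = _ := by ring
  -- In this regime `V_K u ≥ K`, so the second term dominates the denominator of `α`.
  have hYq : q ^ 10 ≤ Y := by
    refine le_of_pow_le_pow_left₀ (n := 6) (by norm_num) hY.le ?_
    rw [hY6]
    calc (q ^ 10) ^ 6 = q ^ 30 * q ^ 30 := by ring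
      _ ≤ q ^ 30 * (v ^ 30 * W) := by
          gcongr
          exact hqv.trans (by gcongr)
      _ = _ := by ring
  have hα : (p ^ 5 * √W * b ^ 10 / (q ^ 10 + Y)) ^ 2 * W
      = p ^ 10 * W ^ 2 * b ^ 20 / (q ^ 10 + Y) ^ 2 := by
    rw [div_pow, mul_pow, mul_pow, Real.sq_sqrt hW0.le]
    ring
  have hu5 : u ^ 5 * b ^ 60 = p ^ 60 * (q ^ 30 * v ^ 30) := by
    calc u ^ 5 * b ^ 60 = (u * b ^ 12) ^ 5 := by ring
      _ = _ := by rw [hub]; ring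
  refine ⟨hW3, by positivity, ?_, ?_, ?_, ?_, ?_⟩
  · calc W ^ 2 * b ^ 30 ≤ ((2 + c) * u) ^ 2 * b ^ 30 := by gcongr
      _ = (2 + c) ^ 2 * ((u * b ^ 12) ^ 2 * b ^ 6) := by ring
      _ = (2 + c) ^ 2 * (p ^ 24 * v ^ 12 * b ^ 6 * q ^ 12) := by rw [hub]; ring
      _ ≤ (3 + c) ^ 2 * T := by gcongr; norm_num
  · refine le_trans ?_ hTC
    refine le_trans ?_ hT
    rw [div_le_iff₀ hW0]
    have h1 : p ^ 30 * q ^ 30 * b ^ 6 ≤ p ^ 24 * v ^ 12 * b ^ 6 * q ^ 12 * u * b ^ 6 := by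
      calc p ^ 30 * q ^ 30 * b ^ 6 = p ^ 30 * q ^ 18 * (q ^ 2 * b) ^ 6 := by ring
        _ ≤ p ^ 30 * q ^ 18 * (v ^ 3 * p) ^ 6 := by gcongr
        _ = p ^ 24 * v ^ 12 * q ^ 12 * (p ^ 12 * (q ^ 6 * v ^ 6)) := by ring
        _ = _ := by rw [← hub]; ring
    exact (le_of_mul_le_mul_right h1 (by positivity)).trans (by gcongr)
  · refine le_trans ?_ hTC
    refine le_trans ?_ hT
    have h1 : √(q ^ 30 * v ^ 30 / W) ≤ q ^ 12 * v ^ 12 * b ^ 6 / p ^ 6 := by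
      refine Real.sqrt_le_iff.2 ⟨by positivity, ?_⟩
      rw [div_le_iff₀ hW0]
      calc q ^ 30 * v ^ 30 = q ^ 24 * v ^ 24 * (p ^ 12 * (q ^ 6 * v ^ 6)) / p ^ 12 := by field_simp
        _ = (q ^ 12 * v ^ 12 * b ^ 6 / p ^ 6) ^ 2 * u := by rw [← hub]; field_simp
        _ ≤ _ := by gcongr
    calc p ^ 30 * √(q ^ 30 * v ^ 30 / W) ≤ p ^ 30 * (q ^ 12 * v ^ 12 * b ^ 6 / p ^ 6) := by gcongr
      _ = _ := by field_simp
  -- The rounded window size occurs inside `Y`, and only `Y ^ 6` is explicit; cubing turns `Y ^ 2`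
  -- into it.
  · refine le_of_pow_le_pow_left₀ (n := 3) (by norm_num) (by positivity) ?_
    rw [hα, div_pow, div_le_iff₀ (by positivity)]
    calc (p ^ 10 * W ^ 2 * b ^ 20) ^ 3 = p ^ 30 * W ^ 5 * W * b ^ 60 := by ring
      _ ≤ p ^ 30 * ((2 + c) * u) ^ 5 * W * b ^ 60 := by gcongr
      _ = (2 + c) ^ 5 * p ^ 30 * W * (u ^ 5 * b ^ 60) := by ring
      _ = (2 + c) ^ 5 * (p ^ 30) ^ 3 * Y ^ 6 := by rw [hu5, hY6]; ring
      _ ≤ (3 + c) ^ 6 * (p ^ 30) ^ 3 * (q ^ 10 + Y) ^ 6 := by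
          gcongr ?_ * _ * ?_
          · calc (2 + c) ^ 5 ≤ (3 + c) ^ 5 := by gcongr; norm_num
              _ ≤ (3 + c) ^ 6 := pow_le_pow_right₀ (by linarith) (by norm_num)
          · gcongr
            have : 0 < q ^ 10 := by positivity
            linarith
      _ = _ := by ring
  · refine le_of_pow_le_pow_left₀ (n := 3) (by norm_num) (by positivity) ?_
    rw [hα, mul_div_assoc', div_pow, le_div_iff₀ (by positivity)]
    calc (p ^ 30) ^ 3 * ((q ^ 10 + Y) ^ 2) ^ 3 ≤ (p ^ 30) ^ 3 * ((2 * Y) ^ 2) ^ 3 := by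
          gcongr
          linarith
      _ = 64 * (p ^ 30) * p ^ 60 * Y ^ 6 := by ring
      _ = 64 * p ^ 30 * W * (p ^ 60 * (q ^ 30 * v ^ 30)) := by rw [hY6]; ring
      _ = 64 * p ^ 30 * W * (u ^ 5 * b ^ 60) := by rw [hu5]
      _ ≤ (3 + c) ^ 6 * p ^ 30 * W * (W ^ 5 * b ^ 60) := by
          gcongr ?_ * _ * _ * ?_
          · calc (64 : ℝ) = 2 ^ 6 := by norm_num
              _ ≤ (3 + c) ^ 6 := by gcongr; linarith
          · gcongr
      _ = _ := by ring

theorem goodParameters {c₀ c₁ : ℝ} (hc₀ : 0 < c₀) (hc₁ : 0 < c₁) {d K : ℕ} {BK VK : ℝ}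
    (hd : 1 ≤ d) (hK : 1 ≤ K) (hBK : BK ∈ Set.Icc c₀ (c₁ * K)) (hVK : VK ∈ Set.Icc c₀ (c₁ * K)) :
    GoodParameters ((3 + c₁) ^ 2) d K BK VK (window d K BK VK)
      (alpha d K BK VK (window d K BK VK)) (rate d K BK VK) := by
  have hd0 : (0 : ℝ) ≤ d := Nat.cast_nonneg d
  have hd1 : (1 : ℝ) ≤ d := by exact_mod_cast hd
  have hK0 : (0 : ℝ) < K := by exact_mod_cast hK
  have hB0 : 0 < BK := hc₀.trans_le hBK.1
  have hV0 : 0 < VK := hc₀.trans_le hVK.1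
  set p := (d : ℝ) ^ (1 / 30 : ℝ) with hp
  set q := (K : ℝ) ^ (1 / 30 : ℝ) with hq
  set b := BK ^ (1 / 30 : ℝ) with hb
  set v := VK ^ (1 / 30 : ℝ) with hv
  have hp1 : 1 ≤ p := Real.one_le_rpow hd1 (by norm_num)
  have hq0 : 0 < q := Real.rpow_pos_of_pos hK0 _
  have hb0 : 0 < b := Real.rpow_pos_of_pos hB0 _
  have hv0 : 0 < v := Real.rpow_pos_of_pos hV0 _
  have hp30 : (d : ℝ) = p ^ 30 := (root_pow_thirty hd0).symm
  have hq30 : (K : ℝ) = q ^ 30 := (root_pow_thirty hK0.le).symm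
  have hb30 : BK = b ^ 30 := (root_pow_thirty hB0.le).symm
  have hv30 : VK = v ^ 30 := (root_pow_thirty hV0.le).symm
  have hbc : b ^ 30 ≤ c₁ * q ^ 30 := by rw [← hb30, ← hq30]; exact hBK.2
  have hrate : rate d K BK VK = p ^ 24 * v ^ 12 * b ^ 6 * q ^ 12 + p ^ 20 * b ^ 10 * q ^ 20 := by
    have e (x : ℝ) (hx : 0 ≤ x) : x ^ (2 / 5 : ℝ) = (x ^ (1 / 30 : ℝ)) ^ 12 :=
      rpow_eq_root_pow hx 12 (by norm_num)
    rw [rate, rpow_eq_root_pow hd0 24 (e := 4 / 5) (by norm_num), e _ hV0.le,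
      rpow_eq_root_pow hB0.le 6 (e := 1 / 5) (by norm_num), e _ hK0.le,
      rpow_eq_root_pow hd0 20 (e := 2 / 3) (by norm_num),
      rpow_eq_root_pow hB0.le 10 (e := 1 / 3) (by norm_num),
      rpow_eq_root_pow hK0.le 20 (e := 2 / 3) (by norm_num)]
  set w := window d K BK VK with hw
  have hcond : VK ^ 3 * d / BK ≤ (K : ℝ) ^ 2 ↔ v ^ 3 * p ≤ q ^ 2 * b := by
    rw [div_le_iff₀ hB0, hp30, hq30, hb30, hv30]
    rw [show (v ^ 30) ^ 3 * p ^ 30 = (v ^ 3 * p) ^ 30 by ring,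
      show (q ^ 30) ^ 2 * b ^ 30 = (q ^ 2 * b) ^ 30 by ring]
    exact pow_le_pow_iff_left₀ (by positivity) (by positivity) (by norm_num)
  have hw1 : (d : ℝ) ^ (1 / 3 : ℝ) * (K / BK) ^ (1 / 3 : ℝ) = p ^ 10 * q ^ 10 / b ^ 10 := by
    rw [Real.div_rpow hK0.le hB0.le, rpow_eq_root_pow hd0 10 (by norm_num),
      rpow_eq_root_pow hK0.le 10 (by norm_num), rpow_eq_root_pow hB0.le 10 (by norm_num),
      mul_div_assoc']
  have hw2 : (d : ℝ) ^ (2 / 5 : ℝ) * (K * VK) ^ (1 / 5 : ℝ) / BK ^ (2 / 5 : ℝ)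
      = p ^ 12 * (q ^ 6 * v ^ 6) / b ^ 12 := by
    rw [Real.mul_rpow hK0.le hV0.le, rpow_eq_root_pow hd0 12 (by norm_num),
      rpow_eq_root_pow hK0.le 6 (by norm_num), rpow_eq_root_pow hV0.le 6 (by norm_num),
      rpow_eq_root_pow hB0.le 12 (by norm_num)]
  have hp0 : 0 < p := by linarith
  have hw_pos : 1 ≤ w := by
    rw [hw, window]
    split_ifs
    · rw [hw1]
      exact Nat.ceil_pos.2 (by positivity)
    · rw [hw2]
      exact Nat.ceil_pos.2 (by positivity)
  have hW3 : (1 : ℝ) ≤ w := by exact_mod_cast hw_pos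
  have hVKw : 0 < VK * K * w := by positivity
  have halpha : alpha d K BK VK w
      = p ^ 5 * √w * b ^ 10 / (q ^ 10 + (VK * K * w) ^ (1 / 6 : ℝ)) := by
    rw [alpha, rpow_eq_root_pow hd0 5 (by norm_num), rpow_eq_root_pow hB0.le 10 (by norm_num),
      rpow_eq_root_pow hK0.le 10 (by norm_num)]
  have hY : 0 < (VK * K * w) ^ (1 / 6 : ℝ) := Real.rpow_pos_of_pos hVKw _
  have hY6 : ((VK * K * w) ^ (1 / 6 : ℝ)) ^ 6 = v ^ 30 * q ^ 30 * w := by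
    rw [rpow_sixth_pow hVKw.le, ← hv30, ← hq30]
  rw [halpha, hrate]
  set Y := (VK * K * w) ^ (1 / 6 : ℝ)
  by_cases h : VK ^ 3 * d / BK ≤ (K : ℝ) ^ 2
  · have hceil : w = ⌈p ^ 10 * q ^ 10 / b ^ 10⌉₊ := by rw [hw, window, if_pos h, hw1]
    have := goodParameters_of_small_variance hp1 hq0 hb0 hv0 hc₁ hbc (hcond.1 h) (W := w)
      (by rw [hceil]; exact Nat.le_ceil _)
      (by rw [hceil]; exact (Nat.ceil_lt_add_one (by positivity)).le) hW3 hY hY6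
      (T := p ^ 24 * v ^ 12 * b ^ 6 * q ^ 12 + p ^ 20 * b ^ 10 * q ^ 20)
      (le_add_of_nonneg_left (by positivity))
    rwa [← hp30, ← hq30, ← hb30, ← hv30] at this
  · have hceil : w = ⌈p ^ 12 * (q ^ 6 * v ^ 6) / b ^ 12⌉₊ := by rw [hw, window, if_neg h, hw2]
    have := goodParameters_of_large_variance hp1 hq0 hb0 hv0 hc₁ hbc
      (le_of_lt (not_le.1 fun h' => h (hcond.2 h'))) (W := w)
      (by rw [hceil]; exact Nat.le_ceil _)
      (by rw [hceil]; exact (Nat.ceil_lt_add_one (by positivity)).le) hW3 hY hY6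
      (T := p ^ 24 * v ^ 12 * b ^ 6 * q ^ 12 + p ^ 20 * b ^ 10 * q ^ 20)
      (le_add_of_nonneg_right (by positivity))
    rwa [← hp30, ← hq30, ← hb30, ← hv30] at this

end Parameters

/-! ### The regret bound in terms of the rate -/

section Rate

theorem numLayers_bounds {α : ℝ} (h0 : 0 < α) (h1 : α < 1) :
    1 ≤ numLayers α ∧ 1 ≤ α * 2 ^ numLayers α ∧ α * 2 ^ numLayers α ≤ 2 := by
  have hlog : 0 < Real.logb 2 (1 / α) := Real.logb_pos one_lt_two ((one_lt_div h0).2 h1)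
  have hα : (2 : ℝ) ^ Real.logb 2 (1 / α) = 1 / α :=
    Real.rpow_logb two_pos (by norm_num) (by positivity)
  refine ⟨Nat.ceil_pos.2 hlog, ?_, ?_⟩
  · have h2 : 1 / α ≤ 2 ^ numLayers α := by
      rw [← hα, ← Real.rpow_natCast]
      exact Real.rpow_le_rpow_of_exponent_le one_le_two (Nat.le_ceil _)
    rwa [div_le_iff₀ h0, mul_comm] at h2
  · have h2 : (2 : ℝ) ^ numLayers α ≤ 1 / α * 2 := by
      rw [← hα, ← Real.rpow_natCast]
      refine (Real.rpow_le_rpow_of_exponent_le one_le_two (Nat.ceil_lt_add_one hlog.le).le).trans ?_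
      rw [Real.rpow_add two_pos, Real.rpow_one]
    calc α * 2 ^ numLayers α ≤ α * (1 / α * 2) := by gcongr
      _ = 2 := by field_simp

theorem log_le_of_le_mul_exp {z c y : ℝ} (hz : 0 < z) (hc : 0 < c) (h : z ≤ c * Real.exp y) :
    Real.log z ≤ c + y := by
  have h1 := Real.log_le_log hz h
  rw [Real.log_mul hc.ne' (Real.exp_pos _).ne', Real.log_exp] at h1
  linarith [Real.log_le_sub_one_of_pos hc]

/-- The logarithmic factors, for `1 ≤ w ≤ K` and `α < 1`. -/
theorem log_factors_le {M A δ α d : ℝ} {K w L : ℕ} (hM : 1 ≤ M) (hK : 1 ≤ K) (hw : 1 ≤ w)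
    (hwK : w ≤ K) (hδ : 0 < δ) (hδ1 : δ < 1) (hα0 : 0 < α) (hα1 : α < 1) (hd : 1 ≤ d)
    (hL : 1 ≤ L) (hL2 : α * 2 ^ L ≤ 2) (hα' : d ≤ M * (α ^ 2 * w)) :
    Real.log (4 * ((w : ℝ) + 1) ^ 2 * L / δ) ≤ (64 * M * (1 + A ^ 2) + 3) * (1 + Real.log (K / δ))
    ∧ L ≤ (64 * M * (1 + A ^ 2) + 3) * (1 + Real.log (K / δ))
    ∧ Real.log (d + w * A ^ 2 * 4 ^ L) ≤ (64 * M * (1 + A ^ 2) + 3) * (1 + Real.log (K / δ))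
    ∧ (2 ^ L) ^ 2 ≤ 4 * M * (w : ℝ) := by
  set x := 1 + Real.log (K / δ) with hx
  have hK1 : (1 : ℝ) ≤ K := by exact_mod_cast hK
  have hw1 : (1 : ℝ) ≤ w := by exact_mod_cast hw
  have hL1 : (1 : ℝ) ≤ L := by exact_mod_cast hL
  have hwK' : (w : ℝ) ≤ K := by exact_mod_cast hwK
  have hKδ : K ≤ K / δ := le_div_self (by linarith) hδ hδ1.le
  have hexp : K / δ ≤ Real.exp x := by
    rw [hx, Real.exp_add, Real.exp_log (by positivity)]
    exact le_mul_of_one_le_left (by positivity) (Real.one_le_exp zero_le_one)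
  have hKx : K ≤ Real.exp x := hKδ.trans hexp
  have hx1 : 1 ≤ x := by
    have : 0 ≤ Real.log (K / δ) := Real.log_nonneg (hK1.trans hKδ)
    linarith
  have hα2 : α ^ 2 * (2 ^ L) ^ 2 ≤ 4 := by
    rw [← mul_pow]
    calc (α * 2 ^ L) ^ 2 ≤ 2 ^ 2 := by gcongr
      _ = 4 := by norm_num
  -- Combine `2^L ≤ 2 / α` with `1 ≤ d ≤ M α² w`; this is what makes `2^L` at most of order `√w`.
  have h4 : ((2 : ℝ) ^ L) ^ 2 ≤ 4 * M * w := by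
    have h1 : (1 : ℝ) ≤ M * (α ^ 2 * w) := hd.trans hα'
    calc ((2 : ℝ) ^ L) ^ 2 ≤ (2 ^ L) ^ 2 * (M * (α ^ 2 * w)) :=
          le_mul_of_one_le_right (by positivity) h1
      _ = α ^ 2 * (2 ^ L) ^ 2 * (M * w) := by ring
      _ ≤ 4 * (M * w) := by gcongr
      _ = _ := by ring
  have h4' : (4 : ℝ) ^ L ≤ 4 * M * w := by
    calc (4 : ℝ) ^ L = (2 ^ L) ^ 2 := by rw [← pow_mul, mul_comm, pow_mul]; norm_num
      _ ≤ _ := h4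
  have hLK : (L : ℝ) ≤ 4 * M * K := by
    calc (L : ℝ) ≤ 4 ^ L := by exact_mod_cast (Nat.lt_pow_self (by norm_num)).le
      _ ≤ 4 * M * w := h4'
      _ ≤ _ := by gcongr
  have hdK : d ≤ M * K := by
    calc d ≤ M * (α ^ 2 * w) := hα'
      _ ≤ M * (1 * K) := by
          gcongr
          exact pow_le_one₀ hα0.le hα1.le
      _ = _ := by ring
  have hA2 : 0 ≤ A ^ 2 := sq_nonneg A
  have hMA : M ≤ M * (1 + A ^ 2) := le_mul_of_one_le_right (by linarith) (by linarith)
  have hMA1 : 1 ≤ M * (1 + A ^ 2) := hM.trans hMA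
  have hexp2 : Real.exp (2 * x) = Real.exp x * Real.exp x := by
    rw [← Real.exp_add]; ring_nf
  have hexp3 : Real.exp (3 * x) = Real.exp x * Real.exp x * Real.exp x := by
    rw [← Real.exp_add, ← Real.exp_add]; ring_nf
  have hfin : 64 * (M * (1 + A ^ 2)) + 3 * x ≤ (64 * M * (1 + A ^ 2) + 3) * x := by
    nlinarith
  refine ⟨?_, ?_, ?_, h4⟩
  · refine (log_le_of_le_mul_exp (c := 64 * M) (y := 3 * x) (by positivity) (by positivity)
      ?_).trans ?_
    · rw [hexp3]
      calc 4 * ((w : ℝ) + 1) ^ 2 * L / δ ≤ 4 * (2 * K) ^ 2 * (4 * M * K) / δ := by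
            gcongr
            linarith
        _ = 64 * M * (K * K * (K / δ)) := by ring
        _ ≤ 64 * M * (Real.exp x * Real.exp x * Real.exp x) := by gcongr
    · linarith
  · have h1 : (L : ℝ) ≤ Real.log (4 ^ L) := by
      rw [Real.log_pow]
      refine le_mul_of_one_le_right (by positivity) ?_
      rw [Real.le_log_iff_exp_le (by norm_num)]
      linarith [Real.exp_one_lt_d9]
    refine h1.trans ?_
    refine (log_le_of_le_mul_exp (c := 4 * M) (y := x) (by positivity) (by positivity)
      ?_).trans ?_
    · refine h4'.trans ?_
      gcongr
      exact hwK'.trans hKx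
    · linarith
  · refine (log_le_of_le_mul_exp (c := 4 * (M * (1 + A ^ 2))) (y := 2 * x) (by positivity)
      (by positivity) ?_).trans ?_
    · rw [hexp2]
      calc d + w * A ^ 2 * 4 ^ L ≤ M * K * K + K * A ^ 2 * (4 * M * K) := by
            gcongr
            · exact hdK.trans (le_mul_of_one_le_right (by positivity) hK1)
            · exact h4'.trans (by gcongr)
        _ ≤ 4 * (M * (1 + A ^ 2)) * (K * K) := by
            nlinarith [mul_pos (by linarith : (0 : ℝ) < M) (by positivity : (0 : ℝ) < K * K)]
        _ ≤ 4 * (M * (1 + A ^ 2)) * (Real.exp x * Real.exp x) := by gcongr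
    · linarith

/-- The terms of the regret bound of a typical run are of the order of the rate. -/
theorem sum_terms_le {A E M c s d K BK VK w α T L Y ι Λ g n S V β x : ℝ}
    (hG : GoodParameters M d K BK VK w α T) (hA : 0 ≤ A) (hE : 0 ≤ E) (hM : 1 ≤ M) (hc : 0 ≤ c)
    (hs : 0 ≤ s) (hd : 1 ≤ d) (hK : 0 < K) (hVK : 0 ≤ VK) (hx : 1 ≤ x)
    (hL0 : 0 ≤ L) (hL : L ≤ c * x) (hY : 1 ≤ Y) (hYw : Y ^ 2 ≤ 4 * M * w)
    (hι0 : 0 ≤ ι) (hι : ι ≤ c * x) (hΛ0 : 0 ≤ Λ) (hΛ : Λ ≤ c * x) (hg0 : 0 ≤ g)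
    (hg : g ≤ α ^ 2) (hn0 : 0 ≤ n) (hn : n ≤ 2 * (K / w)) (hS0 : 0 ≤ S) (hS : S ≤ s * x * VK)
    (hV0 : 0 ≤ V) (hV : V ≤ BK) (hβ : β ≤ K / w) (hBK : 0 ≤ BK) :
    2 * β + (2 * A * Y + 8) * (√w * A * (w * V)) + 65536 * L * ι * (d * Λ) * n
        + 2 * ι * (8 * L * (d * Λ) + w * g) * (80 * √(n * S) + 16 * E * n)
      ≤ (2 * M + (2 * A + 8) * A * (2 * M ^ 2) + 131072 * c ^ 3 * M
          + 2 * c * (8 * c ^ 2 + M) * (80 * (1 + 2 * s) * M + 32 * E * M)) * x ^ 4 * T := by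
  have hw1 := hG.one_le_w
  have hw0 : 0 < w := by linarith
  have hx0 : 0 < x := by linarith
  have hM0 : 0 < M := by linarith
  have hKw : 0 ≤ K / w := by positivity
  have hdn : d * (K / w) ≤ M * T := by
    rw [← mul_div_assoc]; exact hG.windows_le
  have hMT : 0 ≤ M * T := le_trans (by positivity) hdn
  have hT : 0 ≤ T := by
    by_contra! h
    have := mul_neg_of_pos_of_neg hM0 h
    linarith
  have hx4 : 1 ≤ x ^ 4 := one_le_pow₀ hx
  have hx34 : x ^ 3 ≤ x ^ 4 := pow_le_pow_right₀ hx (by norm_num)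
  have t1 : 2 * β ≤ 2 * M * x ^ 4 * T := by
    calc 2 * β ≤ 2 * (d * (K / w)) := by
          gcongr
          exact hβ.trans (le_mul_of_one_le_left hKw hd)
      _ ≤ 2 * (M * T) := by gcongr
      _ ≤ 2 * (M * T) * x ^ 4 := le_mul_of_one_le_right (by positivity) hx4
      _ = _ := by ring
  have t2 : (2 * A * Y + 8) * (√w * A * (w * V)) ≤ (2 * A + 8) * A * (2 * M ^ 2) * x ^ 4 * T := by
    -- With `Y = 2^L` of order `√w`, the drift term `Y √w · w B_K` becomes `w² B_K`.
    have h1 : Y * √w ≤ 2 * M * w := by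
      refine le_of_pow_le_pow_left₀ (n := 2) (by norm_num) (by positivity) ?_
      rw [mul_pow, Real.sq_sqrt hw0.le]
      calc Y ^ 2 * w ≤ 4 * M * w * w := by gcongr
        _ ≤ 4 * (M * M) * w * w := by
            gcongr
            exact le_mul_of_one_le_left hM0.le hM
        _ = _ := by ring
    calc (2 * A * Y + 8) * (√w * A * (w * V)) ≤ (2 * A * Y + 8 * Y) * (√w * A * (w * BK)) := by
          gcongr
          linarith
      _ = (2 * A + 8) * A * (w * BK) * (Y * √w) := by ring
      _ ≤ (2 * A + 8) * A * (w * BK) * (2 * M * w) := by gcongr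
      _ = (2 * A + 8) * A * (2 * M) * (w ^ 2 * BK) := by ring
      _ ≤ (2 * A + 8) * A * (2 * M) * (M * T) :=
          mul_le_mul_of_nonneg_left hG.drift_le (by positivity)
      _ ≤ (2 * A + 8) * A * (2 * M) * (M * T) * x ^ 4 :=
          le_mul_of_one_le_right (by positivity) hx4
      _ = _ := by ring
  have hdn' : d * n ≤ 2 * (M * T) := by
    calc d * n ≤ d * (2 * (K / w)) := by gcongr
      _ = 2 * (d * (K / w)) := by ring
      _ ≤ _ := by gcongr
  have t3 : 65536 * L * ι * (d * Λ) * n ≤ 131072 * c ^ 3 * M * x ^ 4 * T := by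
    calc 65536 * L * ι * (d * Λ) * n = 65536 * (L * ι * Λ) * (d * n) := by ring
      _ ≤ 65536 * ((c * x) * (c * x) * (c * x)) * (2 * (M * T)) := by gcongr
      _ = 131072 * c ^ 3 * (M * T) * x ^ 3 := by ring
      _ ≤ 131072 * c ^ 3 * (M * T) * x ^ 4 := by gcongr
      _ = _ := by ring
  have hZ : 8 * L * (d * Λ) + w * g ≤ (8 * c ^ 2 + M) * x ^ 2 * d := by
    have h1 : 8 * L * (d * Λ) ≤ 8 * c ^ 2 * x ^ 2 * d := by
      calc 8 * L * (d * Λ) = 8 * (L * Λ) * d := by ring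
        _ ≤ 8 * ((c * x) * (c * x)) * d := by gcongr
        _ = _ := by ring
    have h2 : w * g ≤ M * x ^ 2 * d := by
      calc w * g ≤ w * α ^ 2 := by gcongr
        _ = α ^ 2 * w := by ring
        _ ≤ M * d := hG.alpha_le
        _ ≤ M * d * x ^ 2 := le_mul_of_one_le_right (by positivity) (one_le_pow₀ hx)
        _ = _ := by ring
    linarith
  have hsqrt : d * √(n * S) ≤ (1 + 2 * s) * x * (M * T) := by
    have h1 : √(n * S) ≤ (1 + 2 * s) * x * √(K * VK / w) := by
      refine Real.sqrt_le_iff.2 ⟨by positivity, ?_⟩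
      rw [mul_pow, Real.sq_sqrt (by positivity)]
      calc n * S ≤ 2 * (K / w) * (s * x * VK) := by gcongr
        _ = (2 * s) * x * (K * VK / w) := by ring
        _ ≤ ((1 + 2 * s) * x) ^ 2 * (K * VK / w) := by
            gcongr
            have hh : 2 * s * x ≤ (1 + 2 * s) * x := by linarith
            have : 1 ≤ (1 + 2 * s) * x := one_le_mul_of_one_le_of_one_le (by linarith) hx
            nlinarith
    calc d * √(n * S) ≤ d * ((1 + 2 * s) * x * √(K * VK / w)) := by gcongr
      _ = (1 + 2 * s) * x * (d * √(K * VK / w)) := by ring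
      _ ≤ _ := mul_le_mul_of_nonneg_left hG.variance_le (by positivity)
  have t4 : 2 * ι * (8 * L * (d * Λ) + w * g) * (80 * √(n * S) + 16 * E * n)
      ≤ 2 * c * (8 * c ^ 2 + M) * (80 * (1 + 2 * s) * M + 32 * E * M) * x ^ 4 * T := by
    calc 2 * ι * (8 * L * (d * Λ) + w * g) * (80 * √(n * S) + 16 * E * n)
        ≤ 2 * (c * x) * ((8 * c ^ 2 + M) * x ^ 2 * d) * (80 * √(n * S) + 16 * E * n) := by gcongr
      _ = 2 * c * (8 * c ^ 2 + M) * x ^ 3 * (80 * (d * √(n * S)) + 16 * E * (d * n)) := by ring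
      _ ≤ 2 * c * (8 * c ^ 2 + M) * x ^ 3
          * (80 * ((1 + 2 * s) * x * (M * T)) + 16 * E * (2 * (M * T) * x)) := by
          have := hdn'.trans (le_mul_of_one_le_right (by positivity) hx)
          refine mul_le_mul_of_nonneg_left (add_le_add ?_ ?_) (by positivity)
          · exact mul_le_mul_of_nonneg_left hsqrt (by norm_num)
          · exact mul_le_mul_of_nonneg_left this (by positivity)
      _ = _ := by ring
  linarith

end Rate

/-! ### The typical event -/

section Typical

variable {d : ℕ}

theorem selfNorm_const_mul (c : ℝ) (v : ℕ → Fin d → ℝ) (η : ℕ → ℝ) (s t : ℕ) (q : ℝ) :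
    selfNorm c v (fun i => q * η i) s t = q ^ 2 * selfNorm c v η s t := by
  simp only [selfNorm]
  have h : ∑ i ∈ Finset.Ico s t, (q * η i) • v i = q • ∑ i ∈ Finset.Ico s t, η i • v i := by
    simp only [Finset.smul_sum, smul_smul]
  rw [h, Matrix.mulVec_smul, smul_dotProduct, dotProduct_smul, smul_eq_mul, smul_eq_mul]
  ring

/-- The bound on the self-normalized noise, for noise that is bounded by `R`. -/
theorem selfNoise_le_of_not_deviates {w L : ℕ} (hw : 1 ≤ w) {ι R : ℝ} (hι : 1 ≤ ι) (hR : 0 ≤ R)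
    {a : ℕ → EuclideanSpace ℝ (Fin d)} {r ε : ℕ → ℝ} {k K : ℕ} (hk : k ∈ Finset.Icc 1 K)
    (hε : ∀ i ∈ Finset.Icc 1 K, |ε i| ≤ R)
    (h : ¬ Deviates w L ι a r (fun i => ε i / R) k) {ℓ : ℕ} (hℓ : ℓ ∈ Set.Icc 1 L) :
    selfNoise w L a r ε k ℓ ≤ 36 * reg ℓ * ι * (noiseSq w L a r ε k ℓ + 9 * R ^ 2 * ι) := by
  have hk' := Finset.mem_Icc.1 hk
  have hmem : ∀ i ∈ Finset.Ico (start w k) k, i ∈ Finset.Icc 1 K := fun i hi => by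
    have := one_le_start w k
    rw [Finset.mem_Ico] at hi
    exact Finset.mem_Icc.2 ⟨by omega, by omega⟩
  have key := selfNorm_le_of_not_deviates hw hι hk'.1
    (fun i hi => abs_div_le_one hR (hε i (hmem i hi))) h (Finset.mem_Icc.2 hℓ)
  have hscale : ∀ i ∈ Finset.Ico (start w k) k,
      wnoise w L a r ε ℓ i = R * wnoise w L a r (fun i => ε i / R) ℓ i := fun i hi => by
    rcases hR.eq_or_lt with h0 | h0
    -- For `R = 0` the noise itself is zero, so the scaling identity survives the convention for
    -- division by zero.
    · have h1 := hε i (hmem i hi)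
      rw [← h0] at h1 ⊢
      rw [wnoise, abs_nonpos_iff.1 h1]
      simp
    · simp only [wnoise]
      field_simp
  have h1 : selfNoise w L a r ε k ℓ = R ^ 2 * selfNorm (reg ℓ) (feat w L a r ℓ)
      (wnoise w L a r (fun i => ε i / R) ℓ) (start w k) k := by
    rw [← selfNorm_const_mul, selfNoise, selfNorm, selfNorm,
      Finset.sum_congr rfl fun i hi => by rw [hscale i hi]]
  have h2 : noiseSq w L a r ε k ℓ = R ^ 2 * ∑ i ∈ Finset.Ico (start w k) k,
      wnoise w L a r (fun i => ε i / R) ℓ i ^ 2 := by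
    rw [noiseSq, Finset.mul_sum]
    exact Finset.sum_congr rfl fun i hi => by rw [hscale i hi, mul_pow]
  rw [h1, h2]
  calc _ ≤ R ^ 2 * _ := mul_le_mul_of_nonneg_left key (sq_nonneg R)
    _ = _ := by ring

variable {Ω : Type*} [MeasurableSpace Ω] {μ : Measure Ω} {K : ℕ}

/-- A run is typical if the noise is bounded by `R`, the sum of the squared noises is controlled by
the total variance, and few rounds deviate. -/
def IsTypical (w L K : ℕ) (ι R VK δ : ℝ) (a : ℕ → EuclideanSpace ℝ (Fin d)) (r ε : ℕ → ℝ) : Prop :=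
  (∀ i ∈ Finset.Icc 1 K, |ε i| ≤ R)
    ∧ ∑ i ∈ Finset.Icc 1 K, ε i ^ 2 ≤ 2 * VK + R ^ 2 * Real.log (1 / δ)
    ∧ ∑ k ∈ Finset.Icc 1 K,
        {k | Deviates w L ι a r (fun i => ε i / R) k}.indicator (fun _ => (1 : ℝ)) k ≤ K / w

/-- The exponent `2 ι` squares `δ / (4 w² L)`, which beats the roughly `L w²` events of the union
bound and leaves the factor `1 / w` that the counting argument consumes. -/
theorem deviation_probability_le {w L : ℕ} (hw : 1 ≤ w) (hL : 1 ≤ L) {δ : ℝ} (hδ : 0 < δ)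
    (hδ1 : δ < 1) :
    L * w * (w + 1) * Real.exp (-(2 * Real.log (4 * (w : ℝ) ^ 2 * L / δ))) ≤ δ / w := by
  have hw1 : (1 : ℝ) ≤ w := by exact_mod_cast hw
  have hL1 : (1 : ℝ) ≤ L := by exact_mod_cast hL
  have h1 : Real.exp (-(2 * Real.log (4 * (w : ℝ) ^ 2 * L / δ))) = (δ / (4 * w ^ 2 * L)) ^ 2 := by
    rw [Real.exp_neg, two_mul, Real.exp_add, Real.exp_log (by positivity), ← sq, ← inv_pow, inv_div]
  rw [h1, div_pow, mul_div_assoc', div_le_div_iff₀ (by positivity) (by positivity)]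
  have h2 : δ ^ 2 ≤ δ := by nlinarith
  calc (L : ℝ) * w * (w + 1) * δ ^ 2 * w ≤ L * w * (w + w) * δ * w := by gcongr
    _ = δ * (2 * w ^ 3 * L) := by ring
    _ ≤ δ * (16 * w ^ 4 * L ^ 2) := by
        gcongr
        · norm_num
        · norm_num
        · exact le_self_pow₀ hL1 (by norm_num)
    _ = _ := by ring

/-- Boundedness fails with probability zero, the squared noises and the number of deviating rounds
cost `δ` each. The expected number of deviating rounds is at most `K δ / w`, and the threshold `K /
w` is `1 / δ` times that. -/
theorem measure_not_isTypical_le [IsProbabilityMeasure μ] {A R B BK VK δ : ℝ}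
    {θ : ℕ → EuclideanSpace ℝ (Fin d)} {D : ℕ → Ω → Set (EuclideanSpace ℝ (Fin d))}
    {a : ℕ → Ω → EuclideanSpace ℝ (Fin d)} {ε σ : ℕ → Ω → ℝ}
    (hE : IsEnvironment μ K A R B BK VK θ D a ε σ) (hR : 0 ≤ R) (hK : 1 ≤ K) (hδ : 0 < δ)
    (hδ1 : δ < 1) (r : Ω → ℕ → ℝ) {w L : ℕ} (hw : 1 ≤ w) (hL : 1 ≤ L)
    (hι : 1 ≤ Real.log (4 * (w : ℝ) ^ 2 * L / δ)) :
    μ {ω | ¬ IsTypical w L K (Real.log (4 * (w : ℝ) ^ 2 * L / δ)) R VK δ (fun i => a i ω) (r ω)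
        (fun i => ε i ω)} ≤ ENNReal.ofReal (3 * δ) := by
  set ι := Real.log (4 * (w : ℝ) ^ 2 * L / δ) with hιd
  have hw1 : (1 : ℝ) ≤ w := by exact_mod_cast hw
  have hK1 : (1 : ℝ) ≤ K := by exact_mod_cast hK
  set E : ℕ → Set Ω := fun k => {ω | Deviates w L ι (fun i => a i ω) (r ω) (fun i => ε i ω / R) k}
    with hEdef
  have h1 : μ {ω | ¬ ∀ i ∈ Finset.Icc 1 K, |ε i ω| ≤ R} = 0 := by
    have : ∀ᵐ ω ∂μ, ∀ i ∈ Finset.Icc 1 K, |ε i ω| ≤ R := by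
      rw [Finset.eventually_all]
      exact hE.noise_le
    exact this
  have h2 := measure_sum_sq_noise_ge_le hE.measurable_arm hE.measurable_noise hR hE.noise_le
    hE.noise_variance hK hE.variance_le (Real.log (1 / δ))
  have h2' : Real.exp (-Real.log (1 / δ)) = δ := by
    rw [one_div, Real.log_inv, neg_neg, Real.exp_log hδ]
  rw [h2'] at h2
  have h3 := measure_card_ge_le (μ := μ) (Finset.Icc 1 K) E (p := δ / w) (z := K / w)
    (by positivity) fun k hk =>
      (measure_deviates_le hE.measurable_arm hE.measurable_noise hR hE.noise_le hE.noise_mean r hw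
        hι hk).trans (ENNReal.ofReal_le_ofReal (deviation_probability_le hw hL hδ hδ1))
  have h3' : ((Finset.Icc 1 K).card : ℝ) * (δ / w) / (K / w) = δ := by
    rw [Nat.card_Icc, Nat.add_sub_cancel]
    field_simp
  rw [h3'] at h3
  have hsub : {ω | ¬ IsTypical w L K ι R VK δ (fun i => a i ω) (r ω) (fun i => ε i ω)}
      ⊆ {ω | ¬ ∀ i ∈ Finset.Icc 1 K, |ε i ω| ≤ R}
        ∪ ({ω | 2 * VK + R ^ 2 * Real.log (1 / δ) < ∑ i ∈ Finset.Icc 1 K, ε i ω ^ 2}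
        ∪ {ω | K / w ≤ ∑ i ∈ Finset.Icc 1 K, (E i).indicator (fun _ => (1 : ℝ)) ω}) := by
    intro ω hω
    by_contra hcon
    simp only [Set.mem_union, Set.mem_ofPred_eq, not_or, not_lt, not_le, not_not] at hcon
    refine hω ⟨hcon.1, hcon.2.1, le_trans (le_of_eq ?_) hcon.2.2.le⟩
    refine Finset.sum_congr rfl fun k _ => ?_
    simp only [Set.indicator]
    rfl
  refine (measure_mono hsub).trans ((measure_union_le _ _).trans ?_)
  rw [h1, zero_add]
  refine (measure_union_le _ _).trans ((add_le_add h2 h3).trans ?_)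
  rw [← ENNReal.ofReal_add hδ.le hδ.le]
  exact ENNReal.ofReal_le_ofReal (by linarith)

end Typical

/-! ### Explicit constants, degenerate parameters and typical runs. -/

section Constant

/-- The constant of the regret bound of a typical run. -/
def typicalConstant (A R B c₀ M : ℝ) : ℝ :=
  2 * M + (2 * A + 8) * A * (2 * M ^ 2) + 131072 * (64 * M * (1 + A ^ 2) + 3) ^ 3 * M
    + 2 * (64 * M * (1 + A ^ 2) + 3) * (8 * (64 * M * (1 + A ^ 2) + 3) ^ 2 + M)
      * (80 * (1 + 2 * (2 + R ^ 2 / c₀)) * M + 32 * (11 * B + 5 * R + 4) * M)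

/-- The constant of the bound on the number of rounds in the cases in which the regret is bounded
by twice the number of rounds. -/
def trivialConstant (A R B c₀ M : ℝ) : ℝ :=
  M / c₀ + M ^ 2 + 4096 * (64 * M * (1 + A ^ 2) + 3) * M ^ 2 + Real.exp (B / R) * M

theorem typicalConstant_nonneg {A R B c₀ M : ℝ} (hA : 0 ≤ A) (hR : 0 ≤ R) (hB : 0 ≤ B)
    (hc₀ : 0 < c₀) (hM : 0 < M) : 0 ≤ typicalConstant A R B c₀ M := by
  unfold typicalConstant
  positivity

theorem trivialConstant_pos {A R B c₀ M : ℝ} (hc₀ : 0 < c₀) (hM : 0 < M) :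
    0 < trivialConstant A R B c₀ M := by
  unfold trivialConstant
  positivity

theorem regret_le_two_mul {Ω : Type*} {d K : ℕ} {θ : ℕ → EuclideanSpace ℝ (Fin d)}
    {D : ℕ → Ω → Set (EuclideanSpace ℝ (Fin d))} {a : ℕ → Ω → EuclideanSpace ℝ (Fin d)} {ω : Ω}
    (ha : ∀ k ∈ Finset.Icc 1 K, a k ω ∈ D k ω)
    (hD : ∀ k ∈ Finset.Icc 1 K, ∀ x ∈ D k ω, inner ℝ x (θ k) ∈ Set.Icc (-1 : ℝ) 1) :
    regret K θ D a ω ≤ 2 * K := by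
  refine (Finset.sum_le_card_nsmul _ _ 2 fun k hk =>
    regret_round_le_two (ha k hk) (hD k hk)).trans (le_of_eq ?_)
  rw [Nat.card_Icc, Nat.add_sub_cancel, nsmul_eq_mul, mul_comm]

/-- Unless the number of rounds is of the order of the rate, the parameters are in the range to
which the analysis of typical runs applies. -/
theorem parameters_of_not_trivial {A R B c₀ M BK VK δ α T : ℝ} {d K w : ℕ}
    (hG : GoodParameters M d K BK VK w α T) (hB : 0 ≤ B) (hR : 0 ≤ R) (hc₀ : 0 < c₀)
    (hM : 1 ≤ M) (hd : 1 ≤ d) (hK : 1 ≤ K) (hBK : c₀ ≤ BK) (hδ : 0 < δ) (hδ1 : δ < 1)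
    (hno : trivialConstant A R B c₀ M * ((1 + Real.log (K / δ)) ^ 4 * T) < K) :
    w ≤ K ∧ α < 1
      ∧ 64 * √(Real.log (4 * ((w : ℝ) + 1) ^ 2 * numLayers α / δ)) ≤ (2 : ℝ) ^ numLayers α
      ∧ (B ≤ 60 * R * Real.log (4 * (w : ℝ) ^ 2 * numLayers α / δ) ∨ R = 0) := by
  set x := 1 + Real.log (K / δ) with hx
  have hK1 : (1 : ℝ) ≤ K := by exact_mod_cast hK
  have hd1 : (1 : ℝ) ≤ d := by exact_mod_cast hd
  have hw1 := hG.one_le_w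
  have hw1' : 1 ≤ w := by exact_mod_cast hw1
  have hw0 : (0 : ℝ) < w := by linarith
  have hM0 : 0 < M := by linarith
  have hx1 : 1 ≤ x := by
    have : 0 ≤ Real.log (K / δ) :=
      Real.log_nonneg (hK1.trans (le_div_self (by linarith) hδ hδ1.le))
    linarith
  have hT : 0 ≤ T := by
    have h1 : 0 ≤ M * T := le_trans (by positivity) hG.windows_le
    exact nonneg_of_mul_nonneg_right h1 hM0
  have hU : 0 ≤ x ^ 4 * T := by positivity
  have hxT : x * T ≤ x ^ 4 * T := by
    gcongr
    exact le_self_pow₀ hx1 (by norm_num)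
  have hTU : T ≤ x ^ 4 * T := le_mul_of_one_le_left hT (one_le_pow₀ hx1)
  have hno' : ∀ N ≤ trivialConstant A R B c₀ M, ¬ (K ≤ N * (x ^ 4 * T)) := fun N hN h => by
    have := mul_le_mul_of_nonneg_right hN hU
    linarith
  have hc : 0 < 64 * M * (1 + A ^ 2) + 3 := by positivity
  have hn1 : 0 ≤ M / c₀ := by positivity
  have hn2 : 0 ≤ M ^ 2 := by positivity
  have hn3 : 0 ≤ 4096 * (64 * M * (1 + A ^ 2) + 3) * M ^ 2 := by positivity
  have hn4 : 0 ≤ Real.exp (B / R) * M := by positivity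
  -- The source of the trivial cases below other than `w > K`: whenever `w` is at most `d` times
  -- constants and logarithms, `K` is of the order of the rate.
  have hKd : (K : ℝ) * d ≤ w * (M * T) := by
    have := (div_le_iff₀ hw0).1 hG.windows_le
    linarith
  have hwK : w ≤ K := by
    by_contra! hlt
    have hlt' : (K : ℝ) ≤ w := by exact_mod_cast hlt.le
    refine hno' (M / c₀) (by unfold trivialConstant; linarith) ?_
    rw [div_mul_eq_mul_div, le_div_iff₀ hc₀]
    calc (K : ℝ) * c₀ ≤ (K * K) * c₀ := by gcongr; exact le_mul_of_one_le_right (by linarith) hK1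
      _ ≤ (w * w) * BK := by gcongr
      _ = w ^ 2 * BK := by ring
      _ ≤ M * T := hG.drift_le
      _ ≤ _ := by gcongr
  have hα1 : α < 1 := by
    by_contra! hge
    refine hno' (M ^ 2) (by unfold trivialConstant; linarith) ?_
    have h1 : (w : ℝ) ≤ M * d := (le_mul_of_one_le_left hw0.le (one_le_pow₀ hge)).trans hG.alpha_le
    have h2 : (K : ℝ) * d ≤ M ^ 2 * T * d := by
      calc (K : ℝ) * d ≤ w * (M * T) := hKd
        _ ≤ M * d * (M * T) := by gcongr
        _ = _ := by ring
    exact (le_of_mul_le_mul_right h2 (by linarith)).trans (by gcongr)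
  obtain ⟨hL, hL1, hL2⟩ := numLayers_bounds hG.alpha_pos hα1
  obtain ⟨hι1, -, -, -⟩ := log_factors_le (A := A) hM hK hw1' hwK hδ hδ1 hG.alpha_pos hα1 hd1 hL hL2
    hG.le_alpha
  set L := numLayers α
  refine ⟨hwK, hα1, ?_, ?_⟩
  · by_contra! hlt
    refine hno' (4096 * (64 * M * (1 + A ^ 2) + 3) * M ^ 2)
      (by unfold trivialConstant; linarith) ?_
    set ι1 := Real.log (4 * ((w : ℝ) + 1) ^ 2 * L / δ)
    have hι0 : 0 ≤ ι1 := by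
      by_contra! hneg
      rw [Real.sqrt_eq_zero_of_nonpos hneg.le, mul_zero] at hlt
      have : (0 : ℝ) < 2 ^ L := by positivity
      linarith
    -- Too few layers means `1 / α ≤ 2^L < 64 √ι`, and then `α² w ≤ M d` bounds `w` by `d` times a
    -- logarithm.
    have h1 : 1 ≤ α ^ 2 * (4096 * ι1) := by
      calc (1 : ℝ) ≤ (α * 2 ^ L) ^ 2 := one_le_pow₀ hL1
        _ ≤ (α * (64 * √ι1)) ^ 2 := by
            have := hG.alpha_pos
            gcongr
        _ = α ^ 2 * (4096 * √ι1 ^ 2) := by ring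
        _ = _ := by rw [Real.sq_sqrt hι0]
    have h2 : (w : ℝ) ≤ M * d * (4096 * ι1) := by
      calc (w : ℝ) ≤ w * (α ^ 2 * (4096 * ι1)) := le_mul_of_one_le_right hw0.le h1
        _ = α ^ 2 * w * (4096 * ι1) := by ring
        _ ≤ _ := mul_le_mul_of_nonneg_right hG.alpha_le (by positivity)
    have h3 : (K : ℝ) * d ≤ 4096 * (64 * M * (1 + A ^ 2) + 3) * M ^ 2 * (x * T) * d := by
      calc (K : ℝ) * d ≤ w * (M * T) := hKd
        _ ≤ M * d * (4096 * ((64 * M * (1 + A ^ 2) + 3) * x)) * (M * T) := by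
            refine mul_le_mul_of_nonneg_right (h2.trans ?_) (by positivity)
            gcongr
        _ = _ := by ring
    exact (le_of_mul_le_mul_right h3 (by linarith)).trans (by gcongr)
  · rcases hR.eq_or_lt with h0 | hR0
    · exact Or.inr h0.symm
    left
    -- Otherwise `w` is bounded by a constant. Once it holds, the logarithm in the radius is at
    -- least `B / R`.
    have hwexp : Real.exp (B / R) ≤ w := by
      by_contra! hlt
      refine hno' (Real.exp (B / R) * M) (by unfold trivialConstant; linarith) ?_
      calc (K : ℝ) ≤ K * d := le_mul_of_one_le_right (by linarith) hd1
        _ ≤ w * (M * T) := hKd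
        _ ≤ Real.exp (B / R) * (M * (x ^ 4 * T)) := by gcongr
        _ = _ := by ring
    have hL1' : (1 : ℝ) ≤ L := by exact_mod_cast hL
    have h1 : B / R ≤ Real.log (4 * (w : ℝ) ^ 2 * L / δ) := by
      rw [Real.le_log_iff_exp_le (by positivity)]
      refine hwexp.trans ?_
      calc (w : ℝ) ≤ w * (4 * w * L) := by
            refine le_mul_of_one_le_right hw0.le ?_
            nlinarith
        _ = 4 * w ^ 2 * L := by ring
        _ ≤ _ := le_div_self (by positivity) hδ hδ1.le
    have h2 := (div_le_iff₀ hR0).1 h1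
    have : 0 ≤ R * Real.log (4 * (w : ℝ) ^ 2 * L / δ) := by linarith
    linarith

theorem regret_le_of_isTypical {Ω : Type*} [MeasurableSpace Ω] {μ : Measure Ω}
    {A R B c₀ M BK VK δ α T : ℝ} {d K w : ℕ} {θ : ℕ → EuclideanSpace ℝ (Fin d)}
    {D : ℕ → Ω → Set (EuclideanSpace ℝ (Fin d))} {a : ℕ → Ω → EuclideanSpace ℝ (Fin d)}
    {ε σ : ℕ → Ω → ℝ} (hE : IsEnvironment μ K A R B BK VK θ D a ε σ)
    (hG : GoodParameters M d K BK VK w α T) (hA : 0 ≤ A) (hR : 0 ≤ R) (hB : 0 ≤ B)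
    (hc₀ : 0 < c₀) (hM : 1 ≤ M) (hd : 1 ≤ d) (hK : 1 ≤ K) (hVK : c₀ ≤ VK)
    (hδ : 0 < δ) (hδ1 : δ < 1) (hwK : w ≤ K) (hα1 : α < 1)
    (hhigh : 64 * √(Real.log (4 * ((w : ℝ) + 1) ^ 2 * numLayers α / δ)) ≤ (2 : ℝ) ^ numLayers α)
    (hBR : B ≤ 60 * R * Real.log (4 * (w : ℝ) ^ 2 * numLayers α / δ) ∨ R = 0)
    (hι : 1 ≤ Real.log (4 * (w : ℝ) ^ 2 * numLayers α / δ)) {ω : Ω}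
    (hplay : IsPlay R B δ α w K (fun k => D k ω) (fun k => a k ω) (reward θ a ε ω))
    (htyp : IsTypical w (numLayers α) K (Real.log (4 * (w : ℝ) ^ 2 * numLayers α / δ)) R VK δ
      (fun k => a k ω) (reward θ a ε ω) (fun k => ε k ω)) :
    regret K θ D a ω ≤ typicalConstant A R B c₀ M * (1 + Real.log (K / δ)) ^ 4 * T := by
  have hK1 : (1 : ℝ) ≤ K := by exact_mod_cast hK
  have hd1 : (1 : ℝ) ≤ d := by exact_mod_cast hd
  have hw1 := hG.one_le_w
  have hw1' : 1 ≤ w := by exact_mod_cast hw1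
  have hw0 : (0 : ℝ) < w := by linarith
  have hM0 : 0 < M := by linarith
  have hVK0 : 0 < VK := hc₀.trans_le hVK
  obtain ⟨hL, hL1, hL2⟩ := numLayers_bounds hG.alpha_pos hα1
  obtain ⟨hι1, hLx, hΛx, hY⟩ := log_factors_le (A := A) hM hK hw1' hwK hδ hδ1 hG.alpha_pos hα1 hd1
    hL hL2 hG.le_alpha
  set L := numLayers α
  have hL1' : (1 : ℝ) ≤ L := by exact_mod_cast hL
  have hιι1 : Real.log (4 * (w : ℝ) ^ 2 * L / δ) ≤ Real.log (4 * ((w : ℝ) + 1) ^ 2 * L / δ) := by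
    gcongr
    linarith
  have hΛ0 : 0 ≤ Real.log (d + w * A ^ 2 * 4 ^ L) :=
    Real.log_nonneg (le_add_of_le_of_nonneg hd1 (by positivity))
  have hlogδ : Real.log (1 / δ) ≤ Real.log (K / δ) := by gcongr
  have hlogδ0 : 0 ≤ Real.log (1 / δ) := Real.log_nonneg ((one_le_div hδ).2 hδ1.le)
  set x := 1 + Real.log (K / δ) with hx
  have hx1 : 1 ≤ x := by linarith
  have hreg : reg L ≤ α ^ 2 := by
    rw [reg_eq_inv, show (4 : ℝ) ^ L = (2 ^ L) ^ 2 by rw [← pow_mul, mul_comm, pow_mul]; norm_num,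
      inv_le_iff_one_le_mul₀ (by positivity), ← mul_pow]
    exact one_le_pow₀ hL1
  have hn : ((K / w + 1 : ℕ) : ℝ) ≤ 2 * (K / w) := by
    push_cast
    have h1 : ((K / w : ℕ) : ℝ) ≤ K / w := Nat.cast_div_le
    have h2 : (1 : ℝ) ≤ K / w := (one_le_div hw0).2 (by exact_mod_cast hwK)
    linarith
  have hS : ∑ i ∈ Finset.Icc 1 K, ε i ω ^ 2 ≤ (2 + R ^ 2 / c₀) * x * VK := by
    refine htyp.2.1.trans ?_
    -- The lower bound `c₀ ≤ V_K` absorbs the additive deviation into the variance term.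
    have h1 : R ^ 2 * Real.log (1 / δ) ≤ R ^ 2 / c₀ * x * VK := by
      calc R ^ 2 * Real.log (1 / δ) ≤ R ^ 2 * x := by gcongr; linarith
        _ = R ^ 2 / c₀ * x * c₀ := by field_simp
        _ ≤ _ := by gcongr
    have h2 : VK ≤ x * VK := le_mul_of_one_le_left hVK0.le hx1
    calc 2 * VK + R ^ 2 * Real.log (1 / δ) ≤ 2 * (x * VK) + R ^ 2 / c₀ * x * VK := by gcongr
      _ = _ := by ring
  have hV0 : 0 ≤ ∑ j ∈ Finset.Icc 1 (K - 1), ‖θ (j + 1) - θ j‖ :=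
    Finset.sum_nonneg fun _ _ => norm_nonneg _
  refine (regret_le_of_typical hw1' hd hA hR hB (fun i => rfl) hE.norm_theta_le
    (fun k hk => hE.norm_arm_le k hk ω) (fun k hk => hE.mean_mem k hk ω) htyp.1 hplay hι hιι1 hBR
    hhigh _ fun k hk hbad ℓ hℓ => selfNoise_le_of_not_deviates hw1' hι hR hk htyp.1 hbad hℓ).trans ?_
  exact sum_terms_le hG hA (by positivity) hM (by positivity) (by positivity) hd1 (by linarith)
    hVK0.le hx1 (by positivity) hLx (one_le_pow₀ one_le_two) hY (by linarith) hι1 hΛ0 hΛx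
    (reg_pos L).le hreg (Nat.cast_nonneg _) hn (Finset.sum_nonneg fun _ _ => sq_nonneg _) hS hV0
    hE.variation_le htyp.2.2 (hV0.trans hE.variation_le)

end Constant

end RestartedSAVE

end

theorem mainTheorem4 (A R B c₀ c₁ : ℝ) (hA : 0 ≤ A) (hR : 0 ≤ R) (hB : 0 ≤ B)
    (hc₀ : 0 < c₀) (hc₁ : 0 < c₁) :
    ∃ (C : ℝ) (p : ℕ), 0 < C ∧
      ∀ (d K : ℕ) (BK VK δ : ℝ), 1 ≤ d → 1 ≤ K →
        BK ∈ Set.Icc c₀ (c₁ * K) → VK ∈ Set.Icc c₀ (c₁ * K) → 0 < δ → δ < 1 →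
      ∀ (Ω : Type*) [MeasurableSpace Ω] (μ : Measure Ω) [IsProbabilityMeasure μ]
        (θ : ℕ → EuclideanSpace ℝ (Fin d)) (D : ℕ → Ω → Set (EuclideanSpace ℝ (Fin d)))
        (a : ℕ → Ω → EuclideanSpace ℝ (Fin d)) (ε σ : ℕ → Ω → ℝ),
        RestartedSAVE.IsEnvironment μ K A R B BK VK θ D a ε σ →
        (∀ ω, RestartedSAVE.IsPlay R B δ
          (RestartedSAVE.alpha d K BK VK (RestartedSAVE.window d K BK VK))
          (RestartedSAVE.window d K BK VK) K (fun k => D k ω) (fun k => a k ω)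
          (RestartedSAVE.reward θ a ε ω)) →
        μ {ω | C * (1 + Real.log (K / δ)) ^ p * RestartedSAVE.rate d K BK VK
            < RestartedSAVE.regret K θ D a ω} ≤ ENNReal.ofReal (3 * δ) := by
  set M : ℝ := (3 + c₁) ^ 2 with hMdef
  have hM : 1 ≤ M := one_le_pow₀ (by linarith)
  have hM0 : 0 < M := by linarith
  set C₁ := RestartedSAVE.typicalConstant A R B c₀ M with hC₁
  set C₂ := RestartedSAVE.trivialConstant A R B c₀ M with hC₂
  have hC₁0 : 0 ≤ C₁ := RestartedSAVE.typicalConstant_nonneg hA hR hB hc₀ hM0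
  have hC₂0 : 0 < C₂ := RestartedSAVE.trivialConstant_pos hc₀ hM0
  -- Four logarithms: one from the confidence radius, two from the number of layers and the
  -- elliptical potential, one from the bound on the squared noises. The summand `2 * C₂` covers the
  -- degenerate case, where the regret is at most `2 K`.
  refine ⟨C₁ + 2 * C₂, 4, by linarith, ?_⟩
  intro d K BK VK δ hd hK hBK hVK hδ hδ1 Ω _ μ _ θ D a ε σ hE hplay
  have hG := RestartedSAVE.goodParameters hc₀ hc₁ hd hK hBK hVK
  rw [← hMdef] at hG
  set w := RestartedSAVE.window d K BK VK
  set α := RestartedSAVE.alpha d K BK VK w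
  set T := RestartedSAVE.rate d K BK VK
  set x := 1 + Real.log (K / δ) with hx
  have hw1 : 1 ≤ w := by exact_mod_cast hG.one_le_w
  have hT : 0 ≤ T :=
    nonneg_of_mul_nonneg_right (le_trans (by positivity) hG.windows_le : 0 ≤ M * T) hM0
  have hU : 0 ≤ x ^ 4 * T := mul_nonneg (Even.pow_nonneg (by decide) x) hT
  by_cases hno : C₂ * (x ^ 4 * T) < K
  · obtain ⟨hwK, hα1, hhigh, hBR⟩ := RestartedSAVE.parameters_of_not_trivial hG hB hR hc₀ hM hd hK
      hBK.1 hδ hδ1 hno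
    have hL := (RestartedSAVE.numLayers_bounds hG.alpha_pos hα1).1
    have hι : 1 ≤ Real.log (4 * (w : ℝ) ^ 2 * RestartedSAVE.numLayers α / δ) := by
      have hw1' : (1 : ℝ) ≤ w := by exact_mod_cast hw1
      have hL1 : (1 : ℝ) ≤ RestartedSAVE.numLayers α := by exact_mod_cast hL
      rw [Real.le_log_iff_exp_le (by positivity)]
      calc Real.exp 1 ≤ 4 * 1 ^ 2 * 1 := by linarith [Real.exp_one_lt_d9]
        _ ≤ 4 * (w : ℝ) ^ 2 * RestartedSAVE.numLayers α := by gcongr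
        _ ≤ _ := le_div_self (by positivity) hδ hδ1.le
    refine (measure_mono fun ω hω htyp => ?_).trans (RestartedSAVE.measure_not_isTypical_le hE hR hK
      hδ hδ1 (RestartedSAVE.reward θ a ε) hw1 hL hι)
    have h1 := RestartedSAVE.regret_le_of_isTypical hE hG hA hR hB hc₀ hM hd hK hVK.1 hδ hδ1 hwK
      hα1 hhigh hBR hι (hplay ω) htyp
    have h2 : (C₁ + 2 * C₂) * x ^ 4 * T < RestartedSAVE.regret K θ D a ω := hω
    rw [← hC₁, ← hx] at h1
    nlinarith
  · have hempty : {ω | (C₁ + 2 * C₂) * x ^ 4 * T < RestartedSAVE.regret K θ D a ω} = ∅ := by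
      refine Set.eq_empty_iff_forall_notMem.2 fun ω hω => ?_
      have h1 := RestartedSAVE.regret_le_two_mul (θ := θ) (D := D) (a := a) (ω := ω)
        (fun k hk => (hplay ω k hk).1) fun k hk => hE.mean_mem k hk ω
      have h2 : (C₁ + 2 * C₂) * x ^ 4 * T < RestartedSAVE.regret K θ D a ω := hω
      have h3 := mul_nonneg hC₁0 hU
      linarith
    rw [hempty, measure_empty]
    exact bot_le
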